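/- All graphs are undirected and loopless. On the vertex set $\mathbb N\times\{0,1\}$ put $A=\mathbb N\times\{0\}$, $B=\mathbb N\times\{1\}$. * $G_0,G_1,G_2$ have vertex set $A\cup B$, with $A$ and $B$ independent; $(i,0)$ is adjacent to $(j,1)$ iff $i\neq j$ (for $G_0$), $i\le j$ (for $G_1$), $j\in\{i,i+1\}$ (for $G_2$). * $G_3$ has vertex set $A\cup B\cup\{c\}$; $A$ and $B$ are independent, $(i,0)\sim(j,1)$ iff $i=j$, and $c$ is adjacent exactly to all the vertices of $B$. * $G_4$ has vertex set $A\cup B$; $A$ is a clique, $B$ is independent, and $(i,0)\sim(j,1)$ iff $i=j$. * $G_5$ (resp. $G_5'$) has vertex set $A\cup B\cup\{c\}$; $A$ is a clique, $B$ is independent, $(i,0)\sim(j,1)$ iff $i\le j$ (resp. $i\ge j$), and $c$ is adjacent exactly to all the vertices of $B$. * $G_6$ (resp. $G_6'$) has vertex set $A\cup B\cup\{a,b\}$; $A$ is a clique, $B$ is independent, $(i,0)\sim(j,1)$ iff $i\le j$ (resp. $i\ge j$), $a$ is adjacent exactly to $b$ and to all the vertices of $A$, and $b$ is adjacent only to $a$.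 Let $\mathcal L=\{G_0,G_1,G_2,G_3,\overline{G_0},\overline{G_1},\overline{G_2},\overline{G_3},G_4,G_5,G_5',G_6,G_6',\overline{G_4},\overline{G_6},\overline{G_6'}\}$, where $\overline G$ is the complement of $G$. The age of a graph $G$ is the set of isomorphism types of its finite induced subgraphs, its profile $\varphi_G(n)$ is the number of members of the age with $n$ vertices, and $F_G(x)=\sum_{n\ge0}\varphi_G(n)x^n$, a formal power series over $\mathbb Q$. Write $\varphi_i=\varphi_{G_i}$, and $f\sim g$ for asymptotic equivalence as $n\to\infty$. **Theorem.** The generating functions $F_G$, $G\in\mathcal L$, are exactly $F_{G_0},\dots,F_{G_6}$; more precisely $F_{\overline{G_i}}=F_{G_i}$ for $i=0,1,2,3,4,6$, $F_{G_5'}=F_{G_5}$ and $F_{G_6'}=F_{\overline{G_6'}}=F_{G_6}$. Moreover: 1. $F_{G_0}(x)=\dfrac{1-x^2+x^3+2x^4-2x^5-x^6+x^7}{(1-x)(1-x^2)^2}$ and $\varphi_0(n)\sim \dfrac{n^2}{8}$; 2. $F_{G_1}(x)=\dfrac{1-x-2x^2+x^3}{(1-2x)(1-2x^2)}$ and $\varphi_1(n)\sim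 \dfrac{2^n}{4}$; 3. $F_{G_2}(x)=\prod_{k\ge1}\dfrac1{1-x^k}$ and $\varphi_2(n)=\mathbf p(n)$ for all $n$, where $\mathbf p(n)$ is the number of partitions of the integer $n$; 4. $F_{G_3}(x)=\dfrac{1-x+x^3+x^4-x^6}{(1-x)^2(1-x^2)}$ and $\varphi_3(n)\sim \dfrac{n^2}{4}$; 5. $F_{G_4}(x)=\dfrac{1-x+2x^3-x^5}{(1-x)^3(1+x)}$ and $\varphi_4(n)\sim \dfrac{n^2}{4}$; 6. $F_{G_5}(x)=\dfrac{1-2x+x^2+3x^4+x^5+2x^6}{(1-x)(1-2x)}$ and $\varphi_5(n)\sim 2^n$; 7. $F_{G_6}(x)=\dfrac{1-3x+3x^2-x^3+x^4}{(1-2x)(1-x)^2}$ and $\varphi_6(n)\sim 3\cdot 2^{n-2}$. These seven generating functions are pairwise distinct. All of them except $F_{G_2}$ are rational (a quotient $P/Q$ of polynomials over $\mathbb Q$ with $Q(0)\ne0$), and $F_{G_2}$ is not. For $i=0,3,4$ the profile $\varphi_i$ has polynomial growth of power $2$ (the same order of growth as $n^2$) and is a quasi-polynomial of degree $2$: for all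 sufficiently large $n$, $\varphi_i(n)=b_2(n)n^2+b_1(n)n+b_0(n)$ with periodic functions $b_0,b_1,b_2:\mathbb N\to\mathbb Q$, $b_2\not\equiv0$. For $i=1,5,6$ the profile has exponential growth (the same order of growth as $c^n$ for some $c>1$). The profile $\varphi_2$ is subexponential: $\varphi_2(n)=o(c^n)$ for every $c>1$. -/

import Mathlib

open Filter Asymptotics

namespace GraphAge

/-! ### Isomorphism types, ages, profiles, generating functions -/

/-- Isomorphism of graphs on `{0, …, n - 1}`. -/
def isoSetoid (n : ℕ) : Setoid (SimpleGraph (Fin n)) where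
  r H K := Nonempty (H ≃g K)
  iseqv :=
    ⟨fun _ => ⟨SimpleGraph.Iso.refl⟩, fun ⟨f⟩ => ⟨f.symm⟩, fun ⟨f⟩ ⟨g⟩ => ⟨f.trans g⟩⟩

/-- Isomorphism types of graphs with `n` vertices. -/
abbrev IsoType (n : ℕ) : Type := Quotient (isoSetoid n)

/-- Classes of finite graphs considered up to isomorphism: sets of isomorphism types. -/
abbrev GraphClass : Type := Set (Σ n : ℕ, IsoType n)

/-- The age of `G`: the set of isomorphism types of the restrictions of `G` to the finite
subsets of its vertex set. -/
def age {V : Type*} (G : SimpleGraph V) : GraphClass :=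
  {t | ∃ (A : Finset V) (H : SimpleGraph (Fin t.1)),
    Nonempty (H ≃g G.induce (A : Set V)) ∧ Quotient.mk (isoSetoid t.1) H = t.2}

/-- The profile of a class: the number of its members with `n` vertices, up to isomorphism.
There are only finitely many isomorphism types with `n` vertices. -/
noncomputable def profile (C : GraphClass) (n : ℕ) : ℕ :=
  {t : IsoType n | (⟨n, t⟩ : Σ n : ℕ, IsoType n) ∈ C}.ncard

/-- The (ordinary) generating function `∑ φ(n) xⁿ` of a class. -/
noncomputable def genFun (C : GraphClass) : PowerSeries ℚ :=
  PowerSeries.mk fun n => (profile C n : ℚ)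

/-! ### Types of sequences and series -/

/-- A power series over `ℚ` is rational if it is `P / Q` with `P, Q` polynomials, `Q(0) ≠ 0`. -/
def IsRational (F : PowerSeries ℚ) : Prop :=
  ∃ P Q : Polynomial ℚ, Q.coeff 0 ≠ 0 ∧ F = (P : PowerSeries ℚ) * (Q : PowerSeries ℚ)⁻¹

/-- `f` is a quasi-polynomial of degree `k`: for all large `n`,
`f n = b_k(n) n ^ k + ⋯ + b_1(n) n + b_0(n)` with periodic `b_i` and `b_k` not identically zero. -/
def IsQuasiPolynomial (k : ℕ) (f : ℕ → ℕ) : Prop :=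
  ∃ b : ℕ → ℕ → ℚ,
    (∀ i ≤ k, ∃ p : ℕ, 0 < p ∧ Function.Periodic (b i) p) ∧
    (∃ n, b k n ≠ 0) ∧
    ∀ᶠ n : ℕ in atTop, (f n : ℚ) = ∑ i ∈ Finset.range (k + 1), b i n * (n : ℚ) ^ i

/-- Polynomial growth of power `k`: `f` has the same order of growth as `n ^ k`. -/
def HasPolynomialGrowth (k : ℕ) (f : ℕ → ℕ) : Prop :=
  (fun n => (f n : ℝ)) =Θ[atTop] fun n : ℕ => (n : ℝ) ^ k

/-- Exponential growth: `f` has the same order of growth as `c ^ n` for some constant `c > 1`. -/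
def HasExponentialGrowth (f : ℕ → ℕ) : Prop :=
  ∃ c : ℝ, 1 < c ∧ (fun n => (f n : ℝ)) =Θ[atTop] fun n : ℕ => c ^ n

/-- Subexponential growth: `f` is negligible compared with `c ^ n` for every `c > 1`. -/
def HasSubexponentialGrowth (f : ℕ → ℕ) : Prop :=
  ∀ c : ℝ, 1 < c → (fun n => (f n : ℝ)) =o[atTop] fun n : ℕ => c ^ n

/-! ### The graphs

`SimpleGraph.fromRel r` joins distinct `u, v` when `r u v` or `r v u`. -/

/-- On `ℕ × {0, 1}`: both `ℕ × {0}` and `ℕ × {1}` are independent, and `(i, 0)` is joined to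
`(j, 1)` if and only if `R i j`. -/
def bip (R : ℕ → ℕ → Prop) : SimpleGraph (ℕ × Fin 2) :=
  SimpleGraph.fromRel fun u v => u.2 = 0 ∧ v.2 = 1 ∧ R u.1 v.1

/-- On `ℕ × {0, 1}`: `ℕ × {0}` is a clique, `ℕ × {1}` is independent, and `(i, 0)` is joined to
`(j, 1)` if and only if `R i j`. -/
def split (R : ℕ → ℕ → Prop) : SimpleGraph (ℕ × Fin 2) :=
  SimpleGraph.fromRel fun u v => u.2 = 0 ∧ (v.2 = 0 ∨ (v.2 = 1 ∧ R u.1 v.1))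

/-- Add to `G` a vertex `c`, joined exactly to all the vertices `(j, 1)`. -/
def addC (G : SimpleGraph (ℕ × Fin 2)) : SimpleGraph ((ℕ × Fin 2) ⊕ Unit) :=
  SimpleGraph.fromRel fun u v =>
    match u, v with
    | .inl u, .inl v => G.Adj u v
    | .inr _, .inl v => v.2 = 1
    | _, _ => False

/-- Add to `G` two vertices `a = inr 0` and `b = inr 1`; `a` is joined to `b` and to all the
vertices `(i, 0)`, and there are no other new edges. -/
def addAB (G : SimpleGraph (ℕ × Fin 2)) : SimpleGraph ((ℕ × Fin 2) ⊕ Fin 2) :=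
  SimpleGraph.fromRel fun u v =>
    match u, v with
    | .inl u, .inl v => G.Adj u v
    | .inr x, .inl v => x = 0 ∧ v.2 = 0
    | .inr x, .inr y => x = 0 ∧ y = 1
    | _, _ => False

def G0 : SimpleGraph (ℕ × Fin 2) := bip fun i j => i ≠ j

/-- The half-complete bipartite graph. -/
def G1 : SimpleGraph (ℕ × Fin 2) := bip fun i j => i ≤ j

/-- The one-way infinite path. -/
def G2 : SimpleGraph (ℕ × Fin 2) := bip fun i j => j = i ∨ j = i + 1

/-- The spider. -/
def G3 : SimpleGraph ((ℕ × Fin 2) ⊕ Unit) := addC (bip fun i j => i = j)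

def G4 : SimpleGraph (ℕ × Fin 2) := split fun i j => i = j

def G5 : SimpleGraph ((ℕ × Fin 2) ⊕ Unit) := addC (split fun i j => i ≤ j)

def G5' : SimpleGraph ((ℕ × Fin 2) ⊕ Unit) := addC (split fun i j => i ≥ j)

def G6 : SimpleGraph ((ℕ × Fin 2) ⊕ Fin 2) := addAB (split fun i j => i ≤ j)

def G6' : SimpleGraph ((ℕ × Fin 2) ⊕ Fin 2) := addAB (split fun i j => i ≥ j)

/-- The family `G_0, …, G_6`. -/
def graphFamily : Fin 7 → Σ V : Type, SimpleGraph V :=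
  ![⟨_, G0⟩, ⟨_, G1⟩, ⟨_, G2⟩, ⟨_, G3⟩, ⟨_, G4⟩, ⟨_, G5⟩, ⟨_, G6⟩]

/-- The list `𝓛` of sixteen graphs. -/
def graphList : Set (Σ V : Type, SimpleGraph V) :=
  {⟨_, G0⟩, ⟨_, G1⟩, ⟨_, G2⟩, ⟨_, G3⟩,
   ⟨_, G0ᶜ⟩, ⟨_, G1ᶜ⟩, ⟨_, G2ᶜ⟩, ⟨_, G3ᶜ⟩,
   ⟨_, G4⟩, ⟨_, G5⟩, ⟨_, G5'⟩, ⟨_, G6⟩, ⟨_, G6'⟩,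
   ⟨_, G4ᶜ⟩, ⟨_, G6ᶜ⟩, ⟨_, G6'ᶜ⟩}

end GraphAge

open GraphAge
open PowerSeries (X)
open scoped PowerSeries.WithPiTopology

namespace GraphAge

/-! ### Counting the members of an age -/

/-! For each graph one lists the finite induced subgraphs with `n` vertices, one per isomorphism
type, shows through degree invariants that the list has no repetition (`profile_eq_card`), and
counts it. Complementation is a bijection of isomorphism types, so `G` and `Gᶜ` have equal profiles.
For `G5'` and `G6'` the reversal of a finite range of indices turns `≥` into `≤`, which preserves
the age.

`G0`, `G3`, `G4` are invariant under all permutations of the indices. A finite set of vertices is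
then known by the number `p` of indices used on both sides and the numbers `a`, `b` of indices used
on one side only (`exists_perm_matchPos`). The sums of the degrees and of their squares separate
these parameters once a few coincidences are removed, and the counts are quadratic with period two.

`G1`, `G5`, `G6` come from the order relation. When the vertices are listed as `(0, 0), (0, 1), (1,
0), …`, a restriction depends only on the word of sides that is read along it. For `split (· ≤ ·)`
these are the threshold graphs, and a word is determined up to its last letter. The graphs of `G5`
and `G6` are the threshold graphs together with the restrictions through the additional vertices
that are not threshold; for `G6` the exceptions are the words `1…10…0`, for `G5` the words that are
constant up to the last letter and two further coincidences (`eq_or_isSpecialWord`). For `G1` a word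
matters up to isolated vertices and up to the flip that exchanges the sides, so the profile is a sum
of numbers of words modulo an involution (`eq_or_eq_flipWord`, `card_halfWords`).

`G2` is an infinite path; its finite restrictions are disjoint unions of paths, that is, partitions.
By Euler's pentagonal number theorem the inverse of the partition series has nonzero coefficients
separated by growing gaps, which excludes rationality. The bound `p(n) xⁿ ≤ ∏ (1 - xᵏ)⁻¹` for `0 < x
< 1` gives subexponential growth.

The closed forms of the other profiles yield recurrences, hence the rational series, and the
asymptotics. -/

theorem mem_age_iff {V : Type*} {G : SimpleGraph V} {n : ℕ} {H : SimpleGraph (Fin n)} :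
    (⟨n, Quotient.mk (isoSetoid n) H⟩ : Σ n, IsoType n) ∈ age G ↔ Nonempty (H ↪g G) := by
  classical
  constructor
  · rintro ⟨A, K, ⟨e⟩, h⟩
    obtain ⟨f⟩ : Nonempty (K ≃g H) := Quotient.exact h
    exact ⟨(SimpleGraph.Embedding.induce _).comp (f.symm.trans e).toRelEmbedding⟩
  · rintro ⟨f⟩
    refine ⟨Finset.univ.map f.toEmbedding, H, ⟨?_⟩, rfl⟩
    refine ⟨Equiv.ofBijective (fun v => ⟨f v, by simp⟩) ⟨fun v w h => ?_, ?_⟩, ?_⟩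
    · simpa using h
    · rintro ⟨v, hv⟩
      obtain ⟨w, rfl⟩ : ∃ w, f w = v := by simpa using hv
      exact ⟨w, rfl⟩
    · intro v w
      exact f.map_adj_iff

theorem profile_def {V : Type*} (G : SimpleGraph V) (n : ℕ) :
    profile (age G) n =
      (Quotient.mk (isoSetoid n) '' {H : SimpleGraph (Fin n) | Nonempty (H ↪g G)}).ncard := by
  rw [profile]
  congr 1
  ext t
  induction t using Quotient.inductionOn with
  | h H =>
    simp only [Set.mem_ofPred_eq, mem_age_iff, Set.mem_image]
    constructor
    · exact fun h => ⟨H, h, rfl⟩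
    · rintro ⟨K, ⟨g⟩, h⟩
      obtain ⟨f⟩ : Nonempty (K ≃g H) := Quotient.exact h
      exact ⟨f.symm.toEmbedding.trans g⟩

/-- If the graphs `R i` on `n` vertices embed in `G`, are pairwise non-isomorphic, and if every
graph on `n` vertices that embeds in `G` is isomorphic to one of them, then the profile of `G` at
`n` is the number of indices. -/
theorem profile_eq_card {V : Type*} {G : SimpleGraph V} {n : ℕ} {ι : Type*} [Fintype ι]
    {W : ι → Type*} [∀ i, Finite (W i)] (R : ∀ i, SimpleGraph (W i))
    (hW : ∀ i, Nat.card (W i) = n) (hemb : ∀ i, Nonempty (R i ↪g G))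
    (hcover : ∀ H : SimpleGraph (Fin n), (H ↪g G) → ∃ i, Nonempty (H ≃g R i))
    (hinj : ∀ i j, Nonempty (R i ≃g R j) → i = j) :
    profile (age G) n = Fintype.card ι := by
  have := fun i => Fintype.ofFinite (W i)
  simp only [Nat.card_eq_fintype_card] at hW
  rw [profile_def, ← Nat.card_eq_fintype_card, ← Set.ncard_univ,
    ← Set.ncard_image_of_injective (f := fun i => Quotient.mk (isoSetoid n) ((R i).overFin (hW i)))]
  · congr 1
    ext t
    simp only [Set.image_univ, Set.mem_range]
    constructor
    · rintro ⟨H, ⟨f⟩, rfl⟩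
      obtain ⟨i, ⟨e⟩⟩ := hcover H f
      exact ⟨i, Quotient.sound ⟨(e.trans ((R i).overFinIso (hW i))).symm⟩⟩
    · rintro ⟨i, rfl⟩
      obtain ⟨f⟩ := hemb i
      exact ⟨_, ⟨((R i).overFinIso (hW i)).symm.toEmbedding.trans f⟩, rfl⟩
  · intro i j h
    obtain ⟨f⟩ : Nonempty ((R i).overFin (hW i) ≃g (R j).overFin (hW j)) := Quotient.exact h
    exact hinj i j ⟨(((R i).overFinIso (hW i)).trans f).trans ((R j).overFinIso (hW j)).symm⟩

theorem age_subset_of_forall {V V' : Type*} {G : SimpleGraph V} {G' : SimpleGraph V'}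
    (h : ∀ A : Finset V, Nonempty (G.induce (A : Set V) ↪g G')) : age G ⊆ age G' := by
  rintro ⟨n, t⟩ ⟨A, H, he, ht⟩
  have key : ∀ K : SimpleGraph (Fin n), Nonempty (K ≃g G.induce (A : Set V)) →
      Quotient.mk (isoSetoid n) K = t → (⟨n, t⟩ : Σ n, IsoType n) ∈ age G' := by
    rintro K ⟨e⟩ rfl
    obtain ⟨f⟩ := h A
    exact mem_age_iff.2 ⟨f.comp e.toRelEmbedding⟩
  exact key H he ht

/-- Complementation of embeddings. -/
theorem nonempty_embedding_compl {V W : Type*} {H : SimpleGraph W} {G : SimpleGraph V}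
    (h : Nonempty (H ↪g G)) : Nonempty (Hᶜ ↪g Gᶜ) := by
  obtain ⟨f⟩ := h
  refine ⟨⟨f.toEmbedding, fun {v w} => ?_⟩⟩
  simp [SimpleGraph.compl_adj]

theorem nonempty_iso_compl {V W : Type*} {H : SimpleGraph W} {G : SimpleGraph V}
    (h : Nonempty (H ≃g G)) : Nonempty (Hᶜ ≃g Gᶜ) := by
  obtain ⟨f⟩ := h
  refine ⟨⟨f.toEquiv, fun {v w} => ?_⟩⟩
  have : G.Adj (f v) (f w) ↔ H.Adj v w := f.map_adj_iff
  simp [SimpleGraph.compl_adj, this]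

/-- Complementation respects embeddings and is injective on isomorphism types; applied to `G` and to
`Gᶜ` it gives equality of the two profiles. -/
theorem profile_compl_le {V : Type*} (G : SimpleGraph V) (n : ℕ) :
    profile (age G) n ≤ profile (age Gᶜ) n := by
  rw [profile_def, profile_def]
  refine Set.ncard_le_ncard_of_injOn (Quotient.map (· ᶜ) fun _ _ h => nonempty_iso_compl h) ?_ ?_
    (Set.toFinite _)
  · rintro _ ⟨H, hH, rfl⟩
    exact ⟨Hᶜ, nonempty_embedding_compl hH, rfl⟩
  · rintro _ ⟨H, -, rfl⟩ _ ⟨K, -, rfl⟩ h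
    have := nonempty_iso_compl (Quotient.exact h : Nonempty (Hᶜ ≃g Kᶜ))
    rw [compl_compl, compl_compl] at this
    exact Quotient.sound this

theorem profile_compl {V : Type*} (G : SimpleGraph V) (n : ℕ) :
    profile (age Gᶜ) n = profile (age G) n := by
  refine le_antisymm ?_ (profile_compl_le G n)
  simpa using profile_compl_le Gᶜ n

theorem genFun_compl {V : Type*} (G : SimpleGraph V) : genFun (age Gᶜ) = genFun (age G) := by
  simp only [genFun, profile_compl]

/-- An induced subgraph depends only on its vertex set, so identifying a restriction reduces to
bringing its set of vertices to a standard one. -/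
theorem nonempty_iso_of_range_eq {V U W : Type*} {G : SimpleGraph V} {H : SimpleGraph U}
    {K : SimpleGraph W} (f : H ↪g G) (k : K ↪g G) (h : Set.range f = Set.range k) :
    Nonempty (H ≃g K) := by
  let e : U ≃ W := (Equiv.ofInjective f f.injective).trans
    ((Equiv.setCongr h).trans (Equiv.ofInjective k k.injective).symm)
  have he : ∀ u, k (e u) = f u := fun u => by
    have := Equiv.apply_ofInjective_symm k.injective ((Equiv.setCongr h) ⟨f u, u, rfl⟩)
    simpa [e] using this
  refine ⟨⟨e, fun {u v} => ?_⟩⟩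
  rw [← k.map_adj_iff, he, he, f.map_adj_iff]

theorem nonempty_iso_of_injective {V W : Type*} [Fintype V] [Fintype W] {H : SimpleGraph V}
    {K : SimpleGraph W} (e : V → W) (he : Function.Injective e)
    (hc : Fintype.card V = Fintype.card W) (h : ∀ v w, K.Adj (e v) (e w) ↔ H.Adj v w) :
    Nonempty (H ≃g K) :=
  ⟨⟨Equiv.ofBijective e ((Fintype.bijective_iff_injective_and_card e).2 ⟨he, hc⟩), h _ _⟩⟩

/-- An embedding that avoids the additional vertices. -/
theorem nonempty_embedding_comap_inl {V E U : Type*} {G : SimpleGraph (V ⊕ E)}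
    {H : SimpleGraph U} (f : H ↪g G) (hf : ∀ z, Sum.inr z ∉ Set.range f) :
    Nonempty (H ↪g G.comap Sum.inl) := by
  have h : ∀ v, ∃ u, f v = Sum.inl u := by
    intro v
    rcases hv : f v with u | z
    · exact ⟨u, rfl⟩
    · exact (hf z ⟨v, hv⟩).elim
  choose g hg using h
  refine ⟨⟨⟨g, fun v w h => f.injective (by rw [hg, hg, h])⟩, fun {v w} => ?_⟩⟩
  rw [← f.map_adj_iff, hg, hg]
  rfl

/-! ### Degrees -/

open Classical in
/-- The degree of a vertex, as a sum. -/
noncomputable def vdeg {V : Type*} [Fintype V] (H : SimpleGraph V) (v : V) : ℕ :=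
  ∑ w, if H.Adj v w then 1 else 0

theorem vdeg_iso {V W : Type*} [Fintype V] [Fintype W] {H : SimpleGraph V} {K : SimpleGraph W}
    (f : H ≃g K) (v : V) : vdeg K (f v) = vdeg H v := by
  classical
  rw [vdeg, vdeg, ← f.toEquiv.sum_comp]
  refine Finset.sum_congr rfl fun w _ => ?_
  have : K.Adj (f v) (f w) ↔ H.Adj v w := f.map_adj_iff
  simp [this]

/-- The multiset of degrees. -/
noncomputable def degs {V : Type*} [Fintype V] (H : SimpleGraph V) : Multiset ℕ :=
  Finset.univ.val.map (vdeg H)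

theorem degs_iso {V W : Type*} [Fintype V] [Fintype W] {H : SimpleGraph V} {K : SimpleGraph W}
    (f : H ≃g K) : degs K = degs H := by
  classical
  rw [degs, degs, ← Finset.map_univ_equiv f.toEquiv, Finset.map_val, Multiset.map_map]
  exact Multiset.map_congr rfl fun v _ => vdeg_iso f v

theorem sum_vdeg_iso {V W : Type*} [Fintype V] [Fintype W] {H : SimpleGraph V}
    {K : SimpleGraph W} (f : H ≃g K) (F : ℕ → ℕ) : ∑ v, F (vdeg K v) = ∑ v, F (vdeg H v) := by
  rw [← f.toEquiv.sum_comp]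
  exact Finset.sum_congr rfl fun v _ => congrArg F (vdeg_iso f v)

/-! ### Adjacency in the standard graphs -/

variable {R : ℕ → ℕ → Prop}

@[simp] theorem bip_adj_zero_one {i j : ℕ} : (bip R).Adj (i, 0) (j, 1) ↔ R i j := by
  simp [bip]

@[simp] theorem bip_adj_one_zero {i j : ℕ} : (bip R).Adj (i, 1) (j, 0) ↔ R j i := by
  simp [bip]

@[simp] theorem bip_adj_same {i j : ℕ} {x : Fin 2} : ¬ (bip R).Adj (i, x) (j, x) := by
  revert x; simp [bip, Fin.forall_fin_two]

@[simp] theorem split_adj_zero_one {i j : ℕ} : (split R).Adj (i, 0) (j, 1) ↔ R i j := by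
  simp [split]

@[simp] theorem split_adj_one_zero {i j : ℕ} : (split R).Adj (i, 1) (j, 0) ↔ R j i := by
  simp [split]

@[simp] theorem split_adj_zero_zero {i j : ℕ} : (split R).Adj (i, 0) (j, 0) ↔ i ≠ j := by
  simp [split]

@[simp] theorem split_adj_one_one {i j : ℕ} : ¬ (split R).Adj (i, 1) (j, 1) := by
  simp [split]

@[simp] theorem addC_inl_inl {G : SimpleGraph (ℕ × Fin 2)} {u v : ℕ × Fin 2} :
    (addC G).Adj (.inl u) (.inl v) ↔ G.Adj u v := by
  simp only [addC, SimpleGraph.fromRel_adj]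
  exact ⟨fun h => h.2.elim id SimpleGraph.Adj.symm, fun h => ⟨by simpa using h.ne, .inl h⟩⟩

@[simp] theorem addC_inr_inl {G : SimpleGraph (ℕ × Fin 2)} {v : ℕ × Fin 2} {x : Unit} :
    (addC G).Adj (.inr x) (.inl v) ↔ v.2 = 1 := by
  simp [addC]

@[simp] theorem addC_inl_inr {G : SimpleGraph (ℕ × Fin 2)} {v : ℕ × Fin 2} {x : Unit} :
    (addC G).Adj (.inl v) (.inr x) ↔ v.2 = 1 := by
  simp [addC]

@[simp] theorem addAB_inl_inl {G : SimpleGraph (ℕ × Fin 2)} {u v : ℕ × Fin 2} :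
    (addAB G).Adj (.inl u) (.inl v) ↔ G.Adj u v := by
  simp only [addAB, SimpleGraph.fromRel_adj]
  exact ⟨fun h => h.2.elim id SimpleGraph.Adj.symm, fun h => ⟨by simpa using h.ne, .inl h⟩⟩

@[simp] theorem addAB_inr_inl {G : SimpleGraph (ℕ × Fin 2)} {v : ℕ × Fin 2} {x : Fin 2} :
    (addAB G).Adj (.inr x) (.inl v) ↔ x = 0 ∧ v.2 = 0 := by
  simp [addAB]

@[simp] theorem addAB_inl_inr {G : SimpleGraph (ℕ × Fin 2)} {v : ℕ × Fin 2} {x : Fin 2} :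
    (addAB G).Adj (.inl v) (.inr x) ↔ x = 0 ∧ v.2 = 0 := by
  simp [addAB]

@[simp] theorem addAB_inr_inr {G : SimpleGraph (ℕ × Fin 2)} {x y : Fin 2} :
    (addAB G).Adj (.inr x) (.inr y) ↔ x ≠ y := by
  revert x y; simp [addAB, Fin.forall_fin_two]

/-! ### Reversing the order -/


/-- Reversal of the first `N` indices. -/
def flipIdx (N : ℕ) (u : ℕ × Fin 2) : ℕ × Fin 2 := (N - u.1, u.2)

theorem flipIdx_inj {N : ℕ} {u v : ℕ × Fin 2} (hu : u.1 < N) (hv : v.1 < N) :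
    flipIdx N u = flipIdx N v ↔ u = v := by
  obtain ⟨i, x⟩ := u
  obtain ⟨j, y⟩ := v
  simp only [flipIdx, Prod.mk.injEq] at hu hv ⊢
  exact and_congr_left fun _ => by omega

theorem split_adj_flipIdx {r s : ℕ → ℕ → Prop} {N : ℕ}
    (h : ∀ i < N, ∀ j < N, (s (N - i) (N - j) ↔ r i j)) {u v : ℕ × Fin 2} (hu : u.1 < N)
    (hv : v.1 < N) : (split s).Adj (flipIdx N u) (flipIdx N v) ↔ (split r).Adj u v := by
  obtain ⟨i, x⟩ := u
  obtain ⟨j, y⟩ := v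
  simp only at hu hv
  have h3 := h i hu j hv
  have h4 := h j hv i hu
  obtain rfl | rfl : x = 0 ∨ x = 1 := by omega
  all_goals obtain rfl | rfl : y = 0 ∨ y = 1 := by omega
  · simp only [flipIdx, split_adj_zero_zero]
    omega
  all_goals simp [flipIdx, h3, h4]

theorem exists_forall_inl_lt {E : Type*} (A : Finset ((ℕ × Fin 2) ⊕ E)) :
    ∃ N, ∀ v ∈ A, ∀ u, v = .inl u → u.1 < N := by
  classical
  refine ⟨A.sup (Sum.elim (fun u => u.1 + 1) fun _ => 0), fun v hv u hu => ?_⟩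
  have := Finset.le_sup (f := Sum.elim (fun u : ℕ × Fin 2 => u.1 + 1) fun _ => 0) hv
  rw [hu] at this
  simpa [Nat.succ_le_iff] using this

/-- Reversing the indices embeds the finite restrictions of one graph into another. -/
theorem age_subset_of_flip {E : Type*} {G G' : SimpleGraph ((ℕ × Fin 2) ⊕ E)}
    (h1 : ∀ N u v, u.1 < N → v.1 < N →
      (G'.Adj (.inl (flipIdx N u)) (.inl (flipIdx N v)) ↔ G.Adj (.inl u) (.inl v)))
    (h2 : ∀ N u x, G'.Adj (.inl (flipIdx N u)) (.inr x) ↔ G.Adj (.inl u) (.inr x))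
    (h3 : ∀ x y, G'.Adj (.inr x) (.inr y) ↔ G.Adj (.inr x) (.inr y)) : age G ⊆ age G' := by
  refine age_subset_of_forall fun A => ?_
  obtain ⟨N, hN⟩ := exists_forall_inl_lt A
  refine ⟨⟨⟨fun v => Sum.map (flipIdx N) id v.1, ?_⟩, ?_⟩⟩
  · rintro ⟨u | x, hu⟩ ⟨v | y, hv⟩ huv
    · have := (flipIdx_inj (hN _ hu _ rfl) (hN _ hv _ rfl)).1 (by simpa using huv)
      simp [this]
    all_goals simp_all
  · rintro ⟨u | x, hu⟩ ⟨v | y, hv⟩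
    · simpa using h1 N u v (hN _ hu _ rfl) (hN _ hv _ rfl)
    · simpa using h2 N u y
    · simpa [SimpleGraph.adj_comm] using h2 N v x
    · simpa using h3 x y

/-- A finite restriction uses finitely many indices, and `i ↦ N - i` exchanges `≤` and `≥` on them
without touching the sides or the vertex `c`. -/
theorem age_G5' : age G5' = age G5 := by
  apply Set.Subset.antisymm <;> refine age_subset_of_flip ?_ (by simp [G5, G5', flipIdx]) ?_
  on_goal 2 => simp [G5, G5', addC]
  on_goal 3 => simp [G5, G5', addC]
  all_goals
    intro N u v hu hv
    simp only [G5, G5', addC_inl_inl]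
    exact split_adj_flipIdx (by intros; omega) hu hv

theorem age_G6' : age G6' = age G6 := by
  apply Set.Subset.antisymm <;> refine age_subset_of_flip ?_ (by simp [G6, G6', flipIdx])
    (by simp [G6, G6'])
  all_goals
    intro N u v hu hv
    simp only [G6, G6', addAB_inl_inl]
    exact split_adj_flipIdx (by intros; omega) hu hv


/-! ### Finite subsets of `ℕ × {0, 1}` up to permutations of `ℕ` -/

/-- `p` pairs, `a` single vertices on the side `0` and `b` single vertices on the side `1`. -/
abbrev MatchVert (p a b : ℕ) : Type := (Fin p × Fin 2) ⊕ (Fin a ⊕ Fin b)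

/-- The standard position of `MatchVert p a b` in `ℕ × {0, 1}`. -/
def matchPos (p a b : ℕ) : MatchVert p a b → ℕ × Fin 2
  | .inl (i, x) => (i, x)
  | .inr (.inl i) => (p + i, 0)
  | .inr (.inr j) => (p + a + j, 1)

theorem matchPos_injective (p a b : ℕ) : Function.Injective (matchPos p a b) := by
  rintro (⟨i, x⟩ | i | i) (⟨j, y⟩ | j | j) h <;>
    simp only [matchPos, Prod.mk.injEq, Sum.inl.injEq, Sum.inr.injEq, Fin.ext_iff, reduceCtorEq]
      at h ⊢ <;> omega

theorem mem_range_matchPos {p a b i : ℕ} {x : Fin 2} :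
    (i, x) ∈ Set.range (matchPos p a b) ↔
      (x = 0 ∧ i < p + a) ∨ (x = 1 ∧ (i < p ∨ (p + a ≤ i ∧ i < p + a + b))) := by
  constructor
  · rintro ⟨(⟨j, y⟩ | j | j), h⟩ <;> simp only [matchPos, Prod.mk.injEq] at h <;>
      obtain ⟨rfl, rfl⟩ := h <;> omega
  · rintro (⟨rfl, h⟩ | ⟨rfl, h | h⟩)
    · rcases lt_or_ge i p with hp | hp
      · exact ⟨.inl (⟨i, hp⟩, 0), rfl⟩
      · exact ⟨.inr (.inl ⟨i - p, by omega⟩), by simp only [matchPos, Nat.add_sub_cancel' hp]⟩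
    · exact ⟨.inl (⟨i, h⟩, 1), rfl⟩
    · exact ⟨.inr (.inr ⟨i - (p + a), by omega⟩), by simp only [matchPos, Nat.add_sub_cancel' h.1]⟩

theorem card_matchVert (p a b : ℕ) : Fintype.card (MatchVert p a b) = 2 * p + a + b := by
  simp; omega

open Classical in
/-- The colour of an index: which of the two vertices above it belong to `T`. -/
noncomputable def idxColor (T : Set (ℕ × Fin 2)) (i : ℕ) : Bool × Bool :=
  (decide ((i, 0) ∈ T), decide ((i, 1) ∈ T))

theorem nonempty_equiv_of_ncard_eq {α β : Type*} {s : Set α} {t : Set β} (hs : s.Finite)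
    (ht : t.Finite) (h : s.ncard = t.ncard) : Nonempty (s ≃ t) := by
  have := hs.to_subtype
  have := ht.to_subtype
  exact Finite.card_eq.1 h

/-- Up to a permutation of the indices, a finite set of vertices is in standard position. -/
theorem exists_perm_matchPos {T : Set (ℕ × Fin 2)} (hT : T.Finite) :
    ∃ (p a b : ℕ) (π : ℕ ≃ ℕ), ∀ i x, (π i, x) ∈ Set.range (matchPos p a b) ↔ (i, x) ∈ T := by
  classical
  set c := idxColor T with hc
  have hfin : ∀ k, k ≠ (false, false) → {i | c i = k}.Finite := by
    intro k hk
    refine (hT.image Prod.fst).subset fun i hi => ?_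
    have hi' : c i = k := hi
    by_contra h
    simp only [Set.mem_image, Prod.exists, exists_and_right, exists_eq_right, not_exists] at h
    exact hk (by rw [← hi']; simp [hc, idxColor, h])
  set p := {i | c i = (true, true)}.ncard with hp
  set a := {i | c i = (true, false)}.ncard with ha
  set b := {i | c i = (false, true)}.ncard with hb
  set d := idxColor (Set.range (matchPos p a b)) with hd
  have h1 : {i | d i = (true, true)} = Set.Iio p := by
    ext i; simp [hd, idxColor, mem_range_matchPos, -Set.mem_range]; omega
  have h2 : {i | d i = (true, false)} = Set.Ico p (p + a) := by
    ext i; simp [hd, idxColor, mem_range_matchPos, -Set.mem_range]; omega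
  have h3 : {i | d i = (false, true)} = Set.Ico (p + a) (p + a + b) := by
    ext i; simp [hd, idxColor, mem_range_matchPos, -Set.mem_range]; omega
  -- The three nonempty colours have finite fibres of prescribed sizes. The indices without any
  -- vertex form a countably infinite fibre on both sides, so bijections of the four fibres glue to
  -- a permutation of `ℕ`.
  have hinf : ∀ e : ℕ → Bool × Bool, (∀ k, k ≠ (false, false) → {i | e i = k}.Finite) →
      {i | e i = (false, false)}.Infinite := by
    intro e he hf
    refine Set.infinite_univ (α := ℕ) (((hf.union (he (true, true) (by simp))).union
      ((he (true, false) (by simp)).union (he (false, true) (by simp)))).subset fun i _ => ?_)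
    simp only [Set.mem_union, Set.mem_ofPred_eq]
    rcases e i with ⟨_ | _, _ | _⟩ <;> simp
  have hfib : ∀ k, Nonempty ({i // c i = k} ≃ {i // d i = k}) := by
    rintro ⟨_ | _, _ | _⟩
    · have := (hinf c hfin).to_subtype
      have := (hinf d (by
        rintro ⟨_ | _, _ | _⟩ hk
        · exact (hk rfl).elim
        · rw [h3]; exact Set.finite_Ico _ _
        · rw [h2]; exact Set.finite_Ico _ _
        · rw [h1]; exact Set.finite_Iio _)).to_subtype
      exact nonempty_equiv_of_countable (α := {i | c i = (false, false)})
        (β := {i | d i = (false, false)})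
    · refine nonempty_equiv_of_ncard_eq (s := {i | c i = (false, true)})
        (t := {i | d i = (false, true)}) (hfin _ (by simp)) ?_ ?_ <;> rw [h3]
      · exact Set.finite_Ico _ _
      · rw [← hb]; simp [Set.ncard_eq_toFinset_card']
    · refine nonempty_equiv_of_ncard_eq (s := {i | c i = (true, false)})
        (t := {i | d i = (true, false)}) (hfin _ (by simp)) ?_ ?_ <;> rw [h2]
      · exact Set.finite_Ico _ _
      · rw [← ha]; simp [Set.ncard_eq_toFinset_card']
    · refine nonempty_equiv_of_ncard_eq (s := {i | c i = (true, true)})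
        (t := {i | d i = (true, true)}) (hfin _ (by simp)) ?_ ?_ <;> rw [h1]
      · exact Set.finite_Iio _
      · rw [← hp]; simp [Set.ncard_eq_toFinset_card']
  let F' : ∀ k, {i // c i = k} ≃ {i // d i = k} := fun k => Classical.choice (hfib k)
  obtain ⟨π, hπ'⟩ : ∃ π : ℕ ≃ ℕ, ∀ i, d (π i) = c i :=
    ⟨Equiv.ofFiberEquiv F', Equiv.ofFiberEquiv_map F'⟩
  refine ⟨p, a, b, π, fun i x => ?_⟩
  have hπ := hπ' i
  rw [hd, hc, idxColor, idxColor, Prod.mk.injEq] at hπ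
  obtain rfl | rfl : x = 0 ∨ x = 1 := by omega
  · simpa only [decide_eq_decide] using hπ.1
  · simpa only [decide_eq_decide] using hπ.2

/-- The finite restrictions of a graph on `ℕ × {0, 1}` that is invariant under the permutations
of the indices. -/
theorem exists_iso_comap_matchPos {G : SimpleGraph (ℕ × Fin 2)}
    (hG : ∀ (π : ℕ ≃ ℕ) i x j y, G.Adj (π i, x) (π j, y) ↔ G.Adj (i, x) (j, y))
    {U : Type*} [Fintype U] {H : SimpleGraph U} (f : H ↪g G) :
    ∃ p a b, 2 * p + a + b = Fintype.card U ∧ Nonempty (H ≃g G.comap (matchPos p a b)) := by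
  obtain ⟨p, a, b, π, hπ⟩ := exists_perm_matchPos (Set.finite_range f)
  let g : G ↪g G := ⟨(π.prodCongr (Equiv.refl _)).toEmbedding, fun {u v} => hG π u.1 u.2 v.1 v.2⟩
  obtain ⟨e⟩ := nonempty_iso_of_range_eq (g.comp f)
    (SimpleGraph.Embedding.comap ⟨matchPos p a b, matchPos_injective p a b⟩ G) (by
      ext ⟨i, x⟩
      have := hπ (π.symm i) x
      rw [Equiv.apply_symm_apply] at this
      refine Iff.trans ?_ this.symm
      constructor
      · rintro ⟨v, hv⟩
        refine ⟨v, ?_⟩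
        have h1 : π (f v).1 = i := congrArg Prod.fst hv
        have h2 : (f v).2 = x := congrArg Prod.snd hv
        rw [← h1, ← h2, Equiv.symm_apply_apply]
      · rintro ⟨v, hv⟩
        refine ⟨v, ?_⟩
        change (π (f v).1, (f v).2) = (i, x)
        rw [hv, Equiv.apply_symm_apply])
  refine ⟨p, a, b, ?_, ⟨e⟩⟩
  rw [← card_matchVert, Fintype.card_congr e.toEquiv]

/-- The same with additional vertices, all of which are used. -/
theorem exists_iso_comap_sumMap_matchPos {E : Type*} [Fintype E]
    {G : SimpleGraph ((ℕ × Fin 2) ⊕ E)}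
    (hG : ∀ (π : ℕ ≃ ℕ) i x j y,
      G.Adj (.inl (π i, x)) (.inl (π j, y)) ↔ G.Adj (.inl (i, x)) (.inl (j, y)))
    (hG' : ∀ (π : ℕ ≃ ℕ) i x z, G.Adj (.inl (π i, x)) (.inr z) ↔ G.Adj (.inl (i, x)) (.inr z))
    {U : Type*} [Fintype U] {H : SimpleGraph U} (f : H ↪g G)
    (hf : ∀ z, Sum.inr z ∈ Set.range f) :
    ∃ p a b, 2 * p + a + b + Fintype.card E = Fintype.card U ∧
      Nonempty (H ≃g G.comap (Sum.map (matchPos p a b) (id : E → E))) := by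
  obtain ⟨p, a, b, π, hπ⟩ := exists_perm_matchPos (T := Sum.inl ⁻¹' Set.range f)
    ((Set.finite_range f).preimage Sum.inl_injective.injOn)
  let g : G ↪g G := ⟨((π.prodCongr (Equiv.refl _)).sumCongr (Equiv.refl _)).toEmbedding, by
    rintro (⟨i, x⟩ | z) (⟨j, y⟩ | z')
    · exact hG π i x j y
    · exact hG' π i x z'
    · exact (G.adj_comm _ _).trans ((hG' π j y z).trans (G.adj_comm _ _))
    · exact Iff.rfl⟩
  obtain ⟨e⟩ := nonempty_iso_of_range_eq (g.comp f)
    (SimpleGraph.Embedding.comap ⟨Sum.map (matchPos p a b) (id : E → E),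
      (matchPos_injective p a b).sumMap Function.injective_id⟩ G) (by
      rw [show Set.range (g.comp f) = g '' Set.range f from Set.range_comp g f]
      ext (⟨i, x⟩ | z)
      · have h1 := hπ (π.symm i) x
        rw [Equiv.apply_symm_apply] at h1
        have h2 : (Sum.inl (i, x) : (ℕ × Fin 2) ⊕ E) ∈
            Set.range (Sum.map (matchPos p a b) (id : E → E)) ↔
            (i, x) ∈ Set.range (matchPos p a b) := by simp
        refine Iff.trans ?_ (h2.trans h1).symm
        constructor
        · rintro ⟨⟨j, y⟩ | z, hv, h⟩
          · obtain ⟨rfl, rfl⟩ : π j = i ∧ y = x := by simpa [g] using h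
            simpa using hv
          · simp [g] at h
        · exact fun h => ⟨.inl (π.symm i, x), h, by simp [g]⟩
      · refine iff_of_true ⟨.inr z, hf z, by simp [g]⟩ ⟨.inr z, rfl⟩)
  refine ⟨p, a, b, ?_, ⟨e⟩⟩
  rw [← card_matchVert, ← Fintype.card_sum, Fintype.card_congr e.toEquiv]


/-! ### Degrees in the standard restrictions of `G0`, `G3` and `G4` -/

theorem sum_matchVert {p a b : ℕ} (F : MatchVert p a b → ℕ) :
    ∑ v, F v = (∑ i, F (.inl (i, 0)) + ∑ i, F (.inl (i, 1))) +
      (∑ i, F (.inr (.inl i)) + ∑ i, F (.inr (.inr i))) := by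
  rw [Fintype.sum_sum_type, Fintype.sum_sum_type, Fintype.sum_prod_type]
  simp [Finset.sum_add_distrib]

theorem sum_ite_ne {p : ℕ} (i : Fin p) : (∑ j : Fin p, if i ≠ j then 1 else 0) = p - 1 := by
  rw [Finset.sum_ite, Finset.sum_const_zero, add_zero, Finset.sum_const, smul_eq_mul, mul_one,
    Finset.filter_ne, Finset.card_erase_of_mem (Finset.mem_univ _), Finset.card_univ,
    Fintype.card_fin]

section G0
variable {p a b : ℕ}

theorem G0_vdeg_pair0 (i : Fin p) :
    vdeg (G0.comap (matchPos p a b)) (.inl (i, 0)) = p - 1 + b := by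
  have h : ∀ j : Fin b, ¬ (i : ℕ) = p + a + j := fun j => by omega
  simp only [vdeg, sum_matchVert, matchPos, G0, SimpleGraph.comap_adj, bip_adj_zero_one,
    bip_adj_same, h, ← Fin.ext_iff, ne_eq, not_false_eq_true, if_true, if_false]
  simpa using sum_ite_ne i

theorem G0_vdeg_pair1 (i : Fin p) :
    vdeg (G0.comap (matchPos p a b)) (.inl (i, 1)) = p - 1 + a := by
  have h : ∀ j : Fin a, ¬ p + j = (i : ℕ) := fun j => by omega
  simp only [vdeg, sum_matchVert, matchPos, G0, SimpleGraph.comap_adj, bip_adj_one_zero,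
    bip_adj_same, h, ← Fin.ext_iff, ne_eq, not_false_eq_true, if_true, if_false]
  simpa [eq_comm] using sum_ite_ne i

theorem G0_vdeg_left (i : Fin a) :
    vdeg (G0.comap (matchPos p a b)) (.inr (.inl i)) = p + b := by
  have h : ∀ j : Fin p, ¬ p + i = (j : ℕ) := fun j => by omega
  have h' : ∀ j : Fin b, ¬ p + (i : ℕ) = p + a + j := fun j => by omega
  rw [vdeg, sum_matchVert]
  simp [matchPos, G0, h, h']

theorem G0_vdeg_right (i : Fin b) :
    vdeg (G0.comap (matchPos p a b)) (.inr (.inr i)) = p + a := by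
  have h : ∀ j : Fin p, ¬ (j : ℕ) = p + a + i := fun j => by omega
  have h' : ∀ j : Fin a, ¬ p + (j : ℕ) = p + a + i := fun j => by omega
  rw [vdeg, sum_matchVert]
  simp [matchPos, G0, h, h']

theorem G0_sum_vdeg (F : ℕ → ℕ) : ∑ v, F (vdeg (G0.comap (matchPos p a b)) v) =
    p * F (p - 1 + b) + p * F (p - 1 + a) + (a * F (p + b) + b * F (p + a)) := by
  rw [sum_matchVert]
  simp [G0_vdeg_pair0, G0_vdeg_pair1, G0_vdeg_left, G0_vdeg_right]

end G0

section G4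
variable {p a b : ℕ}

theorem G4_sum_vdeg (F : ℕ → ℕ) : ∑ v, F (vdeg (G4.comap (matchPos p a b)) v) =
    p * F (p + a) + p * F 1 + (a * F (p + a - 1) + b * F 0) := by
  have h0 : ∀ i : Fin p, vdeg (G4.comap (matchPos p a b)) (.inl (i, 0)) = p + a := by
    intro i
    have h : ∀ j : Fin a, ¬ (i : ℕ) = p + j := fun j => by omega
    have h' : ∀ j : Fin b, ¬ (i : ℕ) = p + a + j := fun j => by omega
    simp only [vdeg, sum_matchVert, matchPos, G4, SimpleGraph.comap_adj, split_adj_zero_one,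
      split_adj_zero_zero, h, h', ← Fin.ext_iff, ne_eq, not_false_eq_true, if_true, if_false]
    have := sum_ite_ne i
    simp only [ne_eq] at this
    rw [this]
    simp only [Finset.sum_const, Finset.card_univ, Fintype.card_fin, smul_eq_mul, mul_one, mul_zero,
      Finset.sum_ite_eq, Finset.mem_univ, if_true]
    have := i.isLt
    omega
  have h1 : ∀ i : Fin p, vdeg (G4.comap (matchPos p a b)) (.inl (i, 1)) = 1 := by
    intro i
    have h : ∀ j : Fin a, ¬ p + j = (i : ℕ) := fun j => by omega
    rw [vdeg, sum_matchVert]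
    simp [matchPos, G4, h, ← Fin.ext_iff]
  have h2 : ∀ i : Fin a, vdeg (G4.comap (matchPos p a b)) (.inr (.inl i)) = p + a - 1 := by
    intro i
    have h : ∀ j : Fin p, ¬ p + i = (j : ℕ) := fun j => by omega
    have h' : ∀ j : Fin b, ¬ p + (i : ℕ) = p + a + j := fun j => by omega
    simp only [vdeg, sum_matchVert, matchPos, G4, SimpleGraph.comap_adj, split_adj_zero_one,
      split_adj_zero_zero, h, h', add_right_inj, ← Fin.ext_iff, ne_eq, not_false_eq_true,
      if_true, if_false]
    have := sum_ite_ne i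
    simp only [ne_eq] at this
    rw [this]
    simp only [Finset.sum_const, Finset.card_univ, Fintype.card_fin, smul_eq_mul, mul_one, mul_zero,
      Finset.sum_ite_eq, Finset.mem_univ, if_true]
    have := i.isLt
    omega
  have h3 : ∀ i : Fin b, vdeg (G4.comap (matchPos p a b)) (.inr (.inr i)) = 0 := by
    intro i
    have h : ∀ j : Fin p, ¬ (j : ℕ) = p + a + i := fun j => by omega
    have h' : ∀ j : Fin a, ¬ p + (j : ℕ) = p + a + i := fun j => by omega
    rw [vdeg, sum_matchVert]
    simp [matchPos, G4, h, h']
  rw [sum_matchVert]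
  simp [h0, h1, h2, h3]

end G4

section G3
variable {p a b : ℕ}

theorem matching_sum_vdeg (F : ℕ → ℕ) :
    ∑ v, F (vdeg ((bip fun i j => i = j).comap (matchPos p a b)) v) =
      2 * p * F 1 + (a + b) * F 0 := by
  have h0 : ∀ i : Fin p, vdeg ((bip fun i j => i = j).comap (matchPos p a b)) (.inl (i, 0)) = 1 := by
    intro i
    have h' : ∀ j : Fin b, ¬ (i : ℕ) = p + a + j := fun j => by omega
    rw [vdeg, sum_matchVert]
    simp [matchPos, h', ← Fin.ext_iff]
  have h1 : ∀ i : Fin p, vdeg ((bip fun i j => i = j).comap (matchPos p a b)) (.inl (i, 1)) = 1 := by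
    intro i
    have h : ∀ j : Fin a, ¬ p + j = (i : ℕ) := fun j => by omega
    rw [vdeg, sum_matchVert]
    simp [matchPos, h, ← Fin.ext_iff]
  have h2 : ∀ i : Fin a,
      vdeg ((bip fun i j => i = j).comap (matchPos p a b)) (.inr (.inl i)) = 0 := by
    intro i
    have h : ∀ j : Fin p, ¬ p + i = (j : ℕ) := fun j => by omega
    have h' : ∀ j : Fin b, ¬ p + (i : ℕ) = p + a + j := fun j => by omega
    rw [vdeg, sum_matchVert]
    simp [matchPos, h, h']
  have h3 : ∀ i : Fin b,
      vdeg ((bip fun i j => i = j).comap (matchPos p a b)) (.inr (.inr i)) = 0 := by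
    intro i
    have h : ∀ j : Fin p, ¬ (j : ℕ) = p + a + i := fun j => by omega
    have h' : ∀ j : Fin a, ¬ p + (j : ℕ) = p + a + i := fun j => by omega
    rw [vdeg, sum_matchVert]
    simp [matchPos, h, h']
  rw [sum_matchVert]
  simp [h0, h1, h2, h3]
  ring

theorem G3_sum_vdeg (F : ℕ → ℕ) :
    ∑ v, F (vdeg (G3.comap (Sum.map (matchPos p a b) (id : Unit → Unit))) v) =
      p * F 1 + p * F 2 + (a * F 0 + b * F 1) + F (p + b) := by
  set H := G3.comap (Sum.map (matchPos p a b) (id : Unit → Unit))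
  have h0 : ∀ i : Fin p, vdeg H (.inl (.inl (i, 0))) = 1 := by
    intro i
    have h' : ∀ j : Fin b, ¬ (i : ℕ) = p + a + j := fun j => by omega
    rw [vdeg, Fintype.sum_sum_type, sum_matchVert]
    simp [H, G3, matchPos, h', ← Fin.ext_iff]
  have h1 : ∀ i : Fin p, vdeg H (.inl (.inl (i, 1))) = 2 := by
    intro i
    have h : ∀ j : Fin a, ¬ p + j = (i : ℕ) := fun j => by omega
    rw [vdeg, Fintype.sum_sum_type, sum_matchVert]
    simp [H, G3, matchPos, h, ← Fin.ext_iff]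
  have h2 : ∀ i : Fin a, vdeg H (.inl (.inr (.inl i))) = 0 := by
    intro i
    have h : ∀ j : Fin p, ¬ p + i = (j : ℕ) := fun j => by omega
    have h' : ∀ j : Fin b, ¬ p + (i : ℕ) = p + a + j := fun j => by omega
    rw [vdeg, Fintype.sum_sum_type, sum_matchVert]
    simp [H, G3, matchPos, h, h']
  have h3 : ∀ i : Fin b, vdeg H (.inl (.inr (.inr i))) = 1 := by
    intro i
    have h : ∀ j : Fin p, ¬ (j : ℕ) = p + a + i := fun j => by omega
    have h' : ∀ j : Fin a, ¬ p + (j : ℕ) = p + a + i := fun j => by omega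
    rw [vdeg, Fintype.sum_sum_type, sum_matchVert]
    simp [H, G3, matchPos, h, h']
  have h4 : vdeg H (.inr ()) = p + b := by
    rw [vdeg, Fintype.sum_sum_type, sum_matchVert]
    simp [H, G3, matchPos]
  rw [Fintype.sum_sum_type, sum_matchVert]
  simp [h0, h1, h2, h3, h4]

end G3


/-! ### The profile of `G0` -/

/-- At `p = 0` the truncated `p - 1` differs from its value in `ℤ`, but the factor `p` removes that
term. -/
theorem natCast_mul_pred_add_pow (p c k : ℕ) :
    ((p * (p - 1 + c) ^ k : ℕ) : ℤ) = p * ((p : ℤ) + c - 1) ^ k := by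
  cases p with
  | zero => simp
  | succ q => push_cast; congr 2; ring

theorem nonempty_iso_G0_swap (p a b : ℕ) :
    Nonempty (G0.comap (matchPos p a b) ≃g G0.comap (matchPos p b a)) := by
  refine ⟨⟨((Equiv.refl _).prodCongr (Equiv.swap 0 1)).sumCongr (Equiv.sumComm _ _), ?_⟩⟩
  rintro (⟨i, x⟩ | i | i) (⟨j, y⟩ | j | j)
  · obtain rfl | rfl : x = 0 ∨ x = 1 := by omega
    all_goals obtain rfl | rfl : y = 0 ∨ y = 1 := by omega
    all_goals simp [matchPos, G0, eq_comm]
  all_goals try obtain rfl | rfl : x = 0 ∨ x = 1 := by omega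
  all_goals try obtain rfl | rfl : y = 0 ∨ y = 1 := by omega
  all_goals simp [matchPos, G0]
  all_goals omega

/-- Indices for the restrictions of `G0` with `n` vertices: the size of the smaller side and the
number of pairs. -/
def codeG0 (n : ℕ) : Finset (Σ _ : ℕ, ℕ) := (Finset.range (n / 2 + 1)).sigma fun s => Finset.range (s + 1)

theorem mem_codeG0 {n s p : ℕ} : (⟨s, p⟩ : Σ _ : ℕ, ℕ) ∈ codeG0 n ↔ 2 * s ≤ n ∧ p ≤ s := by
  simp [codeG0]; omega

theorem card_codeG0 (n : ℕ) : (codeG0 n).card = (n / 2 + 2).choose 2 := by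
  have : ∀ m, (∑ s ∈ Finset.range (m + 1), (s + 1)) = (m + 2).choose 2 := by
    intro m
    induction m with
    | zero => simp
    | succ m ih => rw [Finset.sum_range_succ, ih, Nat.choose_succ_succ' (m + 2) 1]; simp; omega
  simp [codeG0, Finset.card_sigma, this]

/-- If the sides have `S` and `n - S` vertices, the degree sum is `2 (S (n - S) - p)` and the sum of
squares is `n S (n - S) - 2 p (n - 1)`. Eliminating `S (n - S)` leaves `(n - 2) p`, and then `S` is
known because `2 S ≤ n`. For `n = 2` the edgeless graph arises twice, from a pair and from two
vertices on one side. -/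
theorem G0_code_unique {n s p s' p' : ℕ} (hn : n ≠ 2) (h : 2 * s ≤ n) (hp : p ≤ s)
    (h' : 2 * s' ≤ n) (hp' : p' ≤ s')
    (e : Nonempty (G0.comap (matchPos p (s - p) (n - s - p)) ≃g
      G0.comap (matchPos p' (s' - p') (n - s' - p')))) : s = s' ∧ p = p' := by
  obtain ⟨e⟩ := e
  obtain ⟨a, rfl⟩ := Nat.exists_eq_add_of_le hp
  obtain ⟨a', rfl⟩ := Nat.exists_eq_add_of_le hp'
  obtain ⟨b, hb⟩ := Nat.exists_eq_add_of_le (show p + (p + a) ≤ n by omega)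
  obtain ⟨b', hb'⟩ := Nat.exists_eq_add_of_le (show p' + (p' + a') ≤ n by omega)
  have q1 : p + a - p = a := by omega
  have q2 : p' + a' - p' = a' := by omega
  have q3 : n - (p + a) - p = b := by omega
  have q4 : n - (p' + a') - p' = b' := by omega
  rw [q1, q2, q3, q4] at e
  have f1 := congrArg (Nat.cast : ℕ → ℤ) ((G0_sum_vdeg fun x => x ^ 1).symm.trans
    ((sum_vdeg_iso e fun x => x ^ 1).trans (G0_sum_vdeg fun x => x ^ 1)))
  have f2 := congrArg (Nat.cast : ℕ → ℤ) ((G0_sum_vdeg fun x => x ^ 2).symm.trans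
    ((sum_vdeg_iso e fun x => x ^ 2).trans (G0_sum_vdeg fun x => x ^ 2)))
  simp only [Nat.cast_add, natCast_mul_pred_add_pow] at f1 f2
  push_cast at f1 f2
  have hbz : (b : ℤ) = n - 2 * p - a := by omega
  have hbz' : (b' : ℤ) = n - 2 * p' - a' := by omega
  rw [hbz, hbz'] at f1 f2
  obtain ⟨S, hS⟩ : ∃ S : ℤ, S = p + a := ⟨_, rfl⟩
  obtain ⟨S', hS'⟩ : ∃ S' : ℤ, S' = p' + a' := ⟨_, rfl⟩
  have ha : (a : ℤ) = S - p := by omega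
  have ha' : (a' : ℤ) = S' - p' := by omega
  rw [ha, ha'] at f1 f2
  have g1 : S * (n - S) - p = S' * (n - S') - p' := by linarith
  have g2 : n * (S * (n - S)) - 2 * p * (n - 1) = n * (S' * (n - S')) - 2 * p' * (n - 1) := by
    linarith
  have g3 : ((n : ℤ) - 2) * (p - p') = 0 := by linear_combination (n : ℤ) * g1 - g2
  have g4 : (p : ℤ) = p' := by
    rcases mul_eq_zero.1 g3 with h | h <;> omega
  have g5 : (S - S') * (n - S - S') = 0 := by linear_combination g1 + g4
  rcases mul_eq_zero.1 g5 with h | h <;> omega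

theorem profile_G0 {n : ℕ} (hn : n ≠ 2) : profile (age G0) n = (n / 2 + 2).choose 2 := by
  rw [← card_codeG0, ← Fintype.card_coe]
  refine profile_eq_card (ι := codeG0 n)
    (W := fun i => MatchVert i.1.2 (i.1.1 - i.1.2) (n - i.1.1 - i.1.2))
    (fun i => G0.comap (matchPos i.1.2 (i.1.1 - i.1.2) (n - i.1.1 - i.1.2))) ?_ ?_ ?_ ?_
  · rintro ⟨⟨s, p⟩, h⟩
    rw [mem_codeG0] at h
    rw [Nat.card_eq_fintype_card, card_matchVert]
    dsimp only
    omega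
  · exact fun i => ⟨SimpleGraph.Embedding.comap ⟨_, matchPos_injective _ _ _⟩ _⟩
  · intro H f
    obtain ⟨p, a, b, hc, e⟩ := exists_iso_comap_matchPos
      (fun π i x j y => by
        obtain rfl | rfl : x = 0 ∨ x = 1 := by omega
        all_goals obtain rfl | rfl : y = 0 ∨ y = 1 := by omega
        all_goals simp [G0]) f
    rw [Fintype.card_fin] at hc
    obtain ⟨p, a, b, hab, hc, e⟩ : ∃ p a b, a ≤ b ∧ 2 * p + a + b = n ∧
        Nonempty (H ≃g G0.comap (matchPos p a b)) := by
      rcases le_total a b with h | h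
      · exact ⟨p, a, b, h, hc, e⟩
      · obtain ⟨e⟩ := e
        obtain ⟨e'⟩ := nonempty_iso_G0_swap p a b
        exact ⟨p, b, a, h, by omega, ⟨e.trans e'⟩⟩
    refine ⟨⟨⟨p + a, p⟩, mem_codeG0.2 ⟨by omega, by omega⟩⟩, ?_⟩
    dsimp only
    have q1 : p + a - p = a := by omega
    have q3 : n - (p + a) - p = b := by omega
    rwa [q1, q3]
  · rintro ⟨⟨s, p⟩, h⟩ ⟨⟨s', p'⟩, h'⟩ e
    have h1 := mem_codeG0.1 h
    have h2 := mem_codeG0.1 h'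
    obtain ⟨rfl, rfl⟩ := G0_code_unique hn h1.1 h1.2 h2.1 h2.2 e
    rfl

/-- Covers the size two for `G0`, where the general count fails, and for `G5`, where it starts only
at three vertices. -/
theorem profile_two {V : Type*} {G : SimpleGraph V} (h1 : ∃ u v, G.Adj u v)
    (h2 : ∃ u v, u ≠ v ∧ ¬ G.Adj u v) : profile (age G) 2 = 2 := by
  have hemb : ∀ (H : SimpleGraph (Fin 2)) (u v : V), u ≠ v → (H.Adj 0 1 ↔ G.Adj u v) →
      Nonempty (H ↪g G) := by
    intro H u v huv h
    have h' : H.Adj 1 0 ↔ G.Adj v u := by rw [H.adj_comm, G.adj_comm, h]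
    refine ⟨⟨⟨fun x => if x = 0 then u else v, fun x y => ?_⟩, fun {x y} => ?_⟩⟩
    · revert x y
      simp [Fin.forall_fin_two, huv, huv.symm]
    · change G.Adj (if x = 0 then u else v) (if y = 0 then u else v) ↔ H.Adj x y
      revert x y
      simp [Fin.forall_fin_two, h, h']
  have key := profile_eq_card (G := G) (n := 2) (ι := Bool) (W := fun _ => Fin 2)
    (fun i => bif i then ⊤ else ⊥) (by simp) ?_ ?_ ?_
  · simpa using key
  · obtain ⟨u, v, h⟩ := h1
    obtain ⟨u', v', h', h''⟩ := h2
    rintro (_ | _)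
    · exact hemb _ u' v' h' (by simp [h''])
    · exact hemb _ u v h.ne (by simp [h])
  · intro H _
    by_cases h : H.Adj 0 1
    · refine ⟨true, ⟨⟨Equiv.refl _, fun {x y} => ?_⟩⟩⟩
      revert x y
      simp [Fin.forall_fin_two, h, h.symm]
    · refine ⟨false, ⟨⟨Equiv.refl _, fun {x y} => ?_⟩⟩⟩
      have h' : ¬ H.Adj 1 0 := fun h' => h h'.symm
      revert x y
      simp [Fin.forall_fin_two, h, h']
  · rintro (_ | _) (_ | _) ⟨e⟩
    · rfl
    · have := e.symm.map_adj_iff (v := 0) (w := 1)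
      simp at this
    · have := e.map_adj_iff (v := 0) (w := 1)
      simp at this
    · rfl

theorem profile_G0_two : profile (age G0) 2 = 2 :=
  profile_two ⟨(0, 0), (1, 1), by simp [G0]⟩ ⟨(0, 0), (1, 0), by simp, by simp [G0]⟩


/-! ### The profiles of `G4` and `G3` -/

/-- The pairs `(k, p)` with `2 ≤ k`, `p ≤ k` and `k + p ≤ n`. -/
def codeG4 (n : ℕ) : Finset (ℕ × ℕ) :=
  ((Finset.range (n + 1)) ×ˢ (Finset.range (n + 1))).filter
    fun x => 2 ≤ x.1 ∧ x.2 ≤ x.1 ∧ x.1 + x.2 ≤ n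

theorem mem_codeG4 {n k p : ℕ} : (k, p) ∈ codeG4 n ↔ 2 ≤ k ∧ p ≤ k ∧ k + p ≤ n := by
  simp [codeG4]; omega

/-- The new pairs lie on the diagonal `k + p = n + 1`, one for each `p ≤ (n + 1) / 2`; the bound `2
≤ n` makes `2 ≤ k` automatic there. -/
theorem card_codeG4_succ {n : ℕ} (hn : 2 ≤ n) :
    (codeG4 (n + 1)).card = (codeG4 n).card + ((n + 1) / 2 + 1) := by
  have h : codeG4 (n + 1) = codeG4 n ∪
      (Finset.range ((n + 1) / 2 + 1)).image fun p => (n + 1 - p, p) := by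
    ext ⟨k, p⟩
    simp only [Finset.mem_union, mem_codeG4, Finset.mem_image, Finset.mem_range, Prod.mk.injEq,
      exists_eq_right_right]
    omega
  rw [h, Finset.card_union_of_disjoint, Finset.card_image_of_injective, Finset.card_range]
  · exact fun p p' h => (Prod.mk.inj h).2
  · rw [Finset.disjoint_left]
    rintro ⟨k, p⟩ h1 h2
    simp only [mem_codeG4, Finset.mem_image, Finset.mem_range, Prod.mk.injEq,
      exists_eq_right_right] at h1 h2
    omega

/-- The parameters of the restrictions of `G4` with `n` vertices. -/
def paramG4 (n : ℕ) : Option (codeG4 n) → ℕ × ℕ × ℕ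
  | none => (0, 0, n)
  | some x => (x.1.2, x.1.1 - x.1.2, n - x.1.1 - x.1.2)

/-- For a clique of `k` vertices, `p` of them with a pendant vertex, the degree sum is `E = k (k -
1) + 2 p` and the sum of squares is `k (E - k + 1)`. Comparison gives `(k - k') (E + 1 - k - k') =
0`. If `k ≠ k'`, the second factor is positive, since `E` is at least `k (k - 1)` and `k' (k' - 1)`.
-/
theorem G4_code_unique {k p a k' p' a' b b' : ℕ} (hk : 2 ≤ k) (ha : p + a = k) (hk' : 2 ≤ k')
    (ha' : p' + a' = k')
    (e : Nonempty (G4.comap (matchPos p a b) ≃g G4.comap (matchPos p' a' b'))) :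
    k = k' ∧ p = p' := by
  obtain ⟨e⟩ := e
  have e1 := (G4_sum_vdeg fun x => x ^ 1).symm.trans
    ((sum_vdeg_iso e fun x => x ^ 1).trans (G4_sum_vdeg fun x => x ^ 1))
  have e2 := (G4_sum_vdeg fun x => x ^ 2).symm.trans
    ((sum_vdeg_iso e fun x => x ^ 2).trans (G4_sum_vdeg fun x => x ^ 2))
  simp only [ha, ha'] at e1 e2
  obtain ⟨m, rfl⟩ := Nat.exists_eq_add_of_le hk
  obtain ⟨m', rfl⟩ := Nat.exists_eq_add_of_le hk'
  rw [show 2 + m - 1 = m + 1 by omega, show 2 + m' - 1 = m' + 1 by omega] at e1 e2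
  zify at e1 e2
  have haz : (a : ℤ) = 2 + m - p := by omega
  have haz' : (a' : ℤ) = 2 + m' - p' := by omega
  rw [haz, haz'] at e1 e2
  have g1 : ((m : ℤ) + 2) * (m + 1) + 2 * p = (m' + 2) * (m' + 1) + 2 * p' := by linarith
  have g2 : ((m : ℤ) - m') * ((m + 2) * (m + 1) + 2 * p - m - m' - 3) = 0 := by
    linear_combination (-1 : ℤ) * e2 - (m' + 2 : ℤ) * g1
  have g3 : (m : ℤ) = m' := by
    rcases mul_eq_zero.1 g2 with h | h
    · omega
    · rcases lt_trichotomy (m : ℤ) m' with hlt | heq | hlt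
      · nlinarith
      · exact heq
      · nlinarith
  have g4 : (p : ℤ) = p' := by rw [g3] at g1; linarith
  omega

theorem profile_G4 (n : ℕ) : profile (age G4) n = (codeG4 n).card + 1 := by
  have key := profile_eq_card (G := G4) (n := n) (ι := Option (codeG4 n))
    (W := fun i => MatchVert (paramG4 n i).1 (paramG4 n i).2.1 (paramG4 n i).2.2)
    (fun i => G4.comap (matchPos (paramG4 n i).1 (paramG4 n i).2.1 (paramG4 n i).2.2)) ?_ ?_ ?_ ?_
  · rw [key, Fintype.card_option, Fintype.card_coe]
  · rintro (_ | ⟨⟨k, p⟩, h⟩)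
    · simp [paramG4]
    · rw [mem_codeG4] at h
      rw [Nat.card_eq_fintype_card, card_matchVert]
      simp only [paramG4]
      omega
  · exact fun i => ⟨SimpleGraph.Embedding.comap ⟨_, matchPos_injective _ _ _⟩ _⟩
  · intro H f
    obtain ⟨p, a, b, hc, ⟨e⟩⟩ := exists_iso_comap_matchPos
      (fun π i x j y => by
        obtain rfl | rfl : x = 0 ∨ x = 1 := by omega
        all_goals obtain rfl | rfl : y = 0 ∨ y = 1 := by omega
        all_goals simp [G4]) f
    rw [Fintype.card_fin] at hc
    have hsome : ∀ p a b, 2 * p + a + b = n → 2 ≤ p + a →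
        Nonempty (H ≃g G4.comap (matchPos p a b)) →
        ∃ i, Nonempty (H ≃g G4.comap
          (matchPos (paramG4 n i).1 (paramG4 n i).2.1 (paramG4 n i).2.2)) := by
      intro p a b hc hk e
      refine ⟨some ⟨(p + a, p), mem_codeG4.2 ⟨hk, by omega, by omega⟩⟩, ?_⟩
      dsimp only [paramG4]
      have q1 : p + a - p = a := by omega
      have q3 : n - (p + a) - p = b := by omega
      rwa [q1, q3]
    -- With at most one vertex on the clique side, the graph is edgeless (the code `none`) or a
    -- single edge with isolated vertices; the latter is also given by `p = 0`, `a = 2`.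
    have hcase : 2 ≤ p + a ∨ (p = 0 ∧ a = 0) ∨ (p = 0 ∧ a = 1) ∨ (p = 1 ∧ a = 0) := by omega
    rcases hcase with hk | ⟨rfl, rfl⟩ | ⟨rfl, rfl⟩ | ⟨rfl, rfl⟩
    · exact hsome p a b hc hk ⟨e⟩
    · refine ⟨none, ?_⟩
      dsimp only [paramG4]
      obtain rfl : b = n := by omega
      exact ⟨e⟩
    · refine ⟨none, ?_⟩
      dsimp only [paramG4]
      obtain rfl : 1 + b = n := by omega
      obtain ⟨e'⟩ : Nonempty (G4.comap (matchPos 0 1 b) ≃g G4.comap (matchPos 0 0 (1 + b))) := by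
        refine nonempty_iso_of_injective (fun
          | .inl x => x.1.elim0
          | .inr (.inl i) => .inr (.inr ⟨i, by omega⟩)
          | .inr (.inr i) => .inr (.inr ⟨i + 1, by omega⟩)) ?_ (by simp) ?_
        · rintro (⟨i, x⟩ | i | i) (⟨j, y⟩ | j | j) h <;> first | exact i.elim0 | exact j.elim0 | skip
          all_goals simp at h
          all_goals first | (rw [Fin.ext_iff.2 h]) | (have := Fin.ext_iff.1 h; simp at this; done) | skip
          all_goals simp_all [Fin.ext_iff]
        · rintro (⟨i, x⟩ | i | i) (⟨j, y⟩ | j | j) <;>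
            first | exact i.elim0 | exact j.elim0 | simp [matchPos, G4]
          all_goals omega
      exact ⟨e.trans e'⟩
    · refine hsome 0 2 b (by omega) (by omega) ?_
      obtain ⟨e'⟩ : Nonempty (G4.comap (matchPos 1 0 b) ≃g G4.comap (matchPos 0 2 b)) := by
        refine nonempty_iso_of_injective (fun
          | .inl x => .inr (.inl x.2)
          | .inr (.inl i) => i.elim0
          | .inr (.inr i) => .inr (.inr i)) ?_ (by simp) ?_
        · rintro (⟨i, x⟩ | i | i) (⟨j, y⟩ | j | j) h <;>
            first | exact i.elim0 | exact j.elim0 | simp at h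
          · rw [h, Subsingleton.elim i j]
          · rw [h]
        · rintro (⟨i, x⟩ | i | i) (⟨j, y⟩ | j | j)
          · obtain rfl | rfl : x = 0 ∨ x = 1 := by omega
            all_goals obtain rfl | rfl : y = 0 ∨ y = 1 := by omega
            all_goals simp [matchPos, G4]
          all_goals try obtain rfl | rfl : x = 0 ∨ x = 1 := by omega
          all_goals try obtain rfl | rfl : y = 0 ∨ y = 1 := by omega
          all_goals first | exact i.elim0 | exact j.elim0 | simp [matchPos, G4]
          all_goals omega
      exact ⟨e.trans e'⟩
  · have hD : ∀ k p h, ¬ Nonempty (G4.comap (matchPos 0 0 n) ≃g G4.comap (matchPos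
        (paramG4 n (some ⟨(k, p), h⟩)).1 (paramG4 n (some ⟨(k, p), h⟩)).2.1
        (paramG4 n (some ⟨(k, p), h⟩)).2.2)) := by
      rintro k p h ⟨e⟩
      have h1 := mem_codeG4.1 h
      have := (G4_sum_vdeg fun x => x ^ 1).symm.trans
        ((sum_vdeg_iso e fun x => x ^ 1).trans (G4_sum_vdeg fun x => x ^ 1))
      simp [paramG4] at this
      omega
    rintro (_ | ⟨⟨k, p⟩, h⟩) (_ | ⟨⟨k', p'⟩, h'⟩) ⟨e⟩
    · rfl
    · exact (hD _ _ _ ⟨e⟩).elim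
    · exact (hD _ _ _ ⟨e.symm⟩).elim
    · have h1 := mem_codeG4.1 h
      have h2 := mem_codeG4.1 h'
      obtain ⟨rfl, rfl⟩ := G4_code_unique h1.1 (by simp [paramG4]; omega) h2.1
        (by simp [paramG4]; omega) ⟨e⟩
      rfl


/-! ### Restrictions of `G3`: matchings and spiders -/

theorem comap_inl_addC (G : SimpleGraph (ℕ × Fin 2)) : (addC G).comap Sum.inl = G := by
  ext u v
  simp

theorem comap_inl_addAB (G : SimpleGraph (ℕ × Fin 2)) : (addAB G).comap Sum.inl = G := by
  ext u v
  simp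

/-- The matching with `p` edges and `q` isolated vertices. -/
abbrev matching (p q : ℕ) : SimpleGraph (MatchVert p q 0) :=
  (bip fun i j => i = j).comap (matchPos p q 0)

/-- The spider with `p` long legs, `b` short legs and `a` isolated vertices. -/
abbrev spider (p a b : ℕ) : SimpleGraph (MatchVert p a b ⊕ Unit) :=
  G3.comap (Sum.map (matchPos p a b) (id : Unit → Unit))

theorem nonempty_iso_matching (p a b : ℕ) :
    Nonempty ((bip fun i j => i = j).comap (matchPos p a b) ≃g matching p (a + b)) := by
  refine nonempty_iso_of_injective (fun
    | .inl x => .inl x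
    | .inr (.inl i) => .inr (.inl (i.castAdd b))
    | .inr (.inr i) => .inr (.inl (i.natAdd a))) ?_ (by simp) ?_
  · rintro (⟨i, x⟩ | i | i) (⟨j, y⟩ | j | j) h <;> simp [Fin.ext_iff] at h ⊢ <;> omega
  · rintro (⟨i, x⟩ | i | i) (⟨j, y⟩ | j | j)
    all_goals try obtain rfl | rfl : x = 0 ∨ x = 1 := by omega
    all_goals try obtain rfl | rfl : y = 0 ∨ y = 1 := by omega
    all_goals simp [matchPos]
    all_goals omega

theorem nonempty_iso_spider_zero (a : ℕ) : Nonempty (spider 0 a 0 ≃g matching 0 (a + 1)) := by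
  refine nonempty_iso_of_injective (fun
    | .inl (.inl x) => x.1.elim0
    | .inl (.inr (.inl i)) => .inr (.inl i.succ)
    | .inl (.inr (.inr i)) => i.elim0
    | .inr _ => .inr (.inl 0)) ?_ (by simp) ?_
  · rintro ((⟨i, x⟩ | i | i) | z) ((⟨j, y⟩ | j | j) | z') h
    all_goals first | exact i.elim0 | exact j.elim0 | skip
    all_goals simp [Fin.ext_iff] at h ⊢ <;> omega
  · rintro ((⟨i, x⟩ | i | i) | z) ((⟨j, y⟩ | j | j) | z')
    all_goals first | exact i.elim0 | exact j.elim0 | simp [matchPos, G3]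

theorem nonempty_iso_spider_one (a : ℕ) : Nonempty (spider 0 a 1 ≃g matching 1 a) := by
  refine nonempty_iso_of_injective (fun
    | .inl (.inl x) => x.1.elim0
    | .inl (.inr (.inl i)) => .inr (.inl i)
    | .inl (.inr (.inr _)) => .inl (0, 1)
    | .inr _ => .inl (0, 0)) ?_ (by simp; omega) ?_
  · rintro ((⟨i, x⟩ | i | i) | z) ((⟨j, y⟩ | j | j) | z') h
    all_goals first | exact i.elim0 | exact j.elim0 | skip
    all_goals simp [Fin.ext_iff] at h ⊢ <;> omega
  · rintro ((⟨i, x⟩ | i | i) | z) ((⟨j, y⟩ | j | j) | z')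
    all_goals first | exact i.elim0 | exact j.elim0 | simp [matchPos, G3]
    all_goals omega

theorem nonempty_iso_spider_path (a : ℕ) : Nonempty (spider 1 a 0 ≃g spider 0 a 2) := by
  refine nonempty_iso_of_injective (fun
    | .inl (.inl (_, x)) => if x = 0 then .inl (.inr (.inr 0)) else .inr ()
    | .inl (.inr (.inl i)) => .inl (.inr (.inl i))
    | .inl (.inr (.inr i)) => i.elim0
    | .inr _ => .inl (.inr (.inr 1))) ?_ (by simp; omega) ?_
  · rintro ((⟨i, x⟩ | i | i) | z) ((⟨j, y⟩ | j | j) | z') h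
    all_goals first | exact i.elim0 | exact j.elim0 | skip
    all_goals try obtain rfl | rfl : x = 0 ∨ x = 1 := by omega
    all_goals try obtain rfl | rfl : y = 0 ∨ y = 1 := by omega
    all_goals simp [Fin.ext_iff] at h ⊢ <;> omega
  · rintro ((⟨i, x⟩ | i | i) | z) ((⟨j, y⟩ | j | j) | z')
    all_goals first | exact i.elim0 | exact j.elim0 | skip
    all_goals try obtain rfl | rfl : x = 0 ∨ x = 1 := by omega
    all_goals try obtain rfl | rfl : y = 0 ∨ y = 1 := by omega
    all_goals simp [matchPos, G3]
    all_goals omega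

/-- The vertices of the standard restrictions of `G3` with `n` vertices. -/
def VertG3 (n : ℕ) : Fin (n / 2 + 1) ⊕ codeG4 (n - 1) → Type
  | .inl p => MatchVert p (n - 2 * p) 0
  | .inr x => MatchVert x.1.2 (n - 1 - x.1.1 - x.1.2) (x.1.1 - x.1.2) ⊕ Unit

instance (n : ℕ) (i) : Finite (VertG3 n i) := by
  rcases i with p | x
  · exact inferInstanceAs (Finite (MatchVert _ _ _))
  · exact inferInstanceAs (Finite (MatchVert _ _ _ ⊕ Unit))

/-- The standard restrictions of `G3` with `n` vertices. -/
def repG3 (n : ℕ) : ∀ i, SimpleGraph (VertG3 n i)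
  | .inl p => matching p (n - 2 * p)
  | .inr x => spider x.1.2 (n - 1 - x.1.1 - x.1.2) (x.1.1 - x.1.2)

theorem profile_G3 (n : ℕ) : profile (age G3) n = n / 2 + 1 + (codeG4 (n - 1)).card := by
  have key := profile_eq_card (G := G3) (n := n) (repG3 n) ?_ ?_ ?_ ?_
  · rw [key, Fintype.card_sum, Fintype.card_coe, Fintype.card_fin]
  · rintro (⟨p, h⟩ | ⟨⟨k, p⟩, h⟩)
    · change Nat.card (MatchVert _ _ _) = n
      rw [Nat.card_eq_fintype_card, card_matchVert]
      dsimp only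
      omega
    · rw [mem_codeG4] at h
      change Nat.card (MatchVert _ _ _ ⊕ Unit) = n
      rw [Nat.card_eq_fintype_card, Fintype.card_sum, card_matchVert, Fintype.card_unit]
      dsimp only
      omega
  · rintro (p | x)
    · have f : matching p (n - 2 * p) ↪g (bip fun i j => i = j) :=
        SimpleGraph.Embedding.comap ⟨_, matchPos_injective _ _ _⟩ _
      have g : (bip fun i j => i = j) ↪g G3 := ⟨Function.Embedding.inl, by simp [G3]⟩
      exact ⟨g.comp f⟩
    · exact ⟨SimpleGraph.Embedding.comap
        ⟨_, (matchPos_injective _ _ _).sumMap Function.injective_id⟩ _⟩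
  · intro H f
    have hmatch : ∀ p q, 2 * p + q = n → Nonempty (H ≃g matching p q) →
        ∃ i, Nonempty (H ≃g repG3 n i) := by
      intro p q hpq e
      refine ⟨.inl ⟨p, by omega⟩, ?_⟩
      change Nonempty (H ≃g matching p (n - 2 * p))
      rwa [show n - 2 * p = q by omega]
    have hspider : ∀ p a b, 2 * p + a + b + 1 = n → 2 ≤ p + b → Nonempty (H ≃g spider p a b) →
        ∃ i, Nonempty (H ≃g repG3 n i) := by
      intro p a b hpq hk e
      refine ⟨.inr ⟨(p + b, p), mem_codeG4.2 ⟨hk, by omega, by omega⟩⟩, ?_⟩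
      change Nonempty (H ≃g spider p (n - 1 - (p + b) - p) (p + b - p))
      rwa [show n - 1 - (p + b) - p = a by omega, show p + b - p = b by omega]
    by_cases hf : Sum.inr () ∈ Set.range f
    · obtain ⟨p, a, b, hc, ⟨e⟩⟩ := exists_iso_comap_sumMap_matchPos
        (fun π i x j y => by
          obtain rfl | rfl : x = 0 ∨ x = 1 := by omega
          all_goals obtain rfl | rfl : y = 0 ∨ y = 1 := by omega
          all_goals simp [G3]) (fun π i x z => by simp [G3]) f (fun _ => hf)
      rw [Fintype.card_fin, Fintype.card_unit] at hc
      -- Fewer than two legs give nothing new: with no leg or one short leg the graph is a matching,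
      -- and one long leg is a path on three vertices, whose middle vertex is the centre of two
      -- short legs.
      have hcase : 2 ≤ p + b ∨ (p = 0 ∧ b = 0) ∨ (p = 0 ∧ b = 1) ∨ (p = 1 ∧ b = 0) := by omega
      rcases hcase with hk | ⟨rfl, rfl⟩ | ⟨rfl, rfl⟩ | ⟨rfl, rfl⟩
      · exact hspider p a b (by omega) hk ⟨e⟩
      · obtain ⟨e'⟩ := nonempty_iso_spider_zero a
        exact hmatch 0 (a + 1) (by omega) ⟨e.trans e'⟩
      · obtain ⟨e'⟩ := nonempty_iso_spider_one a
        exact hmatch 1 a (by omega) ⟨e.trans e'⟩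
      · obtain ⟨e'⟩ := nonempty_iso_spider_path a
        exact hspider 0 a 2 (by omega) (by omega) ⟨e.trans e'⟩
    · obtain ⟨f'⟩ := nonempty_embedding_comap_inl f (fun _ => hf)
      rw [G3, comap_inl_addC] at f'
      obtain ⟨p, a, b, hc, ⟨e⟩⟩ := exists_iso_comap_matchPos
        (fun π i x j y => by
          obtain rfl | rfl : x = 0 ∨ x = 1 := by omega
          all_goals obtain rfl | rfl : y = 0 ∨ y = 1 := by omega
          all_goals simp) f'
      rw [Fintype.card_fin] at hc
      obtain ⟨e'⟩ := nonempty_iso_matching p a b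
      exact hmatch p (a + b) (by omega) ⟨e.trans e'⟩
  -- The sum of `d² - d` over the degrees `d` vanishes for a matching, while the centre of the
  -- spider has degree at least two.
  · have hMS : ∀ p q p' a' b', 2 ≤ p' + b' → ¬ Nonempty (matching p q ≃g spider p' a' b') := by
      rintro p q p' a' b' hk ⟨e⟩
      have e1 := (G3_sum_vdeg fun x => x ^ 1).symm.trans
        ((sum_vdeg_iso e fun x => x ^ 1).trans (matching_sum_vdeg fun x => x ^ 1))
      have e2 := (G3_sum_vdeg fun x => x ^ 2).symm.trans
        ((sum_vdeg_iso e fun x => x ^ 2).trans (matching_sum_vdeg fun x => x ^ 2))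
      nlinarith
    rintro (⟨p, h⟩ | ⟨⟨k, p⟩, h⟩) (⟨p', h'⟩ | ⟨⟨k', p'⟩, h'⟩) ⟨e⟩
    · change matching p (n - 2 * p) ≃g matching p' (n - 2 * p') at e
      have e1 := (matching_sum_vdeg fun x => x ^ 1).symm.trans
        ((sum_vdeg_iso e fun x => x ^ 1).trans (matching_sum_vdeg fun x => x ^ 1))
      obtain rfl : p = p' := by simp at e1; omega
      rfl
    · have h1 := mem_codeG4.1 h'
      exact (hMS p (n - 2 * p) p' _ _ (by dsimp only; omega) ⟨e⟩).elim
    · have h1 := mem_codeG4.1 h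
      exact (hMS p' (n - 2 * p') p _ _ (by dsimp only; omega) ⟨e.symm⟩).elim
    · have h1 := mem_codeG4.1 h
      have h2 := mem_codeG4.1 h'
      change spider p (n - 1 - k - p) (k - p) ≃g spider p' (n - 1 - k' - p') (k' - p') at e
      have e1 := (G3_sum_vdeg fun x => x ^ 1).symm.trans
        ((sum_vdeg_iso e fun x => x ^ 1).trans (G3_sum_vdeg fun x => x ^ 1))
      have e2 := (G3_sum_vdeg fun x => x ^ 2).symm.trans
        ((sum_vdeg_iso e fun x => x ^ 2).trans (G3_sum_vdeg fun x => x ^ 2))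
      simp only [show p + (k - p) = k by omega, show p' + (k' - p') = k' by omega] at e1 e2
      obtain ⟨b, rfl⟩ := Nat.exists_eq_add_of_le h1.2.1
      obtain ⟨b', rfl⟩ := Nat.exists_eq_add_of_le h2.2.1
      rw [show p + b - p = b by omega, show p' + b' - p' = b' by omega] at e1 e2
      simp only [pow_one] at e1
      have g1 : p' + (p' + b') = p + (p + b) := by omega
      -- For `k = p + b` legs, the degree sum gives `p + k`, and the sum of squares then gives `k² -
      -- 3k`. Two different values `k, k' ≥ 2` would need `k + k' = 3`.
      have g2 : ((p : ℤ) + b - (p' + b')) * (p + b + (p' + b') - 3) = 0 := by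
        zify at g1 e2
        linear_combination (-1 : ℤ) * e2 + 4 * g1
      have g3 : (p : ℤ) + b = p' + b' := by
        rcases mul_eq_zero.1 g2 with h | h <;> omega
      obtain ⟨rfl, rfl⟩ : p = p' ∧ b = b' := by omega
      rfl


/-! ### Words -/

/-- The order of the vertices of `ℕ × {0, 1}`: `(0, 0), (0, 1), (1, 0), (1, 1), …` -/
def vertKey (v : ℕ × Fin 2) : ℕ := 2 * v.1 + v.2

/-- The standard position of the letters of a word. -/
def wordPos (l : List (Fin 2)) (i : Fin l.length) : ℕ × Fin 2 := (i, l[i])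

/-- The vertices `g i` are in increasing order and have as second coordinates the letters
of `l`. -/
structure IsWordPos (l : List (Fin 2)) (g : Fin l.length → ℕ × Fin 2) : Prop where
  letter : ∀ i, (g i).2 = l[i]
  lt : ∀ i j, i < j → vertKey (g i) < vertKey (g j)

theorem isWordPos_wordPos (l : List (Fin 2)) : IsWordPos l (wordPos l) :=
  ⟨fun _ => rfl, fun i j h => by
    simp only [vertKey, wordPos]
    have := l[i].isLt
    have : (i : ℕ) < j := h
    omega⟩

namespace IsWordPos

variable {l : List (Fin 2)} {g : Fin l.length → ℕ × Fin 2}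

theorem injective (hg : IsWordPos l g) : Function.Injective g := by
  intro i j h
  rcases lt_trichotomy i j with hij | hij | hij
  · have := hg.lt i j hij
    rw [h] at this
    omega
  · exact hij
  · have := hg.lt j i hij
    rw [h] at this
    omega

/-- The key places `(i, 0)` just before `(i, 1)`, so the weak inequality of indices becomes the
strict order of positions. -/
theorem le_iff (hg : IsWordPos l g) {i j : Fin l.length} (hi : (g i).2 = 0) (hj : (g j).2 = 1) :
    (g i).1 ≤ (g j).1 ↔ i < j := by
  have h1 := hg.lt i j
  have h2 := hg.lt j i
  simp only [vertKey, hi, hj] at h1 h2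
  rcases lt_trichotomy i j with hij | rfl | hij
  · have := h1 hij
    exact iff_of_true (by simp at this; omega) hij
  · rw [hi] at hj
    simp at hj
  · have := h2 hij
    exact iff_of_false (by simp at this; omega) (not_lt_of_gt hij)

/-- The earlier letter alone decides an adjacency: read from right to left, a letter `0` adds a
dominating vertex and a letter `1` an isolated one. This is the construction of threshold graphs. -/
theorem split_adj (hg : IsWordPos l g) {i j : Fin l.length} :
    (split (· ≤ ·)).Adj (g i) (g j) ↔ (i < j ∧ l[i] = 0) ∨ (j < i ∧ l[j] = 0) := by
  have h1 := hg.letter i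
  have h2 := hg.letter j
  have h3 := hg.le_iff (i := i) (j := j)
  have h4 := hg.le_iff (i := j) (j := i)
  have h5 := hg.injective.ne_iff (x := i) (y := j)
  rw [← h1, ← h2]
  revert h3 h4 h5
  generalize g i = u
  generalize g j = v
  obtain ⟨m, x⟩ := u
  obtain ⟨n, y⟩ := v
  intro h3 h4 h5
  obtain rfl | rfl : x = 0 ∨ x = 1 := by omega
  all_goals obtain rfl | rfl : y = 0 ∨ y = 1 := by omega
  all_goals simp at h3 h4 h5 ⊢
  · rw [h5]
  · exact h3
  · exact h4

theorem bip_adj (hg : IsWordPos l g) {i j : Fin l.length} :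
    (bip (· ≤ ·)).Adj (g i) (g j) ↔
      (i < j ∧ l[i] = 0 ∧ l[j] = 1) ∨ (j < i ∧ l[j] = 0 ∧ l[i] = 1) := by
  have h1 := hg.letter i
  have h2 := hg.letter j
  have h3 := hg.le_iff (i := i) (j := j)
  have h4 := hg.le_iff (i := j) (j := i)
  rw [← h1, ← h2]
  revert h3 h4
  generalize g i = u
  generalize g j = v
  obtain ⟨m, x⟩ := u
  obtain ⟨n, y⟩ := v
  intro h3 h4
  obtain rfl | rfl : x = 0 ∨ x = 1 := by omega
  all_goals obtain rfl | rfl : y = 0 ∨ y = 1 := by omega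
  all_goals simp at h3 h4 ⊢
  · exact h3
  · exact h4

end IsWordPos

theorem exists_isWordPos {T : Set (ℕ × Fin 2)} (hT : T.Finite) :
    ∃ l, ∃ g : Fin l.length → ℕ × Fin 2, IsWordPos l g ∧ Set.range g = T := by
  classical
  set K := hT.toFinset.image vertKey with hK
  let u : ℕ → ℕ × Fin 2 := fun k => (k / 2, ⟨k % 2, by omega⟩)
  have hu : ∀ v, u (vertKey v) = v := fun ⟨m, x⟩ => by
    ext <;> simp [u, vertKey] <;> omega
  have hu' : ∀ k, vertKey (u k) = k := fun k => by
    simp [u, vertKey]; omega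
  let e := K.orderEmbOfFin rfl
  set l := List.ofFn fun i => (u (e i)).2 with hl
  have hlen : l.length = K.card := by simp [hl]
  refine ⟨l, fun i => u (e (i.cast hlen)), ⟨fun i => ?_, fun i j hij => ?_⟩, ?_⟩
  · simp [hl]
    rfl
  · rw [hu', hu']
    exact e.strictMono (by simpa using hij)
  · have hr : Set.range e = K := Finset.range_orderEmbOfFin K rfl
    ext v
    constructor
    · rintro ⟨i, rfl⟩
      have : e (i.cast hlen) ∈ (K : Set ℕ) := hr ▸ ⟨_, rfl⟩
      simp only [hK, Finset.coe_image, Set.mem_image, Set.Finite.coe_toFinset] at this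
      obtain ⟨w, hw, hw'⟩ := this
      dsimp only
      rw [← hw', hu]
      exact hw
    · intro hv
      have : vertKey v ∈ (K : Set ℕ) := by
        simp only [hK, Finset.coe_image, Set.mem_image, Set.Finite.coe_toFinset]
        exact ⟨v, hv, rfl⟩
      rw [← hr] at this
      obtain ⟨i, hi⟩ := this
      exact ⟨i.cast hlen.symm, by simp [hi, hu]⟩

/-! ### Chain graphs and threshold graphs of words -/

theorem card_eq_length_of_iso {U : Type*} [Fintype U] {l : List (Fin 2)} {H : SimpleGraph U}
    {K : SimpleGraph (Fin l.length)} (e : H ≃g K) : l.length = Fintype.card U := by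
  rw [Fintype.card_congr e.toEquiv, Fintype.card_fin]

/-- The half-complete bipartite graph of a word. -/
def chainGraph (l : List (Fin 2)) : SimpleGraph (Fin l.length) :=
  (bip (· ≤ ·)).comap (wordPos l)

/-- The threshold graph of a word. -/
def thrGraph (l : List (Fin 2)) : SimpleGraph (Fin l.length) :=
  (split (· ≤ ·)).comap (wordPos l)

theorem chainGraph_adj {l : List (Fin 2)} {i j : Fin l.length} : (chainGraph l).Adj i j ↔
    (i < j ∧ l[i] = 0 ∧ l[j] = 1) ∨ (j < i ∧ l[j] = 0 ∧ l[i] = 1) :=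
  (isWordPos_wordPos l).bip_adj

theorem thrGraph_adj {l : List (Fin 2)} {i j : Fin l.length} :
    (thrGraph l).Adj i j ↔ (i < j ∧ l[i] = 0) ∨ (j < i ∧ l[j] = 0) :=
  (isWordPos_wordPos l).split_adj

theorem exists_iso_chainGraph {U : Type*} [Fintype U] {H : SimpleGraph U}
    (f : H ↪g bip (· ≤ ·)) : ∃ l, Nonempty (H ≃g chainGraph l) := by
  obtain ⟨l, g, hg, hr⟩ := exists_isWordPos (Set.finite_range f)
  have h : (bip (· ≤ ·)).comap g = chainGraph l := by
    ext i j
    rw [chainGraph_adj, SimpleGraph.comap_adj, hg.bip_adj]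
  obtain ⟨e⟩ := nonempty_iso_of_range_eq f (SimpleGraph.Embedding.comap ⟨g, hg.injective⟩ _)
    (hr.symm : Set.range f = Set.range g)
  exact ⟨l, ⟨h ▸ e⟩⟩

theorem exists_iso_thrGraph {U : Type*} [Fintype U] {H : SimpleGraph U}
    (f : H ↪g split (· ≤ ·)) : ∃ l, Nonempty (H ≃g thrGraph l) := by
  obtain ⟨l, g, hg, hr⟩ := exists_isWordPos (Set.finite_range f)
  have h : (split (· ≤ ·)).comap g = thrGraph l := by
    ext i j
    rw [thrGraph_adj, SimpleGraph.comap_adj, hg.split_adj]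
  obtain ⟨e⟩ := nonempty_iso_of_range_eq f (SimpleGraph.Embedding.comap ⟨g, hg.injective⟩ _)
    (hr.symm : Set.range f = Set.range g)
  exact ⟨l, ⟨h ▸ e⟩⟩

/-- Finite restrictions that contain all the additional vertices. -/
theorem exists_iso_comap_sumMap_wordPos {E : Type*} [Fintype E]
    {G : SimpleGraph ((ℕ × Fin 2) ⊕ E)} (h1 : G.comap Sum.inl = split (· ≤ ·))
    (h2 : ∀ u v x, u.2 = v.2 → (G.Adj (.inl u) (.inr x) ↔ G.Adj (.inl v) (.inr x)))
    {U : Type*} [Fintype U] {H : SimpleGraph U} (f : H ↪g G)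
    (hf : ∀ z, Sum.inr z ∈ Set.range f) :
    ∃ l, l.length + Fintype.card E = Fintype.card U ∧
      Nonempty (H ≃g G.comap (Sum.map (wordPos l) (id : E → E))) := by
  obtain ⟨l, g, hg, hr⟩ := exists_isWordPos (T := Sum.inl ⁻¹' Set.range f)
    ((Set.finite_range f).preimage Sum.inl_injective.injOn)
  have h1' : ∀ u v, G.Adj (.inl u) (.inl v) ↔ (split (· ≤ ·)).Adj u v := by
    rw [← h1]; simp
  have h : G.comap (Sum.map g (id : E → E)) = G.comap (Sum.map (wordPos l) (id : E → E)) := by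
    ext (i | z) (j | z')
    · simp only [SimpleGraph.comap_adj, Sum.map_inl, h1', hg.split_adj,
        (isWordPos_wordPos l).split_adj]
    · simpa using h2 _ _ _ (hg.letter i)
    · simpa [SimpleGraph.adj_comm] using h2 _ _ _ (hg.letter j)
    · simp
  obtain ⟨e⟩ := nonempty_iso_of_range_eq f (SimpleGraph.Embedding.comap
    ⟨Sum.map g (id : E → E), hg.injective.sumMap Function.injective_id⟩ G) (by
      refine Set.Subset.antisymm ?_ ?_
      · rintro (u | z) hz
        · have : u ∈ Set.range g := hr ▸ hz
          obtain ⟨i, rfl⟩ := this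
          exact ⟨.inl i, rfl⟩
        · exact ⟨.inr z, rfl⟩
      · rintro _ ⟨i | z, rfl⟩
        · have : g i ∈ Sum.inl ⁻¹' Set.range f := hr ▸ ⟨i, rfl⟩
          exact this
        · exact hf z)
  refine ⟨l, ?_, ⟨h ▸ e⟩⟩
  rw [Fintype.card_congr e.toEquiv, Fintype.card_sum, Fintype.card_fin]

/-! ### Threshold graphs -/

theorem univ_val_map_succ {n : ℕ} {α : Type*} (f : Fin (n + 1) → α) :
    (Finset.univ : Finset (Fin (n + 1))).val.map f =
      f 0 ::ₘ (Finset.univ : Finset (Fin n)).val.map fun i => f i.succ := by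
  rw [Fin.univ_val_map, Fin.univ_val_map, List.ofFn_succ]
  rfl

theorem univ_val_map_sum {α β γ : Type*} [Fintype α] [Fintype β] (f : α ⊕ β → γ) :
    (Finset.univ : Finset (α ⊕ β)).val.map f =
      (Finset.univ : Finset α).val.map (fun a => f (.inl a)) +
        (Finset.univ : Finset β).val.map (fun b => f (.inr b)) := by
  rw [← Finset.univ_disjSum_univ, Finset.val_disjSum, Multiset.disjSum, Multiset.map_add,
    Multiset.map_map, Multiset.map_map]
  rfl

/-- The degrees of the threshold graph of a word. -/
def thrDegs : List (Fin 2) → Multiset ℕ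
  | [] => 0
  | x :: l => if x = 0 then l.length ::ₘ (thrDegs l).map Nat.succ else 0 ::ₘ thrDegs l

theorem vdeg_thrGraph_zero {x : Fin 2} {l : List (Fin 2)} :
    vdeg (thrGraph (x :: l)) (0 : Fin (l.length + 1)) = if x = 0 then l.length else 0 := by
  refine (Fin.sum_univ_succ (n := l.length) _).trans ?_
  have h : ∀ i : Fin l.length,
      (thrGraph (x :: l)).Adj (0 : Fin (l.length + 1)) i.succ ↔ x = 0 := by
    intro i
    rw [thrGraph_adj]
    have : ¬ i.succ < (0 : Fin (l.length + 1)) := by simp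
    have h' : (0 : Fin (l.length + 1)) < i.succ := by simp
    simp [h']
  by_cases hx : x = 0 <;> simp [h, hx]

theorem thrGraph_cons_adj_succ {x : Fin 2} {l : List (Fin 2)} {i j : Fin l.length} :
    (thrGraph (x :: l)).Adj (i.succ : Fin (l.length + 1)) (j.succ : Fin (l.length + 1)) ↔
      (thrGraph l).Adj i j := by
  rw [thrGraph_adj, thrGraph_adj]
  have h : ∀ i j : Fin l.length, ((i.succ : Fin (l.length + 1)) < j.succ) ↔ i < j := fun i j =>
    Fin.succ_lt_succ_iff
  exact or_congr (and_congr (h i j) Iff.rfl) (and_congr (h j i) Iff.rfl)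

theorem vdeg_thrGraph_succ {x : Fin 2} {l : List (Fin 2)} (i : Fin l.length) :
    vdeg (thrGraph (x :: l)) (i.succ : Fin (l.length + 1)) =
      (if x = 0 then 1 else 0) + vdeg (thrGraph l) i := by
  refine (Fin.sum_univ_succ (n := l.length) _).trans ?_
  congr 1
  · have h : (thrGraph (x :: l)).Adj (i.succ : Fin (l.length + 1)) (0 : Fin (l.length + 1)) ↔
        x = 0 := by
      rw [thrGraph_adj]
      have : ¬ i.succ < (0 : Fin (l.length + 1)) := by simp
      have h' : (0 : Fin (l.length + 1)) < i.succ := by simp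
      simp [h']
    simp [h]
  · refine Finset.sum_congr rfl fun j _ => ?_
    classical exact if_congr thrGraph_cons_adj_succ rfl rfl

theorem degs_thrGraph (l : List (Fin 2)) : degs (thrGraph l) = thrDegs l := by
  induction l with
  | nil => rfl
  | cons x l ih =>
    refine (univ_val_map_succ (n := l.length) _).trans ?_
    rw [vdeg_thrGraph_zero]
    simp only [vdeg_thrGraph_succ, thrDegs]
    rw [← ih, degs, Multiset.map_map]
    by_cases hx : x = 0
    · simp [hx, Function.comp_def, add_comm]
    · simp [hx, Function.comp_def]


/-- The last letter of a word does not matter for its threshold graph. -/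
theorem nonempty_iso_thrGraph_append (l : List (Fin 2)) (x y : Fin 2) :
    Nonempty (thrGraph (l ++ [x]) ≃g thrGraph (l ++ [y])) := by
  have hlen : (l ++ [x]).length = (l ++ [y]).length := by simp
  refine ⟨⟨finCongr hlen, fun {i j} => ?_⟩⟩
  have key : ∀ i j : Fin (l ++ [x]).length, i < j →
      ((l ++ [y])[finCongr hlen i] = 0 ↔ (l ++ [x])[i] = 0) := by
    intro i j hij
    have hj := j.isLt
    have hij' : (i : ℕ) < j := hij
    simp only [List.length_append, List.length_singleton] at hj
    have hi : (i : ℕ) < l.length := by omega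
    simp [List.getElem_append_left hi]
  rw [thrGraph_adj, thrGraph_adj]
  refine or_congr (and_congr_right fun h => key i j ?_) (and_congr_right fun h => key j i ?_)
  · simpa using h
  · simpa using h

/-- Non-empty threshold graphs are given by words with last letter `1`. -/
theorem exists_iso_thrGraph_append {U : Type*} [Fintype U] {H : SimpleGraph U} {n : ℕ}
    (hn : Fintype.card U = n + 1) (f : H ↪g split (· ≤ ·)) :
    ∃ l : List (Fin 2), l.length = n ∧ Nonempty (H ≃g thrGraph (l ++ [1])) := by
  obtain ⟨l, ⟨e⟩⟩ := exists_iso_thrGraph f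
  have hlen := card_eq_length_of_iso e
  rcases List.eq_nil_or_concat' l with rfl | ⟨t, x, rfl⟩
  · simp [hn] at hlen
  · obtain ⟨e'⟩ := nonempty_iso_thrGraph_append t x 1
    exact ⟨t, by simp [hn] at hlen; omega, ⟨e.trans e'⟩⟩

/-- The degrees reveal the first letter, which is then peeled off: a leading `1` is isolated,
whereas a leading `0` is joined to everything. The fixed last letter keeps the rest nonempty, so
that a leading `0` leaves no vertex of degree zero. -/
theorem thrDegs_append_injective {l l' : List (Fin 2)} (hl : l.length = l'.length)
    (h : thrDegs (l ++ [1]) = thrDegs (l' ++ [1])) : l = l' := by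
  have key : ∀ l l' : List (Fin 2), thrDegs (0 :: l ++ [1]) ≠ thrDegs (1 :: l' ++ [1]) := by
    intro l l' h
    have h0 : 0 ∈ thrDegs (0 :: l ++ [1]) := by
      rw [h]; simp [thrDegs]
    simp [thrDegs] at h0
  induction l generalizing l' with
  | nil => exact (List.length_eq_zero_iff.1 hl.symm).symm
  | cons x l ih =>
    cases l' with
    | nil => simp at hl
    | cons y l' =>
      have hl' : l.length = l'.length := by simpa using hl
      obtain rfl | rfl : x = 0 ∨ x = 1 := by omega
      all_goals obtain rfl | rfl : y = 0 ∨ y = 1 := by omega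
      · simp only [List.cons_append, thrDegs, if_true, List.length_append, hl',
          Multiset.cons_inj_right] at h
        rw [ih hl' (Multiset.map_injective Nat.succ_injective h)]
      · exact (key _ _ h).elim
      · exact (key _ _ h.symm).elim
      · simp only [List.cons_append, thrDegs, one_ne_zero, if_false,
          Multiset.cons_inj_right] at h
        rw [ih hl' h]

theorem thrGraph_append_unique {l l' : List (Fin 2)} 
    (e : Nonempty (thrGraph (l ++ [1]) ≃g thrGraph (l' ++ [1]))) : l = l' := by
  obtain ⟨e⟩ := e
  refine thrDegs_append_injective ?_ ?_
  · simpa using Fintype.card_congr e.toEquiv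
  · rw [← degs_thrGraph, ← degs_thrGraph, degs_iso e]

/-! ### The profile of `G6` -/

/-- The standard restriction of `G6` to the vertices of a word and the two additional vertices. -/
def repG6 (l : List (Fin 2)) : SimpleGraph (Fin l.length ⊕ Fin 2) :=
  G6.comap (Sum.map (wordPos l) id)

theorem repG6_inl_inl {l : List (Fin 2)} {i j : Fin l.length} :
    (repG6 l).Adj (.inl i) (.inl j) ↔ (thrGraph l).Adj i j := by
  simp [repG6, G6, thrGraph]

theorem repG6_inl_inr {l : List (Fin 2)} {i : Fin l.length} {x : Fin 2} :
    (repG6 l).Adj (.inl i) (.inr x) ↔ x = 0 ∧ l[i] = 0 := by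
  simp [repG6, G6, wordPos]

theorem repG6_inr_inl {l : List (Fin 2)} {i : Fin l.length} {x : Fin 2} :
    (repG6 l).Adj (.inr x) (.inl i) ↔ x = 0 ∧ l[i] = 0 := by
  simp [repG6, G6, wordPos]

theorem repG6_inr_inr {l : List (Fin 2)} {x y : Fin 2} :
    (repG6 l).Adj (.inr x) (.inr y) ↔ x ≠ y := by
  simp [repG6, G6]

/-- The degrees of `repG6 l` except that of the vertex `b`. -/
def degsG6 : List (Fin 2) → Multiset ℕ
  | [] => {1}
  | x :: l => if x = 0 then (l.length + 1) ::ₘ (degsG6 l).map Nat.succ else 0 ::ₘ degsG6 l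

theorem sum_ite_getElem_eq (l : List (Fin 2)) (x : Fin 2) :
    (∑ i : Fin l.length, if l[i] = x then 1 else 0) = l.count x := by
  induction l with
  | nil => simp
  | cons y l ih =>
    refine (Fin.sum_univ_succ (n := l.length) _).trans ?_
    rw [List.count_cons, ← ih, add_comm]
    congr 1
    by_cases h : y = x <;> simp [h]

theorem vdeg_repG6_inl {l : List (Fin 2)} (i : Fin l.length) :
    vdeg (repG6 l) (.inl i) = vdeg (thrGraph l) i + if l[i] = 0 then 1 else 0 := by
  rw [vdeg, Fintype.sum_sum_type, vdeg]
  congr 1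
  · refine Finset.sum_congr rfl fun j _ => ?_
    classical exact if_congr repG6_inl_inl rfl rfl
  · rw [Fin.sum_univ_two]
    by_cases h : l[i] = 0 <;> simp [repG6_inl_inr, h]

theorem vdeg_repG6_a (l : List (Fin 2)) : vdeg (repG6 l) (.inr 0) = l.count 0 + 1 := by
  rw [vdeg, Fintype.sum_sum_type, ← sum_ite_getElem_eq]
  congr 1
  · refine Finset.sum_congr rfl fun j _ => ?_
    classical exact if_congr (by simp [repG6_inr_inl]) rfl rfl
  · simp [repG6_inr_inr]

theorem vdeg_repG6_b (l : List (Fin 2)) : vdeg (repG6 l) (.inr 1) = 1 := by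
  rw [vdeg, Fintype.sum_sum_type]
  simp [repG6_inr_inl, repG6_inr_inr]

/-- The vertex `a` is joined to the letters `0` like a vertex written after the whole word; its
pendant neighbour `b` raises its degree by one, which is the value `{1}` at the empty word. -/
theorem degsG6_eq (l : List (Fin 2)) : degsG6 l = (l.count 0 + 1) ::ₘ
    Finset.univ.val.map (fun i : Fin l.length =>
      vdeg (thrGraph l) i + if l[i] = 0 then 1 else 0) := by
  induction l with
  | nil => rfl
  | cons x l ih =>
    refine Eq.trans ?_ (congrArg _ (univ_val_map_succ (n := l.length) _).symm)
    rw [vdeg_thrGraph_zero]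
    simp only [vdeg_thrGraph_succ]
    rw [degsG6, ih]
    obtain rfl | rfl : x = 0 ∨ x = 1 := by omega
    · simp only [if_true, Multiset.map_cons, Multiset.map_map, Function.comp_def, List.count_cons,
        BEq.rfl]
      rw [Multiset.cons_swap]
      congr 3
      funext i
      simp [Nat.succ_eq_add_one]
      ring
    · simp [List.Perm.swap]

theorem degs_repG6 (l : List (Fin 2)) : degs (repG6 l) = 1 ::ₘ degsG6 l := by
  have h : (Finset.univ : Finset (Fin 2)).val.map (fun b => vdeg (repG6 l) (.inr b)) =
      {l.count 0 + 1, 1} := by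
    rw [show ({l.count 0 + 1, 1} : Multiset ℕ) =
      {vdeg (repG6 l) (.inr 0), vdeg (repG6 l) (.inr 1)} by rw [vdeg_repG6_a, vdeg_repG6_b]]
    rfl
  rw [degs, univ_val_map_sum, degsG6_eq, h]
  simp only [vdeg_repG6_inl]
  rw [Multiset.insert_eq_cons, Multiset.add_cons, add_comm _ {1}, Multiset.singleton_add,
    Multiset.cons_swap]

theorem zero_notMem_degsG6 (l : List (Fin 2)) : 0 ∉ degsG6 (0 :: l) := by
  simp [degsG6]

theorem degsG6_injective {l l' : List (Fin 2)} (hl : l.length = l'.length)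
    (h : degsG6 l = degsG6 l') : l = l' := by
  have key : ∀ l l' : List (Fin 2), degsG6 (0 :: l) ≠ degsG6 (1 :: l') := by
    intro l l' h
    apply zero_notMem_degsG6 l
    rw [h]
    simp [degsG6]
  induction l generalizing l' with
  | nil => exact (List.length_eq_zero_iff.1 hl.symm).symm
  | cons x l ih =>
    cases l' with
    | nil => simp at hl
    | cons y l' =>
      have hl' : l.length = l'.length := by simpa using hl
      obtain rfl | rfl : x = 0 ∨ x = 1 := by omega
      all_goals obtain rfl | rfl : y = 0 ∨ y = 1 := by omega
      · simp only [degsG6, if_true, hl', Multiset.cons_inj_right] at h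
        rw [ih hl' (Multiset.map_injective Nat.succ_injective h)]
      · exact (key _ _ h).elim
      · exact (key _ _ h.symm).elim
      · simp only [degsG6, one_ne_zero, if_false, Multiset.cons_inj_right] at h
        rw [ih hl' h]

theorem le_of_mem_degsG6 {l : List (Fin 2)} {d : ℕ} (h : d ∈ degsG6 l) : d ≤ l.length + 1 := by
  induction l generalizing d with
  | nil => simp [degsG6] at h; simp [h]
  | cons x l ih =>
    obtain rfl | rfl : x = 0 ∨ x = 1 := by omega
    · simp only [degsG6, if_true, Multiset.mem_cons, Multiset.mem_map] at h
      rcases h with rfl | ⟨e, he, rfl⟩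
      · simp
      · simpa using ih he
    · simp only [degsG6, one_ne_zero, if_false, Multiset.mem_cons] at h
      rcases h with rfl | h
      · simp
      · have := ih h
        simp; omega

/-- A letter has degree at most the length of the word, so only `a` can reach this value, thanks to
`b`, and only if it is joined to all the letters. -/
theorem eq_replicate_of_mem_degsG6 {l : List (Fin 2)} (h : l.length + 1 ∈ degsG6 l) :
    l = List.replicate l.length 0 := by
  induction l with
  | nil => rfl
  | cons x l ih =>
    obtain rfl | rfl : x = 0 ∨ x = 1 := by omega
    · simp only [degsG6, if_true, Multiset.mem_cons, Multiset.mem_map, List.length_cons] at h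
      rcases h with h | ⟨e, he, h⟩
      · omega
      · obtain rfl : e = l.length + 1 := by omega
        rw [List.length_cons, List.replicate_succ, ← ih he]
    · simp only [degsG6, one_ne_zero, if_false, Multiset.mem_cons, List.length_cons] at h
      rcases h with h | h
      · omega
      · have := le_of_mem_degsG6 h
        omega

/-- Used when `repG6 l` is a threshold graph. Leading `1`s are isolated and can be stripped on both
sides. Once `l` begins with `0` there is no isolated vertex, so the threshold graph has a dominating
vertex. It is joined to `b`, hence it is `a`, and all the remaining letters are `0`. -/
theorem sorted_of_thrDegs_eq {l t : List (Fin 2)} (hl : t.length = l.length + 1)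
    (h : thrDegs (t ++ [1]) = 1 ::ₘ degsG6 l) :
    ∃ x y, l = List.replicate x 1 ++ List.replicate y 0 := by
  induction l generalizing t with
  | nil => exact ⟨0, 0, rfl⟩
  | cons x l ih =>
    cases t with
    | nil => simp at hl
    | cons z t =>
      have hl' : t.length = l.length + 1 := by simpa using hl
      obtain rfl | rfl : x = 0 ∨ x = 1 := by omega
      · obtain rfl : z = 0 := by
          by_contra hz
          have h0 : 0 ∈ 1 ::ₘ degsG6 (0 :: l) := by
            rw [← h]; simp [thrDegs, hz]
          simp [zero_notMem_degsG6] at h0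
        have hm : l.length + 2 ∈ 1 ::ₘ degsG6 (0 :: l) := by
          rw [← h]; simp [thrDegs, hl']
        simp only [degsG6, if_true, Multiset.mem_cons, Multiset.mem_map] at hm
        rcases hm with hm | hm | ⟨e, he, hm⟩
        · omega
        · omega
        · obtain rfl : e = l.length + 1 := by omega
          have := eq_replicate_of_mem_degsG6 he
          exact ⟨0, l.length + 1, by rw [List.replicate_succ, ← this]; rfl⟩
      · obtain rfl : z = 1 := by
          by_contra hz
          obtain rfl : z = 0 := by omega
          have h0 : 0 ∈ thrDegs (0 :: t ++ [1]) := by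
            rw [h]; simp [degsG6]
          simp [thrDegs] at h0
        simp only [List.cons_append, thrDegs, degsG6, one_ne_zero, if_false] at h
        rw [Multiset.cons_swap, Multiset.cons_inj_right] at h
        obtain ⟨x, y, rfl⟩ := ih hl' h
        exact ⟨x + 1, y, rfl⟩


/-! ### Counting words, and the profile of `G6` -/

/-- The words of length `m`. -/
def words (m : ℕ) : Finset (List (Fin 2)) :=
  (Finset.univ : Finset (List.Vector (Fin 2) m)).map
    ⟨List.Vector.toList, List.Vector.toList_injective⟩

@[simp] theorem mem_words {m : ℕ} {l : List (Fin 2)} : l ∈ words m ↔ l.length = m := by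
  simp only [words, Finset.mem_map, Finset.mem_univ, true_and]
  constructor
  · rintro ⟨v, rfl⟩
    exact v.2
  · exact fun h => ⟨⟨l, h⟩, rfl⟩

theorem card_words (m : ℕ) : (words m).card = 2 ^ m := by
  rw [words, Finset.card_map, Finset.card_univ, card_vector, Fintype.card_fin]

/-- The words of length `m` of the form `1 … 1 0 … 0`. -/
def sortedWords (m : ℕ) : Finset (List (Fin 2)) :=
  (Finset.range (m + 1)).image fun x => List.replicate x 1 ++ List.replicate (m - x) 0

theorem card_sortedWords (m : ℕ) : (sortedWords m).card = m + 1 := by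
  rw [sortedWords, Finset.card_image_of_injective, Finset.card_range]
  intro x y h
  have := congrArg (List.count 1) h
  simpa [List.count_replicate] using this

theorem mem_sortedWords {m : ℕ} {l : List (Fin 2)} : l ∈ sortedWords m ↔
    l.length = m ∧ ∃ x y, l = List.replicate x 1 ++ List.replicate y 0 := by
  simp only [sortedWords, Finset.mem_image, Finset.mem_range]
  constructor
  · rintro ⟨x, hx, rfl⟩
    exact ⟨by simp; omega, x, _, rfl⟩
  · rintro ⟨rfl, x, y, rfl⟩
    exact ⟨x, by simp, by simp⟩

theorem sortedWords_subset (m : ℕ) : sortedWords m ⊆ words m := fun _ h =>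
  mem_words.2 (mem_sortedWords.1 h).1

/-- The `1`s are isolated, the `0`s and `a` form a clique, and `b` hangs on `a`. In threshold order
this reads: the `1`s, then `a` and `b` at the index `x`, then the `0`s shifted by one. -/
theorem nonempty_embedding_repG6_sorted (x y : ℕ) :
    Nonempty (repG6 (List.replicate x 1 ++ List.replicate y 0) ↪g split (· ≤ ·)) := by
  set l : List (Fin 2) := List.replicate x 1 ++ List.replicate y 0 with hl
  have h1 : ∀ i : Fin l.length, (i : ℕ) < x → l[i] = 1 := by
    intro i hi
    simp [hl, List.getElem_append, hi]
  have h0 : ∀ i : Fin l.length, x ≤ (i : ℕ) → l[i] = 0 := by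
    intro i hi
    simp [hl, List.getElem_append, hi]
  refine ⟨⟨⟨Sum.elim (fun i => if (i : ℕ) < x then (i, 1) else (i + 1, 0)) (fun z => (x, z)), ?_⟩,
    ?_⟩⟩
  · rintro (i | z) (j | z') h
    · simp only [Sum.elim_inl] at h
      split_ifs at h <;> simp at h <;> rw [Fin.ext_iff.2 h]
    · simp only [Sum.elim_inl, Sum.elim_inr] at h
      split_ifs at h <;> simp at h <;> omega
    · simp only [Sum.elim_inl, Sum.elim_inr] at h
      split_ifs at h <;> simp at h <;> omega
    · simpa using h
  · rintro (i | z) (j | z')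
    · change (split (· ≤ ·)).Adj (if (i : ℕ) < x then _ else _) (if (j : ℕ) < x then _ else _) ↔ _
      rw [repG6_inl_inl, thrGraph_adj]
      have hij : i < j ↔ (i : ℕ) < j := Iff.rfl
      have hji : j < i ↔ (j : ℕ) < i := Iff.rfl
      by_cases hi : (i : ℕ) < x <;> by_cases hj : (j : ℕ) < x <;>
        [have e1 := h1 i hi; have e1 := h1 i hi; have e1 := h0 i (not_lt.1 hi);
          have e1 := h0 i (not_lt.1 hi)] <;>
        [have e2 := h1 j hj; have e2 := h0 j (not_lt.1 hj); have e2 := h1 j hj;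
          have e2 := h0 j (not_lt.1 hj)]
      all_goals rw [e1, e2]; simp [hi, hj]
      all_goals omega
    · change (split (· ≤ ·)).Adj (if (i : ℕ) < x then _ else _) (x, z') ↔ _
      rw [repG6_inl_inr]
      obtain rfl | rfl : z' = 0 ∨ z' = 1 := by omega
      all_goals by_cases hi : (i : ℕ) < x
      all_goals first | have e1 := h1 i hi | have e1 := h0 i (not_lt.1 hi)
      all_goals rw [e1]; simp [hi]
      all_goals omega
    · change (split (· ≤ ·)).Adj (x, z) (if (j : ℕ) < x then _ else _) ↔ _
      rw [repG6_inr_inl]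
      obtain rfl | rfl : z = 0 ∨ z = 1 := by omega
      all_goals by_cases hi : (j : ℕ) < x
      all_goals first | have e1 := h1 j hi | have e1 := h0 j (not_lt.1 hi)
      all_goals rw [e1]; simp [hi]
      all_goals omega
    · change (split (· ≤ ·)).Adj (x, z) (x, z') ↔ _
      rw [repG6_inr_inr]
      revert z z'
      simp [Fin.forall_fin_two]

/-- Without `b`, the vertex `a` is a letter `0` after all the others, at the index `N + 1`. Without
`a`, the vertex `b` is isolated and becomes a first letter `1`. The shift of the indices makes room
for it. -/
theorem nonempty_embedding_of_not_both {U : Type*} [Finite U] {H : SimpleGraph U} (f : H ↪g G6)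
    (hf : ¬ ∀ z, Sum.inr z ∈ Set.range f) : Nonempty (H ↪g split (· ≤ ·)) := by
  classical
  obtain ⟨N, hN⟩ := exists_forall_inl_lt (Set.finite_range f).toFinset
  have hN' : ∀ v u, f v = .inl u → u.1 < N := fun v u h => hN (f v) (by simp) u h
  let h : (ℕ × Fin 2) ⊕ Fin 2 → ℕ × Fin 2 :=
    Sum.elim (fun u => (u.1 + 1, u.2)) (fun z => if z = 0 then (N + 1, 0) else (0, 1))
  have hnot : ∀ v w z z', f v = .inr z → f w = .inr z' → z = z' := by
    intro v w z z' hv hw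
    by_contra hz
    refine hf fun y => ?_
    have : y = z ∨ y = z' := by omega
    rcases this with rfl | rfl
    · exact ⟨v, hv⟩
    · exact ⟨w, hw⟩
  refine ⟨⟨⟨fun v => h (f v), ?_⟩, ?_⟩⟩
  · intro v w hvw
    apply f.injective
    dsimp only at hvw
    have h1 := hN' v
    have h2 := hN' w
    have h3 := hnot v w
    rcases hv : f v with ⟨i, x⟩ | z <;> rcases hw : f w with ⟨j, y⟩ | z'
    all_goals rw [hv, hw] at hvw
    all_goals simp only [hv, hw, Sum.inl.injEq, Sum.inr.injEq, forall_eq', reduceCtorEq] at h1 h2 h3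
    all_goals simp only [h, Sum.elim_inl, Sum.elim_inr] at hvw
    · simpa using hvw
    · split_ifs at hvw <;> simp at hvw; omega
    · split_ifs at hvw <;> simp at hvw; omega
    · rw [h3 _ _ rfl rfl]
  · intro v w
    rw [← f.map_adj_iff]
    change (split (· ≤ ·)).Adj (h (f v)) (h (f w)) ↔ _
    have h1 := hN' v
    have h2 := hN' w
    have h3 := hnot v w
    rcases hv : f v with ⟨i, x⟩ | z <;> rcases hw : f w with ⟨j, y⟩ | z'
    all_goals simp only [hv, hw, Sum.inl.injEq, Sum.inr.injEq, forall_eq', reduceCtorEq] at h1 h2 h3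
    all_goals simp only [h, Sum.elim_inl, Sum.elim_inr, G6, addAB_inl_inl, addAB_inl_inr,
      addAB_inr_inl, addAB_inr_inr]
    all_goals try obtain rfl | rfl : x = 0 ∨ x = 1 := by omega
    all_goals try obtain rfl | rfl : y = 0 ∨ y = 1 := by omega
    all_goals try obtain rfl | rfl : z = 0 ∨ z = 1 := by omega
    all_goals try obtain rfl | rfl : z' = 0 ∨ z' = 1 := by omega
    all_goals simp at h1 h2 h3 ⊢
    all_goals omega

/-- The vertices of the standard restrictions of `G6` with `m + 2` vertices. -/
def VertG6 (m : ℕ) : words (m + 1) ⊕ ↥(words m \ sortedWords m) → Type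
  | .inl t => Fin (t.1 ++ [1]).length
  | .inr l => Fin l.1.length ⊕ Fin 2

instance (m : ℕ) (i) : Finite (VertG6 m i) := by
  rcases i with p | x
  · exact inferInstanceAs (Finite (Fin _))
  · exact inferInstanceAs (Finite (Fin _ ⊕ Fin 2))

/-- The standard restrictions of `G6` with `m + 2` vertices. -/
def graphG6 (m : ℕ) : ∀ i, SimpleGraph (VertG6 m i)
  | .inl t => thrGraph (t.1 ++ [1])
  | .inr l => repG6 l.1

/-- Threshold graphs are restrictions of the graphs that contain the split graph of `≤`. -/
theorem nonempty_embedding_thrGraph {E : Type*} {G : SimpleGraph ((ℕ × Fin 2) ⊕ E)}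
    (h : G.comap Sum.inl = split (· ≤ ·)) (l : List (Fin 2)) : Nonempty (thrGraph l ↪g G) := by
  refine ⟨⟨⟨fun i => .inl (wordPos l i), fun i j hij => ?_⟩, ?_⟩⟩
  · exact (isWordPos_wordPos l).injective (Sum.inl_injective hij)
  · intro i j
    change (G.comap Sum.inl).Adj (wordPos l i) (wordPos l j) ↔ _
    rw [h]
    rfl

/-- The first term counts the threshold graphs, the second the restrictions through both `a` and `b`
that are not threshold. -/
theorem profile_G6 (m : ℕ) : profile (age G6) (m + 2) = 2 ^ (m + 1) + (2 ^ m - (m + 1)) := by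
  have key := profile_eq_card (G := G6) (n := m + 2) (graphG6 m) ?_ ?_ ?_ ?_
  · rw [key, Fintype.card_sum, Fintype.card_coe, Fintype.card_coe, card_words,
      Finset.card_sdiff_of_subset (sortedWords_subset m), card_words, card_sortedWords]
  · rintro (⟨t, h⟩ | ⟨l, h⟩)
    · change Nat.card (Fin _) = m + 2
      rw [mem_words] at h
      simp [h]
    · change Nat.card (Fin _ ⊕ Fin 2) = m + 2
      have := mem_words.1 (Finset.mem_sdiff.1 h).1
      simp [this]
  · rintro (t | l)
    · exact nonempty_embedding_thrGraph (comap_inl_addAB _) _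
    · exact ⟨SimpleGraph.Embedding.comap
        ⟨_, (isWordPos_wordPos l.1).injective.sumMap Function.injective_id⟩ _⟩
  · intro H f
    have hthr : Nonempty (H ↪g split (· ≤ ·)) → ∃ i, Nonempty (H ≃g graphG6 m i) := by
      rintro ⟨g⟩
      obtain ⟨t, ht, e⟩ := exists_iso_thrGraph_append (n := m + 1) (by simp) g
      exact ⟨.inl ⟨t, mem_words.2 ht⟩, e⟩
    by_cases hf : ∀ z, Sum.inr z ∈ Set.range f
    · obtain ⟨l, hl, ⟨e⟩⟩ := exists_iso_comap_sumMap_wordPos (comap_inl_addAB _)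
        (by intro u v x h; simp [h]) f hf
      have hl' : l.length = m := by simpa using hl
      by_cases hs : l ∈ sortedWords m
      · obtain ⟨-, x, y, rfl⟩ := mem_sortedWords.1 hs
        obtain ⟨g⟩ := nonempty_embedding_repG6_sorted x y
        exact hthr ⟨g.comp e.toRelEmbedding⟩
      · exact ⟨.inr ⟨l, Finset.mem_sdiff.2 ⟨mem_words.2 hl', hs⟩⟩, ⟨e⟩⟩
    · exact hthr (nonempty_embedding_of_not_both f hf)
  · have hmix : ∀ t l, t ∈ words (m + 1) → l ∈ words m \ sortedWords m →
        ¬ Nonempty (thrGraph (t ++ [1]) ≃g repG6 l) := by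
      rintro t l ht hl ⟨e⟩
      obtain ⟨h1, h2⟩ := Finset.mem_sdiff.1 hl
      rw [mem_words] at h1 ht
      refine h2 (mem_sortedWords.2 ⟨h1, sorted_of_thrDegs_eq (t := t) (by omega) ?_⟩)
      rw [← degs_thrGraph, ← degs_repG6, degs_iso e]
    rintro (⟨t, h⟩ | ⟨l, h⟩) (⟨t', h'⟩ | ⟨l', h'⟩) e
    · obtain rfl := thrGraph_append_unique e
      rfl
    · exact (hmix t l' h h' e).elim
    · exact (hmix t' l h' h ⟨e.some.symm⟩).elim
    · obtain ⟨e⟩ := e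
      change repG6 l ≃g repG6 l' at e
      have h1 := mem_words.1 (Finset.mem_sdiff.1 h).1
      have h2 := mem_words.1 (Finset.mem_sdiff.1 h').1
      obtain rfl : l = l' := degsG6_injective (by omega) (by
        have := degs_iso e
        rw [degs_repG6, degs_repG6, Multiset.cons_inj_right] at this
        exact this.symm)
      rfl

/-! ### Profiles at zero and one -/

theorem profile_zero {V : Type*} (G : SimpleGraph V) : profile (age G) 0 = 1 := by
  have key := profile_eq_card (G := G) (n := 0) (ι := Unit) (W := fun _ => Fin 0)
    (fun _ => ⊥) (by simp) (fun _ => ⟨⟨⟨Fin.elim0, fun i => i.elim0⟩, fun {i} => i.elim0⟩⟩) ?_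
    (fun _ _ _ => rfl)
  · simpa using key
  · intro H _
    exact ⟨(), ⟨⟨Equiv.refl _, fun {i} => i.elim0⟩⟩⟩

theorem profile_one {V : Type*} [Nonempty V] (G : SimpleGraph V) : profile (age G) 1 = 1 := by
  have key := profile_eq_card (G := G) (n := 1) (ι := Unit) (W := fun _ => Fin 1)
    (fun _ => ⊥) (by simp) (fun _ => ⟨⟨⟨fun _ => Classical.arbitrary V, fun i j _ =>
      Subsingleton.elim i j⟩, fun {i j} => by rw [Subsingleton.elim i j]; simp⟩⟩) ?_ (fun _ _ _ => rfl)
  · simpa using key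
  · intro H _
    refine ⟨(), ⟨⟨Equiv.refl _, fun {i j} => ?_⟩⟩⟩
    rw [Subsingleton.elim i j]
    simp


/-! ### The restrictions of `G5` that contain `c` -/

/-- The standard restriction of `G5` to the vertices of a word and the vertex `c`. -/
def repG5 (l : List (Fin 2)) : SimpleGraph (Fin l.length ⊕ Unit) :=
  G5.comap (Sum.map (wordPos l) id)

theorem repG5_inl_inl {l : List (Fin 2)} {i j : Fin l.length} :
    (repG5 l).Adj (.inl i) (.inl j) ↔ (i < j ∧ l[i] = 0) ∨ (j < i ∧ l[j] = 0) := by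
  rw [← thrGraph_adj]
  simp [repG5, G5, thrGraph]

theorem repG5_inl_inr {l : List (Fin 2)} {i : Fin l.length} {z : Unit} :
    (repG5 l).Adj (.inl i) (.inr z) ↔ l[i] = 1 := by
  simp [repG5, G5, wordPos]

theorem repG5_inr_inl {l : List (Fin 2)} {i : Fin l.length} {z : Unit} :
    (repG5 l).Adj (.inr z) (.inl i) ↔ l[i] = 1 := by
  simp [repG5, G5, wordPos]

/-- The earliest of the four vertices would have both an edge and a non-edge to later ones, while a
single letter decides all its later adjacencies. -/
theorem not_thr_of_alternating {l : List (Fin 2)} {u v x y : Fin l.length} (hux : u ≠ x)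
    (hvy : v ≠ y) (huv : (thrGraph l).Adj u v) (hxy : (thrGraph l).Adj x y)
    (h1 : ¬ (thrGraph l).Adj u x) (h2 : ¬ (thrGraph l).Adj v y) : False := by
  rw [thrGraph_adj] at *
  have := Fin.val_ne_of_ne hux
  have := Fin.val_ne_of_ne hvy
  simp only [Fin.lt_def] at *
  grind

/-- Words that begin with a constant word and one arbitrary letter. -/
theorem repG5_not_thr {l t : List (Fin 2)}
    (hl : ∀ z x, l ≠ List.replicate (l.length - 1) z ++ [x]) (hne : l ≠ [])
    (e : Nonempty (thrGraph t ≃g repG5 l)) : False := by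
  obtain ⟨e⟩ := e
  have key : ∀ u v x y, u ≠ x → v ≠ y → (repG5 l).Adj u v → (repG5 l).Adj x y →
      ¬ (repG5 l).Adj u x → ¬ (repG5 l).Adj v y → False := by
    intro u v x y h1 h2 h3 h4 h5 h6
    refine not_thr_of_alternating (u := e.symm u) (v := e.symm v) (x := e.symm x) (y := e.symm y)
      (by simpa using h1) (by simpa using h2) ?_ ?_ ?_ ?_
    all_goals rw [e.symm.map_adj_iff]; assumption
  rcases List.eq_nil_or_concat' l with rfl | ⟨s, z, rfl⟩
  · exact hne rfl
  · have hconst : ∀ w : Fin 2, ∃ i, ∃ h : i < s.length, s[i] = w := by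
      intro w
      by_contra hcon
      push Not at hcon
      refine hl (1 - w) z ?_
      congr 1
      refine List.ext_getElem (by simp) fun i h1 h2 => ?_
      have := hcon i h1
      rw [List.getElem_replicate]
      omega
    obtain ⟨i, hi, hi0⟩ := hconst 0
    obtain ⟨j, hj, hj1⟩ := hconst 1
    have hlen : (s ++ [z]).length = s.length + 1 := by simp
    -- An alternating cycle: `c` is joined to `J` and not to `I`, while the last vertex `K`,
    -- whatever its letter, is joined to `I` and not to `J`.
    let I : Fin (s ++ [z]).length := ⟨i, by omega⟩
    let J : Fin (s ++ [z]).length := ⟨j, by omega⟩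
    let K : Fin (s ++ [z]).length := ⟨s.length, by omega⟩
    have hI : (s ++ [z])[I] = 0 := by simp [I, List.getElem_append_left hi, hi0]
    have hJ : (s ++ [z])[J] = 1 := by simp [J, List.getElem_append_left hj, hj1]
    have hK : (s ++ [z])[K] = z := by simp [K]
    have hIK : I < K := hi
    have hJK : J < K := hj
    obtain rfl | rfl : z = 0 ∨ z = 1 := by omega
    · refine key (.inr ()) (.inl J) (.inl I) (.inl K) (by simp) (by simpa using hJK.ne) ?_ ?_ ?_ ?_
      · rw [repG5_inr_inl, hJ]
      · rw [repG5_inl_inl]; exact .inl ⟨hIK, hI⟩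
      · rw [repG5_inr_inl, hI]; simp
      · rw [repG5_inl_inl, hJ]; simp [hJK.le]
    · refine key (.inr ()) (.inl J) (.inl I) (.inl K) (by simp) (by simpa using hJK.ne) ?_ ?_ ?_ ?_
      · rw [repG5_inr_inl, hJ]
      · rw [repG5_inl_inl]; exact .inl ⟨hIK, hI⟩
      · rw [repG5_inr_inl, hI]; simp
      · rw [repG5_inl_inl, hJ, hK]; simp

theorem getElem_replicate_append (k : ℕ) (z x : Fin 2)
    (i : Fin (List.replicate k z ++ [x]).length) :
    (List.replicate k z ++ [x])[i] = if (i : ℕ) < k then z else x := by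
  simp [List.getElem_append]

/-- The vertex `c` behaves uniformly towards a constant prefix. So `c`, together with a last letter
different from `z`, can be placed in front of the prefix as a dominating or isolated vertex. -/
theorem nonempty_embedding_repG5 (k : ℕ) (z x : Fin 2) :
    Nonempty (repG5 (List.replicate k z ++ [x]) ↪g split (· ≤ ·)) := by
  set l := List.replicate k z ++ [x] with hl
  have hlen : l.length = k + 1 := by simp [hl]
  have hget : ∀ i : Fin l.length, l[i] = if (i : ℕ) < k then z else x :=
    getElem_replicate_append k z x
  have main : ∀ (F : ℕ → ℕ × Fin 2) (c : ℕ × Fin 2),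
      (∀ i ≤ k, ∀ j ≤ k, F i = F j → i = j) → (∀ i ≤ k, F i ≠ c) →
      (∀ i ≤ k, ∀ j ≤ k, ((split (· ≤ ·)).Adj (F i) (F j) ↔
        (i < j ∧ (if i < k then z else x) = 0) ∨ (j < i ∧ (if j < k then z else x) = 0))) →
      (∀ i ≤ k, (split (· ≤ ·)).Adj (F i) c ↔ (if i < k then z else x) = 1) →
      Nonempty (repG5 l ↪g split (· ≤ ·)) := by
    intro F c h1 h2 h3 h4
    have hle : ∀ i : Fin l.length, (i : ℕ) ≤ k := fun i => by omega
    refine ⟨⟨⟨Sum.elim (fun i => F i) (fun _ => c), ?_⟩, ?_⟩⟩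
    · rintro (i | u) (j | u') h
      · rw [Fin.ext (h1 _ (hle i) _ (hle j) h)]
      · exact (h2 _ (hle i) h).elim
      · exact (h2 _ (hle j) h.symm).elim
      · rfl
    · rintro (i | u) (j | u')
      · rw [repG5_inl_inl, hget, hget]
        exact h3 i (hle i) j (hle j)
      · rw [repG5_inl_inr, hget]
        exact h4 i (hle i)
      · rw [SimpleGraph.adj_comm, repG5_inr_inl, hget]
        exact h4 j (hle j)
      · simp
  obtain rfl | rfl : z = 0 ∨ z = 1 := by omega
  all_goals obtain rfl | rfl : x = 0 ∨ x = 1 := by omega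
  · refine main (fun i => (i + 1, 0)) (0, 1) ?_ ?_ ?_ ?_
    · intro i hi j hj h
      simpa using h
    · simp
    · intro i hi j hj
      simp only [split_adj_zero_zero, ite_self, and_true]
      omega
    · intro i hi
      simp
  · refine main (fun i => if i < k then (i + 1, 0) else (0, 0)) (0, 1) ?_ ?_ ?_ ?_
    · intro i hi j hj h
      by_cases h1 : i < k <;> by_cases h2 : j < k <;> simp [h1, h2] at h <;> omega
    · intro i hi h
      by_cases h1 : i < k <;> simp [h1] at h
    · intro i hi j hj
      by_cases h1 : i < k <;> by_cases h2 : j < k <;>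
        simp [h1, h2] <;> omega
    · intro i hi
      by_cases h1 : i < k <;> simp [h1]
  · refine main (fun i => if i < k then (i + 1, 1) else (0, 1)) (1, 0) ?_ ?_ ?_ ?_
    · intro i hi j hj h
      by_cases h1 : i < k <;> by_cases h2 : j < k <;> simp [h1, h2] at h <;> omega
    · intro i hi h
      by_cases h1 : i < k <;> simp [h1] at h
    · intro i hi j hj
      by_cases h1 : i < k <;> by_cases h2 : j < k <;>
        simp [h1, h2] <;> omega
    · intro i hi
      by_cases h1 : i < k <;> simp [h1]
  · refine main (fun i => (i, 1)) (0, 0) ?_ ?_ ?_ ?_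
    · intro i hi j hj h
      simpa using h
    · simp
    · intro i hi j hj
      simp
    · intro i hi
      simp


/-! ### The multiset of the numbers of ones after the zeros of a word -/

/-- For every letter `0` of a word, the number of letters `1` after it. -/
def zeroDegs : List (Fin 2) → Multiset ℕ
  | [] => 0
  | x :: l => if x = 0 then l.count 1 ::ₘ zeroDegs l else zeroDegs l

theorem card_zeroDegs (l : List (Fin 2)) : (zeroDegs l).card = l.count 0 := by
  induction l with
  | nil => rfl
  | cons x l ih =>
    obtain rfl | rfl : x = 0 ∨ x = 1 := by omega
    all_goals simp [zeroDegs, ih]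

theorem count_zero_add_count_one (l : List (Fin 2)) : l.count 0 + l.count 1 = l.length := by
  induction l with
  | nil => rfl
  | cons x l ih =>
    obtain rfl | rfl : x = 0 ∨ x = 1 := by omega
    all_goals simp [← ih]; omega

theorem le_of_mem_zeroDegs {l : List (Fin 2)} {d : ℕ} (h : d ∈ zeroDegs l) : d ≤ l.count 1 := by
  induction l with
  | nil => simp [zeroDegs] at h
  | cons x l ih =>
    obtain rfl | rfl : x = 0 ∨ x = 1 := by omega
    · simp only [zeroDegs, if_true, Multiset.mem_cons] at h
      rcases h with rfl | h
      · simp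
      · simpa using ih h
    · simp only [zeroDegs, one_ne_zero, if_false] at h
      have := ih h
      simp; omega

/-- A leading `0` records the total number of `1`s, a value that no entry reaches after a leading
`1`. This determines the first letter, and induction does the rest. -/
theorem zeroDegs_injective {l l' : List (Fin 2)} (h1 : l.count 1 = l'.count 1)
    (h : zeroDegs l = zeroDegs l') : l = l' := by
  have key : ∀ t t' : List (Fin 2), (0 :: t).count 1 = (1 :: t').count 1 →
      zeroDegs (0 :: t) ≠ zeroDegs (1 :: t') := by
    intro t t' h1 h
    have hm : t.count 1 ∈ zeroDegs (1 :: t') := by rw [← h]; simp [zeroDegs]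
    simp only [zeroDegs, one_ne_zero, if_false] at hm
    have := le_of_mem_zeroDegs hm
    simp at h1
    omega
  have hlen : l.length = l'.length := by
    rw [← count_zero_add_count_one, ← count_zero_add_count_one, ← card_zeroDegs, ← card_zeroDegs,
      h, h1]
  induction l generalizing l' with
  | nil => exact (List.length_eq_zero_iff.1 hlen.symm).symm
  | cons x l ih =>
    cases l' with
    | nil => simp at hlen
    | cons y l' =>
      have hlen' : l.length = l'.length := by simpa using hlen
      obtain rfl | rfl : x = 0 ∨ x = 1 := by omega
      all_goals obtain rfl | rfl : y = 0 ∨ y = 1 := by omega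
      · have h1' : l.count 1 = l'.count 1 := by simpa using h1
        simp only [zeroDegs, if_true, h1', Multiset.cons_inj_right] at h
        rw [ih h1' h hlen']
      · exact (key _ _ h1 h).elim
      · exact (key _ _ h1.symm h.symm).elim
      · have h1' : l.count 1 = l'.count 1 := by simpa using h1
        simp only [zeroDegs, one_ne_zero, if_false] at h
        rw [ih h1' h hlen']

/-- The number of letters `1` after the position `i`. -/
def onesAfter (l : List (Fin 2)) (i : Fin l.length) : ℕ :=
  ∑ j : Fin l.length, if i < j ∧ l[j] = 1 then 1 else 0

theorem univ_val_succ (n : ℕ) : (Finset.univ : Finset (Fin (n + 1))).val =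
    0 ::ₘ (Finset.univ : Finset (Fin n)).val.map Fin.succ := by
  have := univ_val_map_succ (n := n) id
  rwa [Multiset.map_id] at this

theorem map_onesAfter (l : List (Fin 2)) :
    ((Finset.univ : Finset (Fin l.length)).val.filter (fun i => l[i] = 0)).map (onesAfter l) =
      zeroDegs l := by
  induction l with
  | nil => rfl
  | cons x l ih =>
    have h0 : onesAfter (x :: l) (0 : Fin (l.length + 1)) = l.count 1 := by
      refine (Fin.sum_univ_succ (n := l.length) _).trans ?_
      rw [← sum_ite_getElem_eq]
      simp
    have h1 : ∀ i : Fin l.length,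
        onesAfter (x :: l) (i.succ : Fin (l.length + 1)) = onesAfter l i := by
      intro i
      refine (Fin.sum_univ_succ (n := l.length) _).trans ?_
      rw [if_neg (by simp), zero_add]
      refine Finset.sum_congr rfl fun j _ => ?_
      exact if_congr (and_congr Fin.succ_lt_succ_iff Iff.rfl) rfl rfl
    have hu : (Finset.univ : Finset (Fin (x :: l).length)).val =
      (0 : Fin (l.length + 1)) ::ₘ (Finset.univ : Finset (Fin l.length)).val.map Fin.succ :=
      univ_val_succ l.length
    have hm : ((((Finset.univ : Finset (Fin l.length)).val.map
        (Fin.succ : Fin l.length → Fin (l.length + 1))).filter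
        (fun i : Fin (x :: l).length => (x :: l)[i] = 0)).map (onesAfter (x :: l))) =
        zeroDegs l := by
      rw [← ih, Multiset.filter_map, Multiset.map_map]
      exact Multiset.map_congr rfl fun i _ => h1 i
    rw [hu]
    obtain rfl | rfl : x = 0 ∨ x = 1 := by omega
    · rw [Multiset.filter_cons_of_pos _ (by rfl), Multiset.map_cons, hm, h0]
      rfl
    · rw [Multiset.filter_cons_of_neg _ (by simp), hm]
      rfl

/-! ### Degrees of non-neighbours -/

open Classical in
/-- The multiset of the degrees of the vertices that are not adjacent to `v`. -/
noncomputable def nonNbrDegs {V : Type*} [Fintype V] (H : SimpleGraph V) (v : V) : Multiset ℕ :=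
  (Finset.univ.filter fun u => u ≠ v ∧ ¬ H.Adj v u).val.map (vdeg H)

theorem nonNbrDegs_iso {V W : Type*} [Fintype V] [Fintype W] {H : SimpleGraph V}
    {K : SimpleGraph W} (f : H ≃g K) (v : V) : nonNbrDegs K (f v) = nonNbrDegs H v := by
  classical
  have h : (Finset.univ.filter fun u => u ≠ f v ∧ ¬ K.Adj (f v) u) =
      (Finset.univ.filter fun u => u ≠ v ∧ ¬ H.Adj v u).map f.toEquiv.toEmbedding := by
    ext u
    obtain ⟨u, rfl⟩ := f.surjective u
    have h1 : K.Adj (f v) (f u) ↔ H.Adj v u := f.map_adj_iff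
    simp only [Finset.mem_filter, Finset.mem_univ, true_and, h1, f.injective.ne_iff,
      Finset.mem_map_equiv]
    have : f.toEquiv.symm (f u) = u := f.toEquiv.symm_apply_apply u
    rw [this]
  rw [nonNbrDegs, nonNbrDegs]
  rw [show (Finset.univ.filter fun u => u ≠ f v ∧ ¬ K.Adj (f v) u) = _ from h, Finset.map_val,
    Multiset.map_map]
  exact Multiset.map_congr rfl fun u _ => vdeg_iso f u

/-- A letter `0` is joined to the other `0`s and to the `1`s after it, but not to `c`; the added one
counts the vertex itself among the `0`s and avoids a subtraction. -/
theorem vdeg_repG5_of_zero {l : List (Fin 2)} {i : Fin l.length} (hi : l[i] = 0) :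
    vdeg (repG5 l) (.inl i) + 1 = onesAfter l i + l.count 0 := by
  classical
  rw [vdeg, Fintype.sum_sum_type, onesAfter, ← sum_ite_getElem_eq]
  have h1 : (∑ u : Unit, if (repG5 l).Adj (.inl i) (.inr u) then 1 else 0) = 0 := by
    simp [repG5_inl_inr, hi]
  have h2 : (∑ j : Fin l.length, if j = i then 1 else 0) = 1 := by simp
  rw [h1, add_zero]
  refine (congrArg (_ + ·) h2.symm).trans ?_
  rw [← Finset.sum_add_distrib, ← Finset.sum_add_distrib]
  refine Finset.sum_congr rfl fun j _ => ?_
  rw [if_congr repG5_inl_inl rfl rfl]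
  rcases lt_trichotomy i j with h | rfl | h
  · have h' := h.not_gt
    have h'' := h.ne'
    obtain hj | hj : l[j] = 0 ∨ l[j] = 1 := by omega
    all_goals rw [hi, hj]; simp [h, h', h'']
  · rw [hi]; simp
  · have h' := h.not_gt
    have h'' := h.ne
    obtain hj | hj : l[j] = 0 ∨ l[j] = 1 := by omega
    all_goals rw [hi, hj]; simp [h, h', h'']

theorem filter_repG5_c (l : List (Fin 2)) [DecidablePred fun u => u ≠ .inr () ∧
    ¬ (repG5 l).Adj (.inr ()) u] :
    (Finset.univ.filter fun u => u ≠ .inr () ∧ ¬ (repG5 l).Adj (.inr ()) u) =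
      (Finset.univ.filter fun i : Fin l.length => l[i] = 0).map Function.Embedding.inl := by
  ext u
  rcases u with i | u
  · have : ¬ l[i] = 1 ↔ l[i] = 0 := by omega
    simp only [Finset.mem_filter, Finset.mem_univ, true_and, repG5_inr_inl, this]
    simp
  · simp

theorem nonNbrDegs_repG5_c (l : List (Fin 2)) :
    (nonNbrDegs (repG5 l) (.inr ())).map Nat.succ =
      (zeroDegs l).map fun d => d + l.count 0 := by
  classical
  rw [nonNbrDegs, filter_repG5_c, Finset.map_val, ← map_onesAfter, Multiset.map_map,
    Multiset.map_map, Multiset.map_map]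
  refine Multiset.map_congr rfl fun i hi => ?_
  have hi' : l[i] = 0 := by simpa using hi
  exact vdeg_repG5_of_zero hi'

/-- The non-neighbours of `c` are the letters `0`; their number and their degrees give `zeroDegs`,
hence the word. Thus different words can be identified only by isomorphisms that do not match the
two vertices `c`. -/
theorem eq_of_nonNbrDegs_eq {l l' : List (Fin 2)} (hl : l.length = l'.length)
    (h : nonNbrDegs (repG5 l) (.inr ()) = nonNbrDegs (repG5 l') (.inr ())) : l = l' := by
  have h1 := nonNbrDegs_repG5_c l
  rw [h, nonNbrDegs_repG5_c l'] at h1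
  have h2 : l.count 0 = l'.count 0 := by
    simpa [card_zeroDegs] using (congrArg Multiset.card h1).symm
  have h3 := count_zero_add_count_one l
  have h4 := count_zero_add_count_one l'
  rw [h2] at h1
  exact zeroDegs_injective (by omega)
    (Multiset.map_injective (add_left_injective (l'.count 0)) h1).symm


/-! ### Isomorphisms between restrictions of `G5` that contain `c` -/

/-- Two adjacent vertices `c`, `p` are exchanged by an automorphism that also exchanges a
neighbour `d` of `c` with a neighbour `x` of `p`, if `c`, `p` have no other neighbours and
`x`, `d` are twins with respect to the other vertices. -/
theorem exists_iso_swap {V : Type*} {H : SimpleGraph V} {c p x d : V} (hcx : c ≠ x) (hcd : c ≠ d)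
    (hpx : p ≠ x) (hpd : p ≠ d) (h1 : H.Adj c p) (h2 : H.Adj c d) (h3 : H.Adj p x)
    (h4 : ¬ H.Adj c x) (h5 : ¬ H.Adj p d)
    (h6 : ∀ j, j ≠ c → j ≠ p → j ≠ x → j ≠ d →
      ¬ H.Adj c j ∧ ¬ H.Adj p j ∧ (H.Adj x j ↔ H.Adj d j)) :
    ∃ σ : H ≃g H, σ c = p := by
  classical
  have hcp := h1.ne
  let f : V → V := fun u => if u = c then p else if u = p then c else if u = x then d else
    if u = d then x else u
  have hf : Function.Involutive f := by
    intro u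
    simp only [f]
    grind
  have hadj : ∀ u v, H.Adj u v → H.Adj (f u) (f v) := by
    intro u v huv
    have hs : ∀ a b, H.Adj a b ↔ H.Adj b a := fun a b => H.adj_comm a b
    have hl : ∀ a, ¬ H.Adj a a := fun a => H.irrefl
    simp only [f]
    by_cases hu1 : u = c
    · subst hu1; grind
    by_cases hu2 : u = p
    · subst hu2; grind
    by_cases hu3 : u = x
    · subst hu3; grind
    by_cases hu4 : u = d
    · subst hu4; grind
    grind
  exact ⟨⟨hf.toPerm, fun {u v} => ⟨fun h => by
    have := hadj _ _ h
    rwa [show f (hf.toPerm f u) = u from hf u, show f (hf.toPerm f v) = v from hf v] at this,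
    hadj u v⟩⟩, by
    simp [f]⟩

/-- The neighbours of `c` are independent and its non-neighbours form a clique. The hypotheses `hN`
and `hC` say that `p` has the same property, so `p` might play the role of `c` in another word. -/
theorem nonNbrDegs_repG5_inl {l : List (Fin 2)} {p : Fin l.length} (hp : l[p] = 1)
    (hN : ∀ u v, (repG5 l).Adj (.inl p) u → (repG5 l).Adj (.inl p) v → ¬ (repG5 l).Adj u v)
    (hC : ∀ u v, u ≠ .inl p → v ≠ .inl p → u ≠ v → ¬ (repG5 l).Adj (.inl p) u →
      ¬ (repG5 l).Adj (.inl p) v → (repG5 l).Adj u v) :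
    nonNbrDegs (repG5 l) (.inl p) = nonNbrDegs (repG5 l) (.inr ()) ∨
      (∀ i : Fin l.length, l[i] = 1 ↔ (i : ℕ) = 1) ∨
      (∀ i : Fin l.length, l[i] = 1 ↔ (i : ℕ) = 0 ∨ (i : ℕ) + 1 = l.length) := by
  have hadj : ∀ i, (repG5 l).Adj (.inl p) (.inl i) ↔ i < p ∧ l[i] = 0 := by
    intro i
    rw [repG5_inl_inl, hp]
    simp
  have hA : ∀ i j, i < p → j < p → l[i] = 0 → l[j] = 0 → i = j := by
    intro i j hi hj hi0 hj0
    by_contra hij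
    refine hN (.inl i) (.inl j) ((hadj _).2 ⟨hi, hi0⟩) ((hadj _).2 ⟨hj, hj0⟩) ?_
    rw [repG5_inl_inl]
    rcases lt_or_gt_of_ne hij with h | h
    · exact .inl ⟨h, hi0⟩
    · exact .inr ⟨h, hj0⟩
  have hB : ∀ i j, i ≠ p → j ≠ p → l[i] = 1 → l[j] = 1 → i = j := by
    intro i j hi hj hi0 hj0
    by_contra hij
    have := hC (.inl i) (.inl j) (by simpa using hi) (by simpa using hj) (by simpa using hij)
      (by rw [hadj, hi0]; simp) (by rw [hadj, hj0]; simp)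
    rw [repG5_inl_inl, hi0, hj0] at this
    simp at this
  have hD : ∀ d j, d ≠ p → l[d] = 1 → p < j → l[j] = 0 → j < d := by
    intro d j hd hd1 hj hj0
    have hjd : j ≠ d := by rintro rfl; simp [hd1] at hj0
    have := hC (.inl d) (.inl j) (by simpa using hd) (by simpa using hj.ne') (by simpa using hjd.symm)
      (by rw [hadj, hd1]; simp) (by rw [hadj]; simp [hj.le])
    rw [repG5_inl_inl, hd1, hj0] at this
    simpa using this
  -- By `hA` and `hB` there is at most one `0` before `p` and at most one other `1`. If both exist,
  -- an automorphism exchanges `c` and `p`. If neither exists, `c` and `p` are each other's only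
  -- neighbour. If exactly one exists, the word is special.
  by_cases hα : ∃ x, x < p ∧ l[x] = 0 <;> by_cases hβ : ∃ d, d ≠ p ∧ l[d] = 1
  · left
    obtain ⟨x, hxp, hx⟩ := hα
    obtain ⟨d, hdp, hd⟩ := hβ
    obtain ⟨σ, hσ⟩ := exists_iso_swap (H := repG5 l) (c := .inr ()) (p := .inl p) (x := .inl x)
      (d := .inl d) (by simp) (by simp) (by simpa using hxp.ne') (by simpa using hdp.symm)
      (by rwa [repG5_inr_inl]) (by rwa [repG5_inr_inl]) (by rw [hadj]; exact ⟨hxp, hx⟩)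
      (by rw [repG5_inr_inl, hx]; simp) (by rw [hadj, hd]; simp) (by
        rintro (j | j) hj1 hj2 hj3 hj4
        · simp only [ne_eq, Sum.inl.injEq] at hj2 hj3 hj4
          have hj : l[j] = 0 := by
            have : ¬ l[j] = 1 := fun h => hj4 (hB _ _ hj2 hdp h hd)
            omega
          have hpj : p < j := by
            rcases lt_trichotomy j p with h | h | h
            · exact (hj3 (hA _ _ h hxp hj hx)).elim
            · exact (hj2 h).elim
            · exact h
          refine ⟨by rw [repG5_inr_inl, hj]; simp, by rw [hadj]; simp [hpj.le], ?_⟩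
          rw [repG5_inl_inl, repG5_inl_inl, hx, hj, hd]
          simp [hD d j hdp hd hpj hj, hxp.trans hpj]
        · exact (hj1 rfl).elim)
    rw [← hσ, nonNbrDegs_iso]
  · right; left
    push Not at hβ
    obtain ⟨x, hxp, hx⟩ := hα
    have h1 : ∀ i, l[i] = 1 ↔ i = p := fun i => ⟨fun h => by_contra fun h' => hβ i h' h, fun h => h ▸ hp⟩
    have h0 : ∀ i, i < p → i = x := by
      intro i hi
      have : ¬ l[i] = 1 := hβ i hi.ne
      exact hA _ _ hi hxp (by omega) hx
    have hp1 : (p : ℕ) = 1 := by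
      have h2 := h0 ⟨0, by omega⟩ (by rw [Fin.lt_def] at *; simp; omega)
      by_contra hcon
      have h3 := h0 ⟨1, by omega⟩ (by rw [Fin.lt_def] at *; simp; omega)
      simpa using h2.trans h3.symm
    intro i
    rw [h1, Fin.ext_iff, hp1]
  · right; right
    push Not at hα
    obtain ⟨d, hdp, hd⟩ := hβ
    have h1 : ∀ i, l[i] = 1 ↔ i = p ∨ i = d := fun i => by
      refine ⟨fun h => ?_, ?_⟩
      · by_contra! hcon
        exact hcon.2 (hB _ _ hcon.1 hdp h hd)
      · rintro (rfl | rfl) <;> assumption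
    have h2 : ∀ i, i < p → i = d := fun i hi => by
      have := hα i hi
      exact hB _ _ hi.ne hdp (by omega) hd
    have h3 : ∀ i, p < i → i ≤ d := fun i hi => by
      by_cases h : l[i] = 1
      · exact (hB _ _ hi.ne' hdp h hd).le
      · exact (hD d i hdp hd hi (by omega)).le
    have hdp' := Fin.val_ne_of_ne hdp
    -- By `h2` only `d` can precede `p`, and by `h3` nothing that follows `p` lies beyond `d`, so
    -- `p` and `d` occupy the two ends.
    have hlast : (d : ℕ) + 1 = l.length ∧ (p : ℕ) = 0 ∨ (p : ℕ) + 1 = l.length ∧ (d : ℕ) = 0 := by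
      rcases lt_or_gt_of_ne hdp with h | h
      · right
        have h4 := fun h => h3 ⟨p + 1, h⟩ (by simp [Fin.lt_def])
        have h5 := h2 ⟨0, by omega⟩ (by rw [Fin.lt_def] at *; simp; omega)
        rw [Fin.lt_def] at h
        simp only [Fin.le_def] at h4
        simp only [Fin.ext_iff] at h5
        omega
      · left
        rw [Fin.lt_def] at h
        have h4 : 0 < (p : ℕ) → _ := fun h => h2 ⟨0, by omega⟩ h
        have h5 := h3 ⟨l.length - 1, by omega⟩ (by rw [Fin.lt_def] at *; simp; omega)
        simp only [Fin.le_def, Fin.lt_def, Fin.ext_iff] at h4 h5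
        omega
    intro i
    rw [h1, Fin.ext_iff, Fin.ext_iff]
    omega
  · left
    push Not at hα hβ
    rw [nonNbrDegs, nonNbrDegs]
    congr 2
    ext u
    rcases u with i | u
    · simp only [Finset.mem_filter, Finset.mem_univ, true_and, hadj, repG5_inr_inl]
      have h1 := hα i
      have h2 := hβ i
      have : l[i] = 1 ↔ i = p := ⟨fun h => by_contra fun h' => h2 h' h, fun h => h ▸ hp⟩
      simp [this]
      tauto
    · have : (repG5 l).Adj (.inr ()) (.inl p) := by rwa [repG5_inr_inl]
      simp [this.symm]

/-- The words that are constant up to the letter `z`, in position `1`, or up to the letters `z` at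
the two ends. -/
def IsSpecialWord (z : Fin 2) (l : List (Fin 2)) : Prop :=
  (∀ i : Fin l.length, l[i] = z ↔ (i : ℕ) = 1) ∨
    (∀ i : Fin l.length, l[i] = z ↔ (i : ℕ) = 0 ∨ (i : ℕ) + 1 = l.length)

/-- The preimage of `c` inherits the independent neighbourhood and the complete non-neighbourhood.
If it also has the non-neighbour degrees of the original `c`, these degrees determine both words. -/
theorem eq_or_isSpecialWord_of_one {l l' : List (Fin 2)} (hl : l.length = l'.length)
    (e : repG5 l ≃g repG5 l') {p : Fin l.length} (hp : l[p] = 1) (he : e (.inl p) = .inr ()) :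
    l = l' ∨ IsSpecialWord 1 l := by
  suffices h : (∀ u v, (repG5 l).Adj (.inl p) u → (repG5 l).Adj (.inl p) v → ¬ (repG5 l).Adj u v) ∧
      (∀ u v, u ≠ .inl p → v ≠ .inl p → u ≠ v → ¬ (repG5 l).Adj (.inl p) u →
        ¬ (repG5 l).Adj (.inl p) v → (repG5 l).Adj u v) by
    refine (nonNbrDegs_repG5_inl hp h.1 h.2).imp (fun h => ?_) id
    rw [← nonNbrDegs_iso e, he] at h
    exact (eq_of_nonNbrDegs_eq hl.symm h).symm
  constructor
  · have hadj : ∀ u, (repG5 l).Adj (.inl p) u → ∃ i : Fin l'.length, e u = .inl i ∧ l'[i] = 1 := by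
      intro u hu
      rw [← e.map_adj_iff, he] at hu
      rcases h : e u with i | i
      · rw [h, repG5_inr_inl] at hu
        exact ⟨i, rfl, hu⟩
      · rw [h] at hu; simp at hu
    intro u v hu hv
    obtain ⟨i, hi, hi1⟩ := hadj u hu
    obtain ⟨j, hj, hj1⟩ := hadj v hv
    rw [← e.map_adj_iff, hi, hj, repG5_inl_inl, hi1, hj1]
    simp
  · have hadj : ∀ u, u ≠ .inl p → ¬ (repG5 l).Adj (.inl p) u →
        ∃ i : Fin l'.length, e u = .inl i ∧ l'[i] = 0 := by
      intro u hup hu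
      rw [← e.map_adj_iff, he] at hu
      rcases h : e u with i | i
      · rw [h, repG5_inr_inl] at hu
        exact ⟨i, rfl, by omega⟩
      · exact (hup (e.injective (by rw [he, h]))).elim
    intro u v hup hvp huv hu hv
    obtain ⟨i, hi, hi1⟩ := hadj u hup hu
    obtain ⟨j, hj, hj1⟩ := hadj v hvp hv
    have hij : i ≠ j := by rintro rfl; exact huv (e.injective (by rw [hi, hj]))
    rw [← e.map_adj_iff, hi, hj, repG5_inl_inl, hi1, hj1]
    rcases lt_or_gt_of_ne hij with h | h <;> simp [h]

/-- The earlier letter decides an adjacency between letters, and the adjacency to `c` depends on one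
letter, so complementation amounts to exchanging `0` and `1`. This reduces a preimage of `c` with
letter `0` to one with letter `1`. -/
theorem exists_iso_repG5_map_rev (l : List (Fin 2)) :
    ∃ f : repG5 (l.map Fin.rev) ≃g (repG5 l)ᶜ, ∀ u, f u = Sum.map (finCongr (by simp)) id u := by
  have hlen : (l.map Fin.rev).length = l.length := by simp
  have hrev : ∀ i : Fin l.length, (l.map Fin.rev)[finCongr hlen.symm i] = l[i].rev := by
    intro i; simp
  refine ⟨⟨(finCongr hlen).sumCongr (.refl _), ?_⟩, fun u => rfl⟩
  have key : ∀ u v, (repG5 (l.map Fin.rev)).Adj (Sum.map (finCongr hlen.symm) id u)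
      (Sum.map (finCongr hlen.symm) id v) ↔ (repG5 l)ᶜ.Adj u v := by
    have h01 : ∀ z : Fin 2, z.rev = 0 ↔ ¬ z = 0 := by decide
    have h11 : ∀ z : Fin 2, z.rev = 1 ↔ ¬ z = 1 := by decide
    rintro (i | i) (j | j)
    · simp only [Sum.map_inl, SimpleGraph.compl_adj, repG5_inl_inl, hrev, h01]
      rcases lt_trichotomy i j with h | rfl | h
      · have := h.ne
        simp [h, h.not_gt, this]
      · simp
      · have := h.ne'
        simp [h, h.not_gt, this]
    · simp only [Sum.map_inl, Sum.map_inr, id, SimpleGraph.compl_adj, repG5_inl_inr, hrev, h11]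
      simp
    · simp only [Sum.map_inl, Sum.map_inr, id, SimpleGraph.compl_adj, repG5_inr_inl, hrev, h11]
      simp
    · simp
  intro u v
  rw [← key]
  rcases u with u | u <;> rcases v with v | v <;> rfl

theorem isSpecialWord_map_rev {z : Fin 2} {l : List (Fin 2)}
    (h : IsSpecialWord z (l.map Fin.rev)) : IsSpecialWord z.rev l := by
  have hlen : (l.map Fin.rev).length = l.length := by simp
  have h1 : ∀ i : Fin l.length, (l.map Fin.rev)[finCongr hlen.symm i] = z ↔ l[i] = z.rev := by
    intro i
    have : ∀ z y : Fin 2, y.rev = z ↔ y = z.rev := by decide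
    simp [this]
  rcases h with h | h
  · left
    intro i
    rw [← h1, h]
    simp
  · right
    intro i
    rw [← h1, h]
    simp

/-- If the vertices `c` do not correspond, the preimage `p` of the second and the image `q` of the
first carry the same letter, since an isomorphism preserves the adjacency between `c` and `p`. Both
words are therefore special for the same `z`. -/
theorem eq_or_isSpecialWord {l l' : List (Fin 2)} (hl : l.length = l'.length)
    (e : repG5 l ≃g repG5 l') :
    l = l' ∨ ∃ z, IsSpecialWord z l ∧ IsSpecialWord z l' := by
  have hrev : Function.Injective (List.map (Fin.rev : Fin 2 → Fin 2)) :=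
    List.map_injective_iff.2 Fin.rev_injective
  by_cases hl' : l = l'
  · exact .inl hl'
  rcases hv : e.symm (.inr ()) with p | p
  · rcases hw : e (.inr ()) with q | q
    · have hp : e (.inl p) = .inr () := by rw [← hv]; simp
      have hq : e.symm (.inl q) = .inr () := by rw [← hw]; simp
      have hpq : l[p] = 1 ↔ l'[q] = 1 := by
        rw [← repG5_inl_inr (z := ()), ← e.map_adj_iff, hp, hw, repG5_inr_inl]
      by_cases h1 : l[p] = 1
      · exact .inr ⟨1, (eq_or_isSpecialWord_of_one hl e h1 hp).resolve_left hl',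
          (eq_or_isSpecialWord_of_one hl.symm e.symm (hpq.1 h1) hq).resolve_left (Ne.symm hl')⟩
      · have h1' : l'[q] = 0 := by have := hpq.not.1 h1; omega
        replace h1 : l[p] = 0 := by omega
        obtain ⟨f, hf⟩ := exists_iso_repG5_map_rev l
        obtain ⟨f', hf'⟩ := exists_iso_repG5_map_rev l'
        have hlr : (l.map Fin.rev).length = (l'.map Fin.rev).length := by simpa
        have hlr' : l.map Fin.rev ≠ l'.map Fin.rev := hrev.ne hl'
        have hfs : ∀ i, f.symm (.inl i) = .inl (finCongr (by simp) i) := fun i => by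
          rw [RelIso.symm_apply_eq, hf]; rfl
        have hfs' : ∀ i, f'.symm (.inl i) = .inl (finCongr (by simp) i) := fun i => by
          rw [RelIso.symm_apply_eq, hf']; rfl
        have hfc : f (.inr ()) = .inr () := by rw [hf]; rfl
        have hfc' : f' (.inr ()) = .inr () := by rw [hf']; rfl
        obtain ⟨ec, hec⟩ : ∃ ec : (repG5 l)ᶜ ≃g (repG5 l')ᶜ, ∀ u, ec u = e u := by
          refine ⟨⟨e.toEquiv, fun {u v} => ?_⟩, fun u => rfl⟩
          simp only [SimpleGraph.compl_adj]
          exact and_congr e.injective.ne_iff (not_congr e.map_adj_iff)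
        let e' : repG5 (l.map Fin.rev) ≃g repG5 (l'.map Fin.rev) :=
          (f.trans ec).trans f'.symm
        have hp' : (l.map Fin.rev)[finCongr (by simp : l.length = (l.map Fin.rev).length) p] = 1 := by
          simp [show l[(p : ℕ)] = 0 from h1]
        have hq' : (l'.map Fin.rev)[finCongr (by simp : l'.length = (l'.map Fin.rev).length) q] = 1 := by
          simp [show l'[(q : ℕ)] = 0 from h1']
        have he1 : e' (.inl (finCongr (by simp) p)) = .inr () := by
          rw [← hfs]
          simp only [e', RelIso.trans_apply, RelIso.apply_symm_apply]
          rw [hec, hp, ← hfc', RelIso.symm_apply_apply]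
        have he2 : e'.symm (.inl (finCongr (by simp) q)) = .inr () := by
          rw [← hfs', RelIso.symm_apply_eq]
          simp only [e', RelIso.trans_apply]
          rw [hfc, hec, hw]
        exact .inr ⟨0, isSpecialWord_map_rev
            ((eq_or_isSpecialWord_of_one hlr e' hp' he1).resolve_left hlr'),
          isSpecialWord_map_rev
            ((eq_or_isSpecialWord_of_one hlr.symm e'.symm hq' he2).resolve_left hlr'.symm)⟩
    · refine .inl (eq_of_nonNbrDegs_eq hl ?_)
      rw [← nonNbrDegs_iso e, hw]
  · refine .inl (eq_of_nonNbrDegs_eq hl ?_)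
    have hw : e (.inr ()) = .inr () := by
      rw [← e.apply_symm_apply (.inr ()), hv]
    rw [← nonNbrDegs_iso e, hw]

theorem nonempty_iso_repG5_of_special {l l' : List (Fin 2)} (hl : l.length = l'.length)
    (h2l : 2 ≤ l.length) {z : Fin 2} (h : ∀ i : Fin l.length, l[i] = z ↔ (i : ℕ) = 1)
    (h' : ∀ i : Fin l'.length, l'[i] = z ↔ (i : ℕ) = 0 ∨ (i : ℕ) + 1 = l'.length) :
    Nonempty (repG5 l ≃g repG5 l') := by
  -- Position `1` takes the role of `c`, `c` becomes the first letter, the first letter becomes the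
  -- last, and every other letter moves one place to the left.
  let f : Fin l.length ⊕ Unit → Fin l'.length ⊕ Unit := fun u => match u with
    | .inl i => if (i : ℕ) = 0 then .inl ⟨l'.length - 1, by omega⟩ else
        if (i : ℕ) = 1 then .inr () else .inl ⟨i - 1, by omega⟩
    | .inr _ => .inl ⟨0, by omega⟩
  have hf : Function.Injective f := by
    rintro (i | i) (j | j) hij
    · simp only [f] at hij
      congr 1
      split_ifs at hij <;> simp at hij <;> try omega
    · simp only [f] at hij
      split_ifs at hij <;> simp at hij <;> try omega
    · simp only [f] at hij
      split_ifs at hij <;> simp at hij <;> try omega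
    · rfl
  have hbij : Function.Bijective f := by
    rw [Fintype.bijective_iff_injective_and_card]
    exact ⟨hf, by simp [hl]⟩
  have key : ∀ u v, (repG5 l').Adj (f u) (f v) ↔ (repG5 l).Adj u v := by
    have hz0 : ∀ x : Fin 2, x = 0 ↔ ¬ x = 1 := by decide
    have hz1 : ∀ x : Fin 2, x = 1 ↔ ¬ x = 0 := by decide
    have h1 : ∀ i j : Fin l.length, (repG5 l').Adj (f (.inl i)) (f (.inl j)) ↔
        (repG5 l).Adj (.inl i) (.inl j) := by
      intro i j
      rw [repG5_inl_inl]
      simp only [f]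
      obtain rfl | rfl : z = 0 ∨ z = 1 := by omega
      · split_ifs <;> simp only [repG5_inl_inl, repG5_inl_inr, repG5_inr_inl, SimpleGraph.irrefl,
          h, h', hz1, Fin.lt_def, true_or, false_iff, true_iff, and_true, not_true_eq_false] <;> omega
      · split_ifs <;> simp only [repG5_inl_inl, repG5_inl_inr, repG5_inr_inl, SimpleGraph.irrefl,
          h, h', hz0, Fin.lt_def, true_or, false_iff, true_iff, and_true, not_true_eq_false,
          and_false, or_false] <;> omega
    have h2 : ∀ (i : Fin l.length) (u : Unit), (repG5 l').Adj (f (.inl i)) (f (.inr u)) ↔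
        (repG5 l).Adj (.inl i) (.inr u) := by
      intro i u
      rw [repG5_inl_inr]
      simp only [f]
      obtain rfl | rfl : z = 0 ∨ z = 1 := by omega
      · split_ifs <;> simp only [repG5_inl_inl, repG5_inl_inr, repG5_inr_inl, SimpleGraph.irrefl,
          h, h', hz1, Fin.lt_def, true_or, false_iff, true_iff, and_true, not_true_eq_false] <;> omega
      · split_ifs <;> simp only [repG5_inl_inl, repG5_inl_inr, repG5_inr_inl, SimpleGraph.irrefl,
          h, h', hz0, Fin.lt_def, true_or, false_iff, true_iff, and_true, not_true_eq_false,
          and_false, or_false] <;> omega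
    rintro (i | u) (j | u')
    · exact h1 i j
    · exact h2 i u'
    · rw [SimpleGraph.adj_comm, h2, SimpleGraph.adj_comm]
    · simp
  exact ⟨⟨Equiv.ofBijective f hbij, key _ _⟩⟩


/-! ### Redundant words, and the profile of `G5` -/

theorem list_eq_of_iff {l l' : List (Fin 2)} (z : Fin 2) (P : ℕ → Prop)
    (hl : l.length = l'.length) (h : ∀ i : Fin l.length, l[i] = z ↔ P i)
    (h' : ∀ i : Fin l'.length, l'[i] = z ↔ P i) : l = l' := by
  refine List.ext_getElem hl fun i h1 h2 => ?_
  have h3 : l[i] = z ↔ P i := h ⟨i, h1⟩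
  have h4 : l'[i] = z ↔ P i := h' ⟨i, h2⟩
  have h5 := h3.trans h4.symm
  omega

theorem rev_ne_self : ∀ z : Fin 2, z.rev ≠ z := by decide

/-- The words of length `j + 2` that are constant up to the last letter. -/
def nearConstWords (j : ℕ) : Finset (List (Fin 2)) :=
  (Finset.univ : Finset (Fin 2 × Fin 2)).image fun q => List.replicate (j + 1) q.1 ++ [q.2]

/-- The word with letters `z` exactly at the two ends. -/
def endsWord (j : ℕ) (z : Fin 2) : List (Fin 2) := z :: (List.replicate j z.rev ++ [z])

/-- The words that are not used for the restrictions of `G5` that contain `c`. -/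
def redundantWords (j : ℕ) : Finset (List (Fin 2)) :=
  nearConstWords j ∪ (Finset.univ.filter fun z : Fin 2 => 2 ≤ j + z).image (endsWord j)

theorem mem_nearConstWords {j : ℕ} {l : List (Fin 2)} :
    l ∈ nearConstWords j ↔ ∃ z x, l = List.replicate (j + 1) z ++ [x] := by
  simp [nearConstWords, eq_comm]

theorem mem_redundantWords {j : ℕ} {l : List (Fin 2)} : l ∈ redundantWords j ↔
    l ∈ nearConstWords j ∨ ∃ z : Fin 2, 2 ≤ j + z ∧ l = endsWord j z := by
  simp [redundantWords, eq_comm]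

theorem length_endsWord (j : ℕ) (z : Fin 2) : (endsWord j z).length = j + 2 := by simp [endsWord]

theorem endsWord_getElem (j : ℕ) (z : Fin 2) (i : Fin (endsWord j z).length) :
    (endsWord j z)[i] = z ↔ (i : ℕ) = 0 ∨ (i : ℕ) + 1 = j + 2 := by
  obtain ⟨i, hi⟩ := i
  rw [length_endsWord] at hi
  have hz : z.rev ≠ z := rev_ne_self z
  rcases i with _ | i
  · simp [endsWord]
  · by_cases h : i < j
    · simp only [endsWord, Fin.getElem_fin, List.getElem_cons_succ, List.getElem_append,
        List.length_replicate, h, dite_true, List.getElem_replicate]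
      simp [hz]; omega
    · have : i = j := by omega
      subst this
      simp [endsWord]

theorem endsWord_one_one :
    ∀ i : Fin (endsWord 1 1).length, (endsWord 1 1)[i] = 0 ↔ (i : ℕ) = 1 := by decide

theorem not_nearConst {j : ℕ} {l : List (Fin 2)} (hl : l.length = j + 2) (hj : 1 ≤ j)
    (h : l[0] ≠ l[1]) : l ∉ nearConstWords j := by
  rw [mem_nearConstWords]
  rintro ⟨z, x, rfl⟩
  simp [List.getElem_append, show 0 < j by omega] at h

theorem endsWord_notMem_nearConstWords {j : ℕ} {z : Fin 2} (hj : 1 ≤ j) :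
    endsWord j z ∉ nearConstWords j := by
  refine not_nearConst (length_endsWord j z) hj fun h => ?_
  have h0 := (endsWord_getElem j z ⟨0, by simp [length_endsWord]⟩).2 (.inl rfl)
  have h1 := (endsWord_getElem j z ⟨1, by simp [length_endsWord]⟩).1 (h.symm.trans h0)
  simp at h1
  omega

/-- The condition `2 ≤ j + z` matters in short lengths. In length two all words are constant up to
the last letter. In length three the end words `1 0 1` and `0 1 0` have isomorphic graphs and each
is the position-one word for the other letter, so only the first is discarded. -/
theorem card_redundantWords (j : ℕ) : (redundantWords j).card = 4 + min j 2 := by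
  rw [redundantWords, Finset.card_union_of_disjoint, nearConstWords,
    Finset.card_image_of_injective, Finset.card_image_of_injective]
  · congr 1
    obtain rfl | rfl | h : j = 0 ∨ j = 1 ∨ 2 ≤ j := by omega
    · decide
    · decide
    · rw [Finset.filter_true_of_mem (fun z _ => by omega)]
      simp [h]
  · intro z z' h
    exact (List.cons.inj h).1
  · rintro ⟨z, x⟩ ⟨z', x'⟩ h
    obtain ⟨h1, h2⟩ := List.append_inj' h rfl
    rw [List.replicate_succ, List.replicate_succ] at h1
    exact Prod.ext (List.cons.inj h1).1 (List.cons.inj h2).1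
  · rw [Finset.disjoint_right]
    intro l hl
    obtain ⟨z, hz, rfl⟩ := Finset.mem_image.1 hl
    have : 2 ≤ j + z := by simpa using hz
    exact endsWord_notMem_nearConstWords (by omega)

theorem redundantWords_subset (j : ℕ) : redundantWords j ⊆ words (j + 2) := by
  intro l hl
  rw [mem_words]
  rcases mem_redundantWords.1 hl with h | ⟨z, -, rfl⟩
  · obtain ⟨z, x, rfl⟩ := mem_nearConstWords.1 h
    simp
  · exact length_endsWord j z

/-- The vertex sets of the standard restrictions of `G5` with `j + 3` vertices. -/
abbrev VertG5 (j : ℕ) : (words (j + 2)) ⊕ ↥(words (j + 2) \ redundantWords j) → Type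
  | .inl t => Fin (t.1 ++ [1]).length
  | .inr l => Fin l.1.length ⊕ Unit

instance (j : ℕ) (i) : Finite (VertG5 j i) := by
  rcases i with i | i
  · exact inferInstanceAs (Finite (Fin _))
  · exact inferInstanceAs (Finite (Fin _ ⊕ Unit))

/-- The standard restrictions of `G5` with `j + 3` vertices. -/
def graphG5 (j : ℕ) : ∀ i, SimpleGraph (VertG5 j i)
  | .inl t => thrGraph (t.1 ++ [1])
  | .inr l => repG5 l.1

theorem exists_iso_repG5_endsWord {j : ℕ} {z : Fin 2} (hz : 2 ≤ j + z) :
    ∃ l, l.length = j + 2 ∧ l ∉ redundantWords j ∧ Nonempty (repG5 (endsWord j z) ≃g repG5 l) := by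
  have hzr : z.rev ≠ z := rev_ne_self z
  -- The representative that is kept has its only letter `z` in position `1`.
  let l : List (Fin 2) := z.rev :: z :: List.replicate j z.rev
  have hl : l.length = j + 2 := by simp [l]
  have hget : ∀ i : Fin l.length, l[i] = z ↔ (i : ℕ) = 1 := by
    rintro ⟨i, hi⟩
    rcases i with _ | _ | i
    · simp [l, hzr]
    · simp [l]
    · simp [l, hzr]
  refine ⟨l, hl, ?_, ?_⟩
  · rw [mem_redundantWords]
    rintro (h | ⟨y, hy, h⟩)
    · refine not_nearConst hl (by omega) ?_ h
      simpa [l] using hzr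
    · have h1 : z.rev = y := (List.cons.inj h).1
      subst h1
      have h2 : (z : ℕ) + z.rev = 1 := by rw [Fin.val_rev]; omega
      have h3 := (hget ⟨2, by omega⟩).not.2 (by simp)
      have h4 := (endsWord_getElem j z.rev ⟨2, by simp [length_endsWord]; omega⟩).not.2
        (by simp; omega)
      simp only [← h] at h4
      simp only [Fin.getElem_fin] at h3 h4
      omega
  · refine (nonempty_iso_repG5_of_special (by rw [hl, length_endsWord]) (by omega) hget ?_).map
      fun e => e.symm
    intro i
    rw [endsWord_getElem, ← length_endsWord j z]

/-- For each `z` at most one special word survives: the position-one word, except in length three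
with `z = 0`, where that word is the discarded `1 0 1` and the end word `0 1 0` remains. -/
theorem eq_of_isSpecialWord {j : ℕ} {l l' : List (Fin 2)} (hl : l.length = j + 2)
    (hl' : l'.length = j + 2) (h : l ∉ redundantWords j) (h' : l' ∉ redundantWords j) {z : Fin 2}
    (hs : IsSpecialWord z l) (hs' : IsSpecialWord z l') : l = l' := by
  have key : ∀ l : List (Fin 2), l.length = j + 2 → l ∉ redundantWords j → IsSpecialWord z l →
      if j = 1 ∧ z = 0 then l = endsWord j z else ∀ i : Fin l.length, l[i] = z ↔ (i : ℕ) = 1 := by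
    intro l hl h hs
    have hE : (∀ i : Fin l.length, l[i] = z ↔ (i : ℕ) = 0 ∨ (i : ℕ) + 1 = l.length) →
        l = endsWord j z := fun hs => by
      refine list_eq_of_iff z (fun i => i = 0 ∨ i + 1 = j + 2) (by rw [hl, length_endsWord]) ?_ ?_
      · simpa only [hl] using hs
      · exact endsWord_getElem j z
    rw [mem_redundantWords, not_or] at h
    split_ifs with hc
    · obtain ⟨rfl, rfl⟩ := hc
      rcases hs with hs | hs
      · exfalso
        refine h.2 ⟨1, by simp, list_eq_of_iff 0 (fun i => i = 1) (by rw [hl, length_endsWord])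
          hs ?_⟩
        exact endsWord_one_one
      · exact hE hs
    · rcases hs with hs | hs
      · exact hs
      · exfalso
        by_cases hz : 2 ≤ j + z
        · exact h.2 ⟨z, hz, hE hs⟩
        · obtain rfl : j = 0 := by omega
          refine h.1 (mem_nearConstWords.2 ⟨z, z, (hE hs).trans ?_⟩)
          rfl
  have h1 := key l hl h hs
  have h2 := key l' hl' h' hs'
  split_ifs at h1 h2
  · rw [h1, h2]
  · exact list_eq_of_iff z (fun i => i = 1) (by rw [hl, hl']) h1 h2

/-- The first term counts the threshold graphs, the second the restrictions through `c`. From the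
words for the latter, four that give threshold graphs and `min j 2` duplicates are removed. -/
theorem profile_G5 (j : ℕ) : profile (age G5) (j + 3) = 2 ^ (j + 2) + (2 ^ (j + 2) - (4 + min j 2)) := by
  have key := profile_eq_card (G := G5) (n := j + 3) (graphG5 j) ?_ ?_ ?_ ?_
  · rw [key, Fintype.card_sum, Fintype.card_coe, Fintype.card_coe, card_words,
      Finset.card_sdiff_of_subset (redundantWords_subset j), card_words, card_redundantWords]
  · rintro (⟨t, h⟩ | ⟨l, h⟩)
    · change Nat.card (Fin _) = j + 3
      rw [mem_words] at h
      simp [h]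
    · change Nat.card (Fin _ ⊕ Unit) = j + 3
      have := mem_words.1 (Finset.mem_sdiff.1 h).1
      simp [this]
  · rintro (t | l)
    · exact nonempty_embedding_thrGraph (comap_inl_addC _) _
    · exact ⟨SimpleGraph.Embedding.comap
        ⟨_, (isWordPos_wordPos l.1).injective.sumMap Function.injective_id⟩ _⟩
  · intro H f
    have hthr : Nonempty (H ↪g split (· ≤ ·)) → ∃ i, Nonempty (H ≃g graphG5 j i) := by
      rintro ⟨g⟩
      obtain ⟨t, ht, e⟩ := exists_iso_thrGraph_append (n := j + 2) (by simp) g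
      exact ⟨.inl ⟨t, mem_words.2 ht⟩, e⟩
    by_cases hf : ∀ z, Sum.inr z ∈ Set.range f
    · obtain ⟨l, hl, ⟨e⟩⟩ := exists_iso_comap_sumMap_wordPos (comap_inl_addC _)
        (by intro u v x h; simp [h]) f hf
      change H ≃g repG5 l at e
      have hl' : l.length = j + 2 := by simpa using hl
      by_cases hs : l ∈ redundantWords j
      · rcases mem_redundantWords.1 hs with h | ⟨z, hz, rfl⟩
        · obtain ⟨z, x, rfl⟩ := mem_nearConstWords.1 h
          obtain ⟨g⟩ := nonempty_embedding_repG5 (j + 1) z x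
          exact hthr ⟨g.comp e.toRelEmbedding⟩
        · obtain ⟨t, ht, ht', ⟨g⟩⟩ := exists_iso_repG5_endsWord hz
          exact ⟨.inr ⟨t, Finset.mem_sdiff.2 ⟨mem_words.2 ht, ht'⟩⟩, ⟨e.trans g⟩⟩
      · exact ⟨.inr ⟨l, Finset.mem_sdiff.2 ⟨mem_words.2 hl', hs⟩⟩, ⟨e⟩⟩
    · have hf' : ∀ z, Sum.inr z ∉ Set.range f := fun z hz => hf fun z' => hz
      obtain ⟨g⟩ := nonempty_embedding_comap_inl f hf'
      rw [G5, comap_inl_addC] at g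
      exact hthr ⟨g⟩
  · have hmix : ∀ t l, l ∈ words (j + 2) \ redundantWords j →
        ¬ Nonempty (thrGraph (t ++ [1]) ≃g repG5 l) := by
      rintro t l hl e
      obtain ⟨h1, h2⟩ := Finset.mem_sdiff.1 hl
      rw [mem_words] at h1
      refine repG5_not_thr (fun z x h => h2 (mem_redundantWords.2 (.inl
        (mem_nearConstWords.2 ⟨z, x, ?_⟩)))) (by rintro rfl; simp at h1) e
      rwa [h1] at h
    rintro (⟨t, h⟩ | ⟨l, h⟩) (⟨t', h'⟩ | ⟨l', h'⟩) e
    · obtain rfl := thrGraph_append_unique e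
      rfl
    · exact (hmix t l' h' e).elim
    · exact (hmix t' l h ⟨e.some.symm⟩).elim
    · obtain ⟨e⟩ := e
      change repG5 l ≃g repG5 l' at e
      obtain ⟨h1, h2⟩ := Finset.mem_sdiff.1 h
      obtain ⟨h3, h4⟩ := Finset.mem_sdiff.1 h'
      rw [mem_words] at h1 h3
      have : l = l' := by
        rcases eq_or_isSpecialWord (by rw [h1, h3]) e with h | ⟨z, hz, hz'⟩
        · exact h
        · exact eq_of_isSpecialWord h1 h3 h2 h4 hz hz'
      subst this
      rfl


/-! ### Reversal of words and normal forms for the restrictions of `G1` -/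

/-- The word read from right to left with the two letters exchanged. -/
def flipWord (l : List (Fin 2)) : List (Fin 2) := (l.map Fin.rev).reverse

@[simp] theorem length_flipWord (l : List (Fin 2)) : (flipWord l).length = l.length := by
  simp [flipWord]

@[simp] theorem flipWord_flipWord (l : List (Fin 2)) : flipWord (flipWord l) = l := by
  have : (Fin.rev ∘ Fin.rev : Fin 2 → Fin 2) = id := funext fun i => Fin.rev_rev i
  simp [flipWord, List.map_reverse, this]

theorem flipWord_append (l l' : List (Fin 2)) :
    flipWord (l ++ l') = flipWord l' ++ flipWord l := by simp [flipWord]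

/-- The word that consists of `x` letters `1` and of the word `0 u 1`. -/
def coreWord (x : ℕ) (u : List (Fin 2)) : List (Fin 2) :=
  List.replicate x 1 ++ (0 :: (u ++ [1]))

@[simp] theorem length_coreWord (x : ℕ) (u : List (Fin 2)) :
    (coreWord x u).length = x + u.length + 2 := by simp [coreWord]; omega

theorem flipWord_coreWord (x : ℕ) (u : List (Fin 2)) :
    flipWord (coreWord x u) = (0 :: (flipWord u ++ [1])) ++ List.replicate x 0 := by
  rw [coreWord, flipWord_append]
  simp [flipWord]

theorem flipWord_getElem (l : List (Fin 2)) (i : Fin (flipWord l).length) :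
    (flipWord l)[i] = (l[((finCongr (length_flipWord l)) i).rev]).rev := by
  simp only [Fin.getElem_fin]
  simp only [flipWord, List.getElem_reverse, List.getElem_map, List.length_map]
  congr 2
  have : (((finCongr (length_flipWord l)) i).rev : ℕ) = l.length - (i + 1) := Fin.val_rev _
  exact (Nat.sub_right_comm _ _ _).trans this.symm

/-- Reversal turns the order around and the exchange of letters swaps the sides, so edges are
preserved. The letters are tracked because the flip serves to turn a vertex with letter `0` into one
with letter `1`. -/
theorem exists_iso_chainGraph_flipWord (l : List (Fin 2)) :
    ∃ e : chainGraph (flipWord l) ≃g chainGraph l, ∀ i, (flipWord l)[i] = (l[e i]).rev := by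
  let e : Fin (flipWord l).length ≃ Fin l.length := (finCongr (length_flipWord l)).trans Fin.revPerm
  have he : ∀ i, (flipWord l)[i] = (l[e i]).rev := flipWord_getElem l
  have hlt : ∀ i j, e i < e j ↔ j < i := fun i j => by
    simp only [e, Equiv.trans_apply, Fin.revPerm_apply, Fin.rev_lt_rev]
    rfl
  refine ⟨⟨e, fun {i j} => ?_⟩, he⟩
  rw [chainGraph_adj, chainGraph_adj, he, he, hlt, hlt]
  have h0 : ∀ x : Fin 2, x.rev = 0 ↔ x = 1 := by decide
  have h1 : ∀ x : Fin 2, x.rev = 1 ↔ x = 0 := by decide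
  rw [h0, h0, h1, h1]
  tauto

/-- Trailing `0`s and leading `1`s are both isolated vertices, so all isolated vertices at the ends
can be collected at the front. -/
theorem nonempty_iso_chainGraph_rotate (l : List (Fin 2)) (k : ℕ) :
    Nonempty (chainGraph (l ++ List.replicate k 0) ≃g chainGraph (List.replicate k 1 ++ l)) := by
  have hl1 : (l ++ List.replicate k 0).length = l.length + k := by simp
  have hl2 : (List.replicate k 1 ++ l).length = l.length + k := by simp; omega
  refine nonempty_iso_of_injective
    (fun i => if h : (i : ℕ) < l.length then ⟨i + k, by omega⟩ else ⟨i - l.length, by omega⟩) ?_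
    (by simp; omega) ?_
  · intro i j hij
    dsimp only at hij
    split_ifs at hij <;> simp at hij <;> omega
  · intro i j
    rw [chainGraph_adj, chainGraph_adj]
    have hA : ∀ i : Fin (l ++ List.replicate k 0).length,
        (l ++ List.replicate k 0)[i] = if (i : ℕ) < l.length then l.getD i 0 else 0 := by
      intro i
      simp only [Fin.getElem_fin, List.getElem_append]
      split_ifs with h
      · simp [h]
      · simp
    have hB : ∀ i : Fin (List.replicate k 1 ++ l).length,
        (List.replicate k 1 ++ l)[i] = if (i : ℕ) < k then 1 else l.getD (i - k) 0 := by
      intro i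
      have := i.isLt
      simp only [Fin.getElem_fin, List.getElem_append, List.length_replicate]
      split_ifs with h
      · simp
      · simp [show (i : ℕ) - k < l.length by omega]
    have hi := i.isLt
    have hj := j.isLt
    rw [hA, hA, hB, hB]
    simp only [Fin.lt_def]
    grind

theorem exists_word_decomposition (l : List (Fin 2)) : ∃ x y t,
    l = List.replicate x 1 ++ t ++ List.replicate y 0 ∧ (t = [] ∨ ∃ u, t = 0 :: (u ++ [1])) := by
  induction hn : l.length using Nat.strong_induction_on generalizing l with
  | _ n ih =>
    subst hn
    rcases l with _ | ⟨z, l⟩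
    · exact ⟨0, 0, [], rfl, .inl rfl⟩
    · obtain rfl | rfl : z = 0 ∨ z = 1 := by omega
      · rcases List.eq_nil_or_concat' l with rfl | ⟨s, w, rfl⟩
        · exact ⟨0, 1, [], rfl, .inl rfl⟩
        · obtain rfl | rfl : w = 0 ∨ w = 1 := by omega
          · obtain ⟨x, y, t, h, ht⟩ := ih _ (by simp) (0 :: s) rfl
            refine ⟨x, y + 1, t, ?_, ht⟩
            rw [← List.cons_append, h, List.replicate_succ']
            simp
          · exact ⟨0, 0, _, by simp, .inr ⟨s, rfl⟩⟩
      · obtain ⟨x, y, t, h, ht⟩ := ih _ (by simp) l rfl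
        exact ⟨x + 1, y, t, by rw [h]; rfl, ht⟩

/-! ### Invariants of the restrictions of `G1` -/

open Classical in
/-- The multiset of the degrees of the neighbours of `v`. -/
noncomputable def nbrDegs {V : Type*} [Fintype V] (H : SimpleGraph V) (v : V) : Multiset ℕ :=
  (Finset.univ.filter fun u => H.Adj v u).val.map (vdeg H)

theorem nbrDegs_iso {V W : Type*} [Fintype V] [Fintype W] {H : SimpleGraph V}
    {K : SimpleGraph W} (f : H ≃g K) (v : V) : nbrDegs K (f v) = nbrDegs H v := by
  classical
  have h : (Finset.univ.filter fun u => K.Adj (f v) u) =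
      (Finset.univ.filter fun u => H.Adj v u).map f.toEquiv.toEmbedding := by
    ext u
    obtain ⟨u, rfl⟩ := f.surjective u
    have h1 : K.Adj (f v) (f u) ↔ H.Adj v u := f.map_adj_iff
    simp only [Finset.mem_filter, Finset.mem_univ, true_and, h1, Finset.mem_map_equiv]
    have : f.toEquiv.symm (f u) = u := f.toEquiv.symm_apply_apply u
    rw [this]
  rw [nbrDegs, nbrDegs]
  rw [show (Finset.univ.filter fun u => K.Adj (f v) u) = _ from h, Finset.map_val,
    Multiset.map_map]
  exact Multiset.map_congr rfl fun u _ => vdeg_iso f u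

/-- The vertex `v` is the end of an edge that meets all the edges, each in a neighbour. -/
def IsDominating {V : Type*} (H : SimpleGraph V) (v : V) : Prop :=
  ∃ a, H.Adj a v ∧ ∀ u w, H.Adj u w → H.Adj u a ∨ H.Adj u v

theorem IsDominating.map {V W : Type*} {H : SimpleGraph V} {K : SimpleGraph W} (f : H ≃g K)
    {v : V} (h : IsDominating H v) : IsDominating K (f v) := by
  obtain ⟨a, h1, h2⟩ := h
  refine ⟨f a, f.map_adj_iff.2 h1, fun u w huw => ?_⟩
  obtain ⟨u, rfl⟩ := f.surjective u
  obtain ⟨w, rfl⟩ := f.surjective w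
  rw [f.map_adj_iff] at huw
  rw [f.map_adj_iff, f.map_adj_iff]
  exact h2 u w huw

theorem vdeg_chainGraph_of_zero {l : List (Fin 2)} {i : Fin l.length} (hi : l[i] = 0) :
    vdeg (chainGraph l) i = onesAfter l i := by
  classical
  rw [vdeg, onesAfter]
  refine Finset.sum_congr rfl fun j _ => ?_
  refine if_congr ?_ rfl rfl
  rw [chainGraph_adj, hi]
  simp

/-- A `0` with some neighbour is the end of an edge, so domination joins it to `a` or to `v`; as `a`
is itself a `0`, it is joined to `v`. Hence the neighbours of `v` are exactly the non-isolated `0`s.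
-/
theorem nbrDegs_chainGraph_of_one {l : List (Fin 2)} {v : Fin l.length} (hv : l[v] = 1)
    (h : IsDominating (chainGraph l) v) :
    nbrDegs (chainGraph l) v = (zeroDegs l).filter (0 < ·) := by
  classical
  obtain ⟨a, h1, h2⟩ := h
  rw [chainGraph_adj, hv] at h1
  replace h1 : a < v ∧ l[a] = 0 := by simpa using h1
  have key : (Finset.univ.filter fun u => (chainGraph l).Adj v u) =
      Finset.univ.filter fun i : Fin l.length => l[i] = 0 ∧ 0 < onesAfter l i := by
    ext i
    simp only [Finset.mem_filter, Finset.mem_univ, true_and]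
    have hpos : 0 < onesAfter l i ↔ ∃ j, i < j ∧ l[j] = 1 := by
      rw [onesAfter, Finset.sum_boole, Nat.cast_id, Finset.card_pos]
      simp [Finset.Nonempty]
    rw [hpos]
    constructor
    · intro h
      rw [chainGraph_adj, hv] at h
      replace h : i < v ∧ l[i] = 0 := by simpa using h
      exact ⟨h.2, v, h.1, hv⟩
    · rintro ⟨hi, j, hij, hj⟩
      rcases h2 i j (by rw [chainGraph_adj]; exact .inl ⟨hij, hi, hj⟩) with h | h
      · rw [chainGraph_adj, hi, h1.2] at h
        simp at h
      · exact h.symm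
  rw [nbrDegs]
  rw [show (Finset.univ.filter fun u => (chainGraph l).Adj v u) = _ from key, ← map_onesAfter,
    Multiset.filter_map, Finset.filter_val, Multiset.filter_filter]
  refine (Multiset.map_congr (g := onesAfter l) rfl fun i hi => ?_).trans ?_
  · exact vdeg_chainGraph_of_zero (Multiset.mem_filter.1 hi).2.1
  · congr 1
    refine Multiset.filter_congr fun i _ => ?_
    rw [and_comm]; rfl

theorem nbrDegs_of_iso_chainGraph {V : Type*} [Fintype V] {H : SimpleGraph V} {v : V}
    (h : IsDominating H v) {l : List (Fin 2)} (f : H ≃g chainGraph l) :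
    nbrDegs H v = (zeroDegs l).filter (0 < ·) ∨
      nbrDegs H v = (zeroDegs (flipWord l)).filter (0 < ·) := by
  obtain h1 | h0 : l[f v] = 1 ∨ l[f v] = 0 := by omega
  · left
    rw [← nbrDegs_iso f, nbrDegs_chainGraph_of_one h1 (h.map f)]
  · right
    obtain ⟨e, he⟩ := exists_iso_chainGraph_flipWord l
    have h1 : (flipWord l)[e.symm (f v)] = 1 := by
      rw [he]
      have : e (e.symm (f v)) = f v := e.apply_symm_apply _
      simp only [this, h0]
      rfl
    rw [← nbrDegs_iso (f.trans e.symm)]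
    exact nbrDegs_chainGraph_of_one h1 (h.map (f.trans e.symm))

theorem zeroDegs_replicate_one_append (x : ℕ) (l : List (Fin 2)) :
    zeroDegs (List.replicate x 1 ++ l) = zeroDegs l := by
  induction x with
  | zero => rfl
  | succ x ih => simpa [List.replicate_succ, zeroDegs] using ih

theorem filter_zeroDegs_append_zeros (u : List (Fin 2)) (x : ℕ) :
    (zeroDegs ((u ++ [1]) ++ List.replicate x 0)).filter (0 < ·) = zeroDegs (u ++ [1]) := by
  induction u with
  | nil =>
    simp only [List.nil_append, List.cons_append, zeroDegs, one_ne_zero, if_false]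
    induction x with
    | zero => rfl
    | succ x ih =>
      have : (List.replicate x (0 : Fin 2)).count 1 = 0 := by simp [List.count_replicate]
      simp [List.replicate_succ, zeroDegs, ih, this]
  | cons z u ih =>
    obtain rfl | rfl : z = 0 ∨ z = 1 := by omega
    · have h : (u ++ [1] ++ List.replicate x 0).count 1 = (u ++ [1]).count 1 := by
        simp [List.count_replicate]
      have h' : 0 < (u ++ [1]).count 1 := by simp
      simp only [List.cons_append, zeroDegs, if_true]
      rw [Multiset.filter_cons_of_pos _ (by rw [h]; exact h'), ih, h]
    · simpa only [List.cons_append, zeroDegs, one_ne_zero, if_false] using ih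

/-- The leading `0` has all the `1`s after it, so the largest entry is the number of `1`s and the
count required by `zeroDegs_injective` comes for free. -/
theorem core_injective {u u' : List (Fin 2)}
    (h : zeroDegs (0 :: (u ++ [1])) = zeroDegs (0 :: (u' ++ [1]))) : u = u' := by
  have key : ∀ u u' : List (Fin 2), zeroDegs (0 :: (u ++ [1])) = zeroDegs (0 :: (u' ++ [1])) →
      (0 :: (u ++ [1])).count 1 ≤ (0 :: (u' ++ [1])).count 1 := by
    intro u u' h
    refine le_of_mem_zeroDegs ?_
    rw [← h]
    simp [zeroDegs]
  have := zeroDegs_injective (le_antisymm (key _ _ h) (key _ _ h.symm)) h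
  exact List.append_cancel_right (List.cons.inj this).2

/-- The edge joins the first `0` to the last `1`: the former is adjacent to every `1` that has a
neighbour, the latter to every `0`. -/
theorem exists_isDominating_coreWord (x : ℕ) (u : List (Fin 2)) :
    ∃ v : Fin (coreWord x u).length, (coreWord x u)[v] = 1 ∧
      IsDominating (chainGraph (coreWord x u)) v := by
  have h0 : (coreWord x u)[(⟨x, by simp; omega⟩ : Fin (coreWord x u).length)] = 0 := by
    simp [coreWord]
  have h1 : (coreWord x u)[(⟨x + u.length + 1, by simp⟩ : Fin (coreWord x u).length)] = 1 := by
    have : x + u.length + 1 - x = u.length + 1 := by omega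
    simp [coreWord, List.getElem_append, this]
  have h2 : ∀ i : Fin (coreWord x u).length, (coreWord x u)[i] = 0 → x ≤ (i : ℕ) := by
    intro i hi
    by_contra! h
    have : (coreWord x u)[i] = 1 := by
      simp only [Fin.getElem_fin]
      simp [coreWord, List.getElem_append, h]
    simp [hi] at this
  refine ⟨_, h1, _, by rw [chainGraph_adj]; exact .inl ⟨by simp [Fin.lt_def], h0, h1⟩,
    fun i j hij => ?_⟩
  have hi := i.isLt
  have hj := j.isLt
  simp only [length_coreWord] at hi hj
  rw [chainGraph_adj] at hij
  rcases hij with ⟨hij, hi0, hj1⟩ | ⟨hij, hj0, hi1⟩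
  · right
    rw [chainGraph_adj]
    exact .inl ⟨by rw [Fin.lt_def] at *; simp; omega, hi0, h1⟩
  · left
    rw [chainGraph_adj]
    have := h2 j hj0
    exact .inr ⟨by rw [Fin.lt_def] at *; simp; omega, h0, hi1⟩

/-- The neighbour degrees at a dominating vertex recover the middle word. The image of that vertex
may lie on either side of the bipartition, which accounts for the flip. -/
theorem eq_or_eq_flipWord {x x' : ℕ} {u u' : List (Fin 2)}
    (e : chainGraph (coreWord x u) ≃g chainGraph (coreWord x' u')) :
    u = u' ∨ u = flipWord u' := by
  obtain ⟨v, hv, hd⟩ := exists_isDominating_coreWord x u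
  have h1 := nbrDegs_chainGraph_of_one hv hd
  have hcore : ∀ x u, (zeroDegs (coreWord x u)).filter (0 < ·) = zeroDegs (0 :: (u ++ [1])) := by
    intro x u
    rw [coreWord, zeroDegs_replicate_one_append]
    simpa only [List.replicate_zero, List.append_nil, List.cons_append] using
      filter_zeroDegs_append_zeros (0 :: u) 0
  rw [hcore] at h1
  refine (nbrDegs_of_iso_chainGraph hd e).imp (fun h => ?_) fun h => ?_
  · rw [hcore, h1] at h
    exact core_injective h
  · rw [flipWord_coreWord, h1] at h
    refine core_injective (h.trans ?_)
    exact filter_zeroDegs_append_zeros (0 :: flipWord u') x'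

theorem nonempty_iso_coreWord_flipWord (x : ℕ) (u : List (Fin 2)) :
    Nonempty (chainGraph (coreWord x u) ≃g chainGraph (coreWord x (flipWord u))) := by
  obtain ⟨e, -⟩ := exists_iso_chainGraph_flipWord (coreWord x u)
  rw [flipWord_coreWord] at e
  obtain ⟨f⟩ := nonempty_iso_chainGraph_rotate (0 :: (flipWord u ++ [1])) x
  exact ⟨e.symm.trans f⟩


/-! ### Words up to flip, and the profile of `G1` -/

/-- Representatives of the words of length `m` up to reversal and exchange of the letters. -/
def halfWords (m : ℕ) : Finset (List (Fin 2)) := (words m).filter fun u => u ≤ flipWord u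

/-- The words below their flip and those above it are equinumerous, cover everything and meet in the
fixed words; this is orbit counting for an involution. -/
theorem card_halfWords (m : ℕ) :
    2 * (halfWords m).card = 2 ^ m + ((words m).filter fun u => u = flipWord u).card := by
  have h1 : ((words m).filter fun u => flipWord u ≤ u).card = (halfWords m).card := by
    refine Finset.card_bij' (fun u _ => flipWord u) (fun u _ => flipWord u) ?_ ?_ ?_ ?_
    · intro u hu; simpa [halfWords] using hu
    · intro u hu; simpa [halfWords] using hu
    · simp
    · simp
  have h2 := Finset.card_union_add_card_inter (halfWords m)
    ((words m).filter fun u => flipWord u ≤ u)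
  have h3 : halfWords m ∪ ((words m).filter fun u => flipWord u ≤ u) = words m := by
    rw [halfWords, ← Finset.filter_or, Finset.filter_true_of_mem fun u _ => le_total _ _]
  have h4 : halfWords m ∩ ((words m).filter fun u => flipWord u ≤ u) =
      (words m).filter fun u => u = flipWord u := by
    rw [halfWords, ← Finset.filter_and]
    exact Finset.filter_congr fun u _ => ⟨fun h => le_antisymm h.1 h.2, fun h => ⟨h.le, h.ge⟩⟩
  rw [h1, h3, h4, card_words] at h2
  omega

theorem card_fixed_even (k : ℕ) :
    ((words (2 * k)).filter fun u => u = flipWord u).card = 2 ^ k := by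
  rw [← card_words]
  refine Finset.card_bij' (fun u _ => u.take k) (fun w _ => w ++ flipWord w) ?_ ?_ ?_ ?_
  · intro u hu
    have := (Finset.mem_filter.1 hu).1
    rw [mem_words] at this ⊢
    simp [this]; omega
  · intro w hw
    rw [mem_words] at hw
    rw [Finset.mem_filter, mem_words, flipWord_append, flipWord_flipWord]
    simp [hw]; omega
  · intro u hu
    obtain ⟨h1, h2⟩ := Finset.mem_filter.1 hu
    rw [mem_words] at h1
    have h3 : flipWord (u.take k) = u.drop k := by
      have h4 : flipWord u = flipWord (u.drop k) ++ flipWord (u.take k) := by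
        rw [← flipWord_append, List.take_append_drop]
      have h5 : u.take k ++ u.drop k = flipWord (u.drop k) ++ flipWord (u.take k) := by
        rw [List.take_append_drop, ← h4, ← h2]
      exact (List.append_inj h5 (by simp; omega)).2.symm
    simp only [h3, List.take_append_drop]
  · intro w hw
    rw [mem_words] at hw
    simp [← hw]

/-- The flip exchanges the numbers of `0`s and `1`s, so a fixed word has even length. -/
theorem card_fixed_odd (k : ℕ) :
    ((words (2 * k + 1)).filter fun u => u = flipWord u).card = 0 := by
  rw [Finset.card_eq_zero, Finset.filter_eq_empty_iff]
  intro u hu h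
  rw [mem_words] at hu
  have h1 : u.count 1 = (flipWord u).count 1 := congrArg (List.count 1) h
  have h2 : (flipWord u).count 1 = u.count 0 := by
    rw [flipWord, List.count_reverse]
    exact List.count_map_of_injective u Fin.rev Fin.rev_injective 0
  have := count_zero_add_count_one u
  omega

/-- The standard words for the restrictions of `G1` with `m + 2` vertices. -/
def wordG1 (m : ℕ) : Option (Σ k : Fin (m + 1), halfWords k) → List (Fin 2)
  | none => List.replicate (m + 2) 1
  | some ⟨k, u⟩ => coreWord (m - k) u

/-- The summand `1` is the edgeless graph. Every other graph has a core `0 u 1` with `u` of length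
at most `m`, unique up to flip, and the missing vertices are isolated. -/
theorem profile_G1 (m : ℕ) : profile (age G1) (m + 2) =
    1 + ∑ k ∈ Finset.range (m + 1), (halfWords k).card := by
  have hnone : ∀ x u, ¬ Nonempty (chainGraph (List.replicate (m + 2) 1) ≃g
      chainGraph (coreWord x u)) := by
    rintro x u ⟨e⟩
    obtain ⟨v, -, a, h, -⟩ := exists_isDominating_coreWord x u
    have h1 := e.symm.map_adj_iff.2 h
    rw [chainGraph_adj] at h1
    simp at h1
  have key := profile_eq_card (G := G1) (n := m + 2) (fun i => chainGraph (wordG1 m i)) ?_ ?_ ?_ ?_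
  · rw [key, Fintype.card_option, Fintype.card_sigma, add_comm]
    simp only [Fintype.card_coe]
    rw [Fin.sum_univ_eq_sum_range (fun k => (halfWords k).card)]
  · rintro (_ | ⟨k, u, hu⟩)
    · simp [wordG1]
    · have := mem_words.1 (Finset.mem_filter.1 hu).1
      simp [wordG1, this]
      omega
  · intro i
    exact ⟨SimpleGraph.Embedding.comap ⟨_, (isWordPos_wordPos _).injective⟩ _⟩
  · intro H f
    obtain ⟨l, ⟨e⟩⟩ := exists_iso_chainGraph f
    have hl : l.length = m + 2 := by simpa using card_eq_length_of_iso e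
    obtain ⟨x, y, t, rfl, ht⟩ := exists_word_decomposition l
    obtain ⟨g⟩ := nonempty_iso_chainGraph_rotate (List.replicate x 1 ++ t) y
    rw [← List.append_assoc, ← List.replicate_add] at g
    rcases ht with rfl | ⟨u, rfl⟩
    · refine ⟨none, ?_⟩
      have h : List.replicate (y + x) (1 : Fin 2) ++ [] = wordG1 m none := by
        rw [List.append_nil, show y + x = m + 2 by simp at hl; omega]
        rfl
      rw [h] at g
      exact ⟨e.trans g⟩
    · have hx : y + x = m - u.length ∧ u.length < m + 1 := by
        simp at hl; omega
      rw [hx.1] at g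
      rcases le_total u (flipWord u) with h | h
      · exact ⟨some ⟨⟨u.length, hx.2⟩, u, Finset.mem_filter.2 ⟨mem_words.2 rfl, h⟩⟩, ⟨e.trans g⟩⟩
      · obtain ⟨g'⟩ := nonempty_iso_coreWord_flipWord (m - u.length) u
        exact ⟨some ⟨⟨u.length, hx.2⟩, flipWord u,
          Finset.mem_filter.2 ⟨mem_words.2 (by simp), by simpa using h⟩⟩,
          ⟨(e.trans g).trans g'⟩⟩
  · rintro (_ | ⟨k, u, hu⟩) (_ | ⟨k', u', hu'⟩) e
    · rfl
    · exact (hnone _ _ e).elim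
    · exact (hnone _ _ ⟨e.some.symm⟩).elim
    · obtain ⟨e⟩ := e
      obtain ⟨h1, h2⟩ := Finset.mem_filter.1 hu
      obtain ⟨h3, h4⟩ := Finset.mem_filter.1 hu'
      rw [mem_words] at h1 h3
      have huu : u = u' := by
        rcases eq_or_eq_flipWord e with h | h
        · exact h
        · change u = flipWord u' at h
          rw [h, flipWord_flipWord] at h2
          rw [h]
          exact le_antisymm h2 h4
      subst huu
      obtain rfl : k = k' := Fin.ext (by rw [← h1, ← h3])
      rfl


/-! ### The infinite path -/

/-- The path on the natural numbers. -/
def natPath : SimpleGraph ℕ where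
  Adj a b := a + 1 = b ∨ b + 1 = a
  symm := ⟨fun _ _ h => h.symm⟩
  loopless := ⟨fun a h => by omega⟩

theorem natPath_adj {a b : ℕ} : natPath.Adj a b ↔ a + 1 = b ∨ b + 1 = a := Iff.rfl

/-- The vertices of `G2` in the order of the path. -/
def pathIndex : ℕ × Fin 2 ≃ ℕ where
  toFun v := 2 * v.1 + (1 - v.2)
  invFun k := (k / 2, ⟨1 - k % 2, by omega⟩)
  left_inv := by
    rintro ⟨m, x⟩
    ext <;> simp <;> omega
  right_inv := by
    intro k
    simp
    omega

/-- The path runs through `(0, 1), (0, 0), (1, 1), (1, 0), …`, which explains the term `1 - v.2` in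
`pathIndex`. -/
theorem nonempty_iso_natPath : Nonempty (G2 ≃g natPath) := by
  refine ⟨⟨pathIndex, ?_⟩⟩
  rintro ⟨m, x⟩ ⟨n, y⟩
  rw [natPath_adj]
  obtain rfl | rfl : x = 0 ∨ x = 1 := by omega
  all_goals obtain rfl | rfl : y = 0 ∨ y = 1 := by omega
  all_goals simp [pathIndex, G2]
  all_goals omega

/-- The vertices of a disjoint union of paths. -/
def PathsVert : List ℕ → Type
  | [] => Empty
  | k :: L => Fin k ⊕ PathsVert L

/-- The disjoint union of paths with given numbers of vertices. -/
def paths : ∀ L : List ℕ, SimpleGraph (PathsVert L)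
  | [] => ⊥
  | k :: L => SimpleGraph.pathGraph k ⊕g paths L

instance fintypePathsVert : ∀ L : List ℕ, Fintype (PathsVert L)
  | [] => inferInstanceAs (Fintype Empty)
  | k :: L => letI := fintypePathsVert L; inferInstanceAs (Fintype (Fin k ⊕ PathsVert L))

theorem card_pathsVert (L : List ℕ) : Fintype.card (PathsVert L) = L.sum := by
  induction L with
  | nil => rfl
  | cons k L ih =>
    rw [List.sum_cons, ← ih]
    refine (Fintype.card_sum (α := Fin k) (β := PathsVert L)).trans ?_
    rw [Fintype.card_fin]

theorem nonempty_iso_paths_of_perm {L L' : List ℕ} (h : L.Perm L') :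
    Nonempty (paths L ≃g paths L') := by
  induction h with
  | nil => exact ⟨SimpleGraph.Iso.refl⟩
  | cons k _ ih => exact ⟨SimpleGraph.Iso.sumCongr .refl ih.some⟩
  | swap k m L =>
    let e1 : paths (m :: k :: L) ≃g (SimpleGraph.pathGraph m ⊕g SimpleGraph.pathGraph k) ⊕g paths L :=
      SimpleGraph.Iso.sumAssoc.symm
    let e2 : (SimpleGraph.pathGraph k ⊕g SimpleGraph.pathGraph m) ⊕g paths L ≃g
      paths (k :: m :: L) := SimpleGraph.Iso.sumAssoc
    let e3 := SimpleGraph.Iso.sumCongr (SimpleGraph.Iso.sumComm (G := SimpleGraph.pathGraph m)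
      (H := SimpleGraph.pathGraph k)) (SimpleGraph.Iso.refl (G := paths L))
    exact ⟨(e1.trans e3).trans e2⟩
  | trans _ _ ih1 ih2 => exact ⟨ih1.some.trans ih2.some⟩

theorem exists_embedding_natPath (L : List ℕ) (a : ℕ) :
    ∃ f : paths L ↪g natPath, ∀ v, a ≤ f v := by
  induction L generalizing a with
  | nil => exact ⟨⟨⟨fun v => v.elim, fun v => v.elim⟩, fun {v} => v.elim⟩, fun v => v.elim⟩
  | cons k L ih =>
    -- The additional `1` leaves a vertex of the path unused between consecutive components.
    obtain ⟨f, hf⟩ := ih (a + k + 1)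
    let g : Fin k ⊕ PathsVert L → ℕ := Sum.elim (fun i => a + i) f
    refine ⟨⟨⟨g, ?_⟩, ?_⟩, ?_⟩
    · rintro (i | u) (j | v) h
      · have h : a + (i : ℕ) = a + j := h
        rw [Fin.ext (by omega : (i : ℕ) = j)]
      · have h : a + (i : ℕ) = f v := h
        have := hf v
        omega
      · have h : f u = a + (j : ℕ) := h
        have := hf u
        omega
      · exact congrArg Sum.inr (f.injective h)
    · rintro (i | u) (j | v)
      · change natPath.Adj (a + i) (a + j) ↔ (SimpleGraph.pathGraph k ⊕g paths L).Adj (.inl i) (.inl j)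
        simp [natPath_adj, SimpleGraph.pathGraph_adj]
        omega
      · change natPath.Adj (a + i) (f v) ↔ (SimpleGraph.pathGraph k ⊕g paths L).Adj (.inl i) (.inr v)
        have := hf v
        simp [natPath_adj]
        omega
      · change natPath.Adj (f u) (a + j) ↔ (SimpleGraph.pathGraph k ⊕g paths L).Adj (.inr u) (.inl j)
        have := hf u
        simp [natPath_adj]
        omega
      · change natPath.Adj (f u) (f v) ↔ (SimpleGraph.pathGraph k ⊕g paths L).Adj (.inr u) (.inr v)
        rw [f.map_adj_iff]
        simp
    · rintro (i | u)
      · exact Nat.le_add_right _ _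
      · exact le_trans (by omega) (hf u)

theorem exists_iso_paths (T : Finset ℕ) :
    ∃ L : List ℕ, (∀ k ∈ L, 0 < k) ∧ Nonempty (natPath.induce (T : Set ℕ) ≃g paths L) := by
  induction hn : T.card using Nat.strong_induction_on generalizing T with
  | _ n ih =>
    subst hn
    rcases T.eq_empty_or_nonempty with rfl | hT
    · have : IsEmpty ((∅ : Finset ℕ) : Set ℕ) := by simp
      have : IsEmpty (PathsVert []) := inferInstanceAs (IsEmpty Empty)
      exact ⟨[], by simp, ⟨⟨Equiv.equivOfIsEmpty _ _, fun {v} => isEmptyElim v⟩⟩⟩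
    · set M := T.max' hT
      have hM : M ∈ T := T.max'_mem hT
      -- The least such `a` gives the component `[a, M]` of the maximum: `a` has no predecessor in
      -- `T`, so the rest of `T` is separated from it.
      have hex : ∃ a, Finset.Icc a M ⊆ T := ⟨M, by simpa using hM⟩
      classical
      let a := Nat.find hex
      have ha : Finset.Icc a M ⊆ T := Nat.find_spec hex
      have haM : a ≤ M := Nat.find_min' hex (by simpa using hM)
      have ha' : ∀ b ∈ T, b + 1 ≠ a := by
        intro b hb hba
        refine Nat.find_min hex (show b < a by omega) fun c hc => ?_
        rw [Finset.mem_Icc] at hc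
        rcases hc.1.eq_or_lt with rfl | h
        · exact hb
        · exact ha (Finset.mem_Icc.2 ⟨by omega, hc.2⟩)
      set T' := T.filter (· < a) with hT'
      have hcard : T'.card < T.card := Finset.card_lt_card (Finset.filter_ssubset.2 ⟨M, hM, by omega⟩)
      obtain ⟨L, hL, ⟨e⟩⟩ := ih _ hcard T' rfl
      refine ⟨(M + 1 - a) :: L, ?_, ?_⟩
      · intro k hk
        rcases List.mem_cons.1 hk with rfl | hk
        · omega
        · exact hL k hk
      · let g : Fin (M + 1 - a) ⊕ (T' : Set ℕ) → (T : Set ℕ) := Sum.elim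
          (fun i => ⟨a + i, ha (Finset.mem_Icc.2 ⟨by omega, by omega⟩)⟩)
          (fun t => ⟨t, (Finset.mem_filter.1 t.2).1⟩)
        have hlt : ∀ t : (T' : Set ℕ), (t : ℕ) + 1 < a := fun t => by
          have h1 := (Finset.mem_filter.1 t.2)
          have h2 := ha' t h1.1
          have h3 : (t : ℕ) < a := h1.2
          omega
        have hg : Function.Bijective g := by
          constructor
          · rintro (i | t) (j | t') h
            · have h : a + (i : ℕ) = a + j := congrArg Subtype.val h
              rw [Fin.ext (by omega : (i : ℕ) = j)]
            · have h : a + (i : ℕ) = t' := congrArg Subtype.val h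
              have := hlt t'
              omega
            · have h : (t : ℕ) = a + j := congrArg Subtype.val h
              have := hlt t
              omega
            · have h : (t : ℕ) = t' := congrArg (fun x : (T : Set ℕ) => (x : ℕ)) h
              exact congrArg Sum.inr (Subtype.ext h)
          · rintro ⟨t, ht⟩
            have htM : t ≤ M := T.le_max' t ht
            by_cases h : t < a
            · exact ⟨.inr ⟨t, Finset.mem_filter.2 ⟨ht, h⟩⟩, rfl⟩
            · exact ⟨.inl ⟨t - a, by omega⟩, Subtype.ext (show a + (t - a) = t by omega)⟩
        have e1 : SimpleGraph.pathGraph (M + 1 - a) ⊕g natPath.induce (T' : Set ℕ) ≃g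
            natPath.induce (T : Set ℕ) := by
          refine ⟨Equiv.ofBijective g hg, ?_⟩
          rintro (i | t) (j | t')
          · change natPath.Adj (a + i) (a + j) ↔ _
            simp [natPath_adj, SimpleGraph.pathGraph_adj]
            omega
          · change natPath.Adj (a + i) t' ↔ _
            have := hlt t'
            simp [natPath_adj]
            omega
          · change natPath.Adj t (a + j) ↔ _
            have := hlt t
            simp [natPath_adj]
            omega
          · change natPath.Adj t t' ↔ _
            simp
        exact ⟨e1.symm.trans (SimpleGraph.Iso.sumCongr .refl e)⟩

/-! ### Sizes of connected components -/

/-- For every vertex, the number of vertices in its connected component. -/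
noncomputable def compSizes {V : Type*} [Fintype V] (H : SimpleGraph V) : Multiset ℕ :=
  (Finset.univ : Finset V).val.map fun v => Nat.card {u // H.Reachable v u}

theorem compSizes_iso {V W : Type*} [Fintype V] [Fintype W] {H : SimpleGraph V}
    {K : SimpleGraph W} (f : H ≃g K) : compSizes K = compSizes H := by
  have h : (Finset.univ : Finset W) = Finset.univ.map f.toEquiv.toEmbedding := by simp
  rw [compSizes, h, Finset.map_val, Multiset.map_map]
  refine Multiset.map_congr rfl fun v _ => ?_
  refine (Nat.card_congr (f.toEquiv.subtypeEquiv fun u => ?_)).symm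
  exact f.reachable_iff.symm

theorem reachable_sum_inl {V W : Type*} {G : SimpleGraph V} {H : SimpleGraph W} {v : V}
    {u : V ⊕ W} : (G ⊕g H).Reachable (.inl v) u ↔ ∃ w, u = .inl w ∧ G.Reachable v w := by
  constructor
  · intro h
    rw [SimpleGraph.reachable_iff_reflTransGen] at h
    induction h with
    | refl => exact ⟨v, rfl, .refl _⟩
    | @tail b c _ hbc ih =>
      obtain ⟨w, rfl, hw⟩ := ih
      rcases c with c | c
      · exact ⟨c, rfl, hw.trans (SimpleGraph.Adj.reachable (by simpa using hbc))⟩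
      · simp at hbc
  · rintro ⟨w, rfl, h⟩
    exact h.map (SimpleGraph.Embedding.sumInl (G := G) (H := H)).toHom

theorem card_reachable_sum_inl {V W : Type*} (G : SimpleGraph V) (H : SimpleGraph W) (v : V) :
    Nat.card {u // (G ⊕g H).Reachable (.inl v) u} = Nat.card {u // G.Reachable v u} := by
  refine (Nat.card_congr (Equiv.ofBijective
    (fun u => ⟨.inl u.1, reachable_sum_inl.2 ⟨_, rfl, u.2⟩⟩) ⟨?_, ?_⟩)).symm
  · intro u w h
    exact Subtype.ext (Sum.inl_injective (congrArg Subtype.val h))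
  · rintro ⟨u, hu⟩
    obtain ⟨w, rfl, hw⟩ := reachable_sum_inl.1 hu
    exact ⟨⟨w, hw⟩, rfl⟩

theorem compSizes_sum {V W : Type*} [Fintype V] [Fintype W] (G : SimpleGraph V)
    (H : SimpleGraph W) : compSizes (G ⊕g H) = compSizes G + compSizes H := by
  have hr : ∀ w, Nat.card {u // (G ⊕g H).Reachable (.inr w) u} = Nat.card {u // H.Reachable w u} := by
    intro w
    rw [← card_reachable_sum_inl H G w]
    let f : G ⊕g H ≃g H ⊕g G := SimpleGraph.Iso.sumComm
    exact Nat.card_congr (f.toEquiv.subtypeEquiv fun u => (f.reachable_iff (u := .inr w)).symm)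
  rw [compSizes, univ_val_map_sum]
  congr 1
  · exact Multiset.map_congr rfl fun v _ => card_reachable_sum_inl G H v
  · exact Multiset.map_congr rfl fun v _ => hr v

theorem compSizes_pathGraph (k : ℕ) :
    compSizes (SimpleGraph.pathGraph k) = Multiset.replicate k k := by
  have : ∀ v : Fin k, Nat.card {u // (SimpleGraph.pathGraph k).Reachable v u} = k := by
    intro v
    rw [Nat.card_congr (Equiv.subtypeUnivEquiv fun u => SimpleGraph.pathGraph_preconnected k v u)]
    simp
  rw [compSizes]
  simp [this]

/-- Each vertex of a path with `k` vertices contributes one entry `k`, hence the factor `k`. -/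
theorem count_compSizes_paths (L : List ℕ) (k : ℕ) :
    (compSizes (paths L)).count k = k * L.count k := by
  induction L with
  | nil => rfl
  | cons m L ih =>
    have : compSizes (paths (m :: L)) = Multiset.replicate m m + compSizes (paths L) := by
      rw [← compSizes_pathGraph]
      exact compSizes_sum _ _
    rw [this, Multiset.count_add, ih, Multiset.count_replicate, List.count_cons]
    by_cases h : m = k
    · simp [h]; ring
    · simp [h]

/-- Empty paths leave no trace in the graph, so the parts must be positive. -/
theorem perm_of_iso_paths {L L' : List ℕ} (hL : ∀ k ∈ L, 0 < k) (hL' : ∀ k ∈ L', 0 < k)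
    (e : paths L ≃g paths L') : L.Perm L' := by
  rw [List.perm_iff_count]
  intro k
  rcases Nat.eq_zero_or_pos k with rfl | hk
  · rw [List.count_eq_zero_of_not_mem fun h => (hL 0 h).false,
      List.count_eq_zero_of_not_mem fun h => (hL' 0 h).false]
  · refine Nat.eq_of_mul_eq_mul_left hk ?_
    rw [← count_compSizes_paths, ← count_compSizes_paths, compSizes_iso e]

theorem profile_G2 (n : ℕ) : profile (age G2) n = Fintype.card (Nat.Partition n) := by
  obtain ⟨e0⟩ := nonempty_iso_natPath
  refine profile_eq_card (G := G2) (n := n) (fun p : Nat.Partition n => paths p.parts.toList)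
    ?_ ?_ ?_ ?_
  · intro p
    rw [Nat.card_eq_fintype_card, card_pathsVert, Multiset.sum_toList, p.parts_sum]
  · intro p
    obtain ⟨f, -⟩ := exists_embedding_natPath p.parts.toList 0
    exact ⟨SimpleGraph.Embedding.comp e0.symm.toRelEmbedding f⟩
  · intro H f
    let g : H ↪g natPath := SimpleGraph.Embedding.comp e0.toRelEmbedding f
    obtain ⟨L, hL, ⟨e⟩⟩ := exists_iso_paths (Finset.univ.map g.toEmbedding)
    obtain ⟨e1⟩ := nonempty_iso_of_range_eq g (SimpleGraph.Embedding.induce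
      (G := natPath) ((Finset.univ.map g.toEmbedding : Finset ℕ) : Set ℕ)) (by
        ext k
        simp [SimpleGraph.Embedding.induce])
    have hsum : L.sum = n := by
      rw [← card_pathsVert, ← Fintype.card_congr (e1.trans e).toEquiv, Fintype.card_fin]
    refine ⟨⟨(L : Multiset ℕ), fun {i} hi => hL i (by simpa using hi), by simpa using hsum⟩, ?_⟩
    obtain ⟨e2⟩ := nonempty_iso_paths_of_perm
      (Multiset.coe_eq_coe.1 (Multiset.coe_toList (L : Multiset ℕ)).symm)
    exact ⟨(e1.trans e).trans e2⟩
  · rintro p q ⟨e⟩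
    have := perm_of_iso_paths (fun k hk => p.parts_pos (Multiset.mem_toList.1 hk))
      (fun k hk => q.parts_pos (Multiset.mem_toList.1 hk)) e
    rw [← Multiset.coe_eq_coe, Multiset.coe_toList, Multiset.coe_toList] at this
    exact Nat.Partition.ext this


/-! ### The generating function of the partition numbers -/

theorem hasProd_genFun_G2 :
    HasProd (fun k : ℕ => ((1 - X ^ (k + 1))⁻¹ : PowerSeries ℚ)) (genFun (age G2)) := by
  have h := Nat.Partition.hasProd_powerSeriesMk_card_restricted ℚ (fun _ => True)
  have h1 : (PowerSeries.mk fun n => ((Nat.Partition.restricted n fun _ => True).card : ℚ)) =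
      genFun (age G2) := by
    ext n
    simp [genFun, profile_G2, Nat.Partition.restricted]
  rw [h1] at h
  refine Eq.mp (congrArg (HasProd · _) (funext fun k => ?_)) h
  symm
  rw [if_pos trivial, PowerSeries.inv_eq_iff_mul_eq_one (by simp)]
  simp_rw [pow_mul]
  rw [PowerSeries.WithPiTopology.tsum_pow_mul_one_sub_of_constantCoeff_eq_zero (by simp)]

/-- Euler's pentagonal number theorem exhibits a sparse inverse of the partition series. -/
theorem genFun_G2_mul_pentagonalSeries :
    genFun (age G2) * PowerSeries.pentagonalSeries ℚ = 1 := by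
  have h := hasProd_genFun_G2.mul (PowerSeries.WithPiTopology.hasProd_one_sub_X_pow ℚ)
  have h1 : (fun k : ℕ => ((1 - X ^ (k + 1))⁻¹ : PowerSeries ℚ) * (1 - X ^ (k + 1))) =
      fun _ => 1 := by
    funext k
    exact PowerSeries.inv_mul_cancel _ (by simp)
  rw [h1] at h
  exact h.unique hasProd_one

/-- The generalized pentagonal numbers increase along `0, 1, -1, 2, -2, …`, so the index after `-k`
is `k + 1`. The gap between the two values is `2 k + 1`. -/
theorem not_pentagonal_of_between {k : ℤ} (hk : 0 < k) {m : ℤ}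
    (h1 : pentagonal (-k) < pentagonal m) : pentagonal (k + 1) ≤ pentagonal m := by
  have h2 := pentagonal_lt_pentagonal_neg hk
  have h3 := pentagonal_lt_pentagonal_neg (show 0 < k + 1 by omega)
  rcases le_total 0 m with hm | hm
  · rcases le_or_gt m k with h | h
    · have := pentagonal_strictMonoOn.monotoneOn hm (show k ∈ Set.Ici 0 from hk.le) h
      omega
    · exact pentagonal_strictMonoOn.monotoneOn (show k + 1 ∈ Set.Ici 0 by simp; omega) hm h
  · rcases le_or_gt (-k) m with h | h
    · have := pentagonal_strictAntiOn.antitoneOn (show -k ∈ Set.Iic 0 by simp; omega) hm h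
      omega
    · have := pentagonal_strictAntiOn.antitoneOn (show m ∈ Set.Iic 0 from hm)
        (show -(k + 1) ∈ Set.Iic 0 by simp; omega) (by omega)
      omega

/-- A fraction `P / Q` would give `P * E = Q` for the pentagonal series `E`. If an exponent `N` of
`E` is followed by a gap longer than the degree `d` of `P`, the coefficient of `P * E` at `d + N` is
the leading coefficient of `P` times a nonzero number. For large `N` this exceeds the degree of `Q`.
-/
theorem not_isRational_genFun_G2 : ¬ IsRational (genFun (age G2)) := by
  rintro ⟨P, Q, hQ, h⟩
  set E := PowerSeries.pentagonalSeries ℚ with hE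
  have hQc : PowerSeries.constantCoeff (Q : PowerSeries ℚ) ≠ 0 := by
    rw [← PowerSeries.coeff_zero_eq_constantCoeff_apply, Polynomial.coeff_coe]
    exact hQ
  have h1 : (P : PowerSeries ℚ) * E = Q := by
    have h2 := genFun_G2_mul_pentagonalSeries
    rw [h, ← hE] at h2
    calc (P : PowerSeries ℚ) * E = (P * (Q : PowerSeries ℚ)⁻¹ * E) * Q := by
          rw [mul_right_comm (P : PowerSeries ℚ), mul_assoc _ (Q : PowerSeries ℚ)⁻¹,
            PowerSeries.inv_mul_cancel _ hQc, mul_one]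
      _ = Q := by rw [h2, one_mul]
  have hP : P ≠ 0 := by
    rintro rfl
    rw [Polynomial.coe_zero, zero_mul] at h1
    exact hQc (by rw [← h1]; simp)
  set d := P.natDegree with hd
  -- Large enough that `N ≥ k` exceeds the degree of `Q` and that the gap `2 k + 1` after `N`
  -- exceeds `d`.
  set k : ℤ := d + Q.natDegree + 1 with hk
  have hk0 : 0 < k := by omega
  have hN1 := two_mul_natCast_pentagonal_neg k
  have hN2 := two_mul_natCast_pentagonal (k + 1)
  set N := pentagonal (-k)
  have hNk : (k : ℤ) ≤ N := by nlinarith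
  have hgap : N + d < pentagonal (k + 1) := by
    have : (N : ℤ) + d < pentagonal (k + 1) := by nlinarith
    exact_mod_cast this
  have h2 : PowerSeries.coeff (d + N) ((P : PowerSeries ℚ) * E) = 0 := by
    rw [h1, Polynomial.coeff_coe]
    refine Polynomial.coeff_eq_zero_of_natDegree_lt ?_
    omega
  rw [PowerSeries.coeff_mul, Finset.sum_eq_single (d, N)] at h2
  · have h3 : PowerSeries.coeff N E ≠ 0 := by
      rw [hE, Ne, PowerSeries.coeff_pentagonalSeries_eq_zero_iff]
      simp [N]
    rcases mul_eq_zero.1 h2 with h | h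
    · rw [Polynomial.coeff_coe] at h
      exact hP (Polynomial.leadingCoeff_eq_zero.1 h)
    · exact h3 h
  · rintro ⟨i, j⟩ hij hne
    rw [Finset.HasAntidiagonal.mem_antidiagonal] at hij
    dsimp only at hij ⊢
    rcases lt_or_ge d i with hi | hi
    · rw [Polynomial.coeff_coe, Polynomial.coeff_eq_zero_of_natDegree_lt hi, zero_mul]
    · rw [hE, PowerSeries.coeff_pentagonalSeries_eq_zero, mul_zero]
      rintro ⟨m, rfl⟩
      have hNm : N < pentagonal m := by
        rcases hi.lt_or_eq with h | h
        · omega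
        · exact (hne (by rw [Prod.mk.injEq]; omega)).elim
      have := not_pentagonal_of_between hk0 hNm
      omega
  · intro h
    simp at h

/-- A term of a series with nonnegative coefficients is at most its value at `x`. The induction
compares `G = F + X ^ (k + 1) * G` with the same relation `hfix` between the values at `x`. -/
theorem coeff_prod_inv_mul_pow_le {x : ℝ} (hx0 : 0 < x) (hx1 : x < 1) (s : Finset ℕ) (n : ℕ) :
    ((PowerSeries.coeff n (∏ k ∈ s, ((1 - X ^ (k + 1))⁻¹ : PowerSeries ℚ)) : ℚ) : ℝ) * x ^ n ≤
      ∏ k ∈ s, (1 - x ^ (k + 1))⁻¹ := by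
  induction s using Finset.induction_on generalizing n with
  | empty =>
    rcases n with _ | n
    · simp
    · simp [PowerSeries.coeff_one]
  | insert k s hk ih =>
    have hxk : x ^ (k + 1) < 1 := pow_lt_one₀ hx0.le hx1 (by omega)
    have hxk0 : 0 < x ^ (k + 1) := by positivity
    set F : PowerSeries ℚ := ∏ k ∈ s, ((1 - X ^ (k + 1))⁻¹ : PowerSeries ℚ)
    set G : PowerSeries ℚ := ∏ k ∈ insert k s, ((1 - X ^ (k + 1))⁻¹ : PowerSeries ℚ) with hG
    have hGF : G = F + X ^ (k + 1) * G := by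
      have h1 : (1 - X ^ (k + 1) : PowerSeries ℚ) * G = F := by
        rw [hG, Finset.prod_insert hk, ← mul_assoc, PowerSeries.mul_inv_cancel _ (by simp), one_mul]
      rw [← h1]; ring
    rw [Finset.prod_insert hk]
    set C := ∏ k ∈ s, (1 - x ^ (k + 1))⁻¹
    have hC : 0 ≤ C := Finset.prod_nonneg fun j _ =>
      inv_nonneg.2 (sub_nonneg.2 (pow_le_one₀ hx0.le hx1.le))
    have hfix : C + x ^ (k + 1) * ((1 - x ^ (k + 1))⁻¹ * C) = (1 - x ^ (k + 1))⁻¹ * C := by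
      have : 1 - x ^ (k + 1) ≠ 0 := by linarith
      field_simp
      ring
    induction n using Nat.strong_induction_on with
    | _ n ih' =>
      rw [hGF, map_add, PowerSeries.coeff_X_pow_mul']
      split_ifs with hkn
      · have h1 := ih n
        have h2 := ih' (n - (k + 1)) (by omega)
        have h3 : x ^ n = x ^ (k + 1) * x ^ (n - (k + 1)) := by
          rw [← pow_add]; congr 1; omega
        push_cast
        rw [add_mul, ← hfix]
        refine add_le_add h1 ?_
        rw [h3, mul_left_comm]
        exact mul_le_mul_of_nonneg_left h2 hxk0.le
      · have h1 := ih n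
        rw [add_zero]
        refine h1.trans ?_
        rw [← hfix]
        have : 0 ≤ (1 - x ^ (k + 1))⁻¹ := inv_nonneg.2 (by linarith)
        have : 0 ≤ x ^ (k + 1) * ((1 - x ^ (k + 1))⁻¹ * C) := by positivity
        linarith

/-- Each factor is `1 + t / (1 - t)` with `t = x ^ (k + 1)`, at most `exp (x ^ k / (1 - x))`; the
exponents form a geometric series. The bound does not depend on `s` and so passes to the infinite
product. -/
theorem prod_inv_le {x : ℝ} (hx0 : 0 < x) (hx1 : x < 1) (s : Finset ℕ) :
    ∏ k ∈ s, (1 - x ^ (k + 1))⁻¹ ≤ Real.exp ((1 - x)⁻¹ * (1 - x)⁻¹) := by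
  have h1 : ∀ k ∈ s, (1 - x ^ (k + 1))⁻¹ ≤ Real.exp (x ^ k * (1 - x)⁻¹) := by
    intro k _
    have h2 : x ^ (k + 1) ≤ x := by
      simpa using pow_le_pow_of_le_one hx0.le hx1.le (show 1 ≤ k + 1 by omega)
    have h3 : x ^ (k + 1) ≤ x ^ k := pow_le_pow_of_le_one hx0.le hx1.le (by omega)
    have h4 : 0 < x ^ (k + 1) := by positivity
    have h5 : (1 - x ^ (k + 1))⁻¹ = x ^ (k + 1) * (1 - x ^ (k + 1))⁻¹ + 1 := by
      have : 1 - x ^ (k + 1) ≠ 0 := by linarith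
      field_simp
      ring
    have h6 : (1 - x ^ (k + 1))⁻¹ ≤ (1 - x)⁻¹ := inv_anti₀ (by linarith) (by linarith)
    have h7 : x ^ (k + 1) * (1 - x ^ (k + 1))⁻¹ ≤ x ^ k * (1 - x)⁻¹ :=
      mul_le_mul h3 h6 (inv_nonneg.2 (by linarith)) (by positivity)
    calc _ ≤ x ^ k * (1 - x)⁻¹ + 1 := by rw [h5]; linarith
      _ ≤ _ := Real.add_one_le_exp _
  refine (Finset.prod_le_prod (fun k _ => inv_nonneg.2 (sub_nonneg.2
    (pow_le_one₀ hx0.le hx1.le))) h1).trans ?_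
  rw [← Real.exp_sum, ← Finset.sum_mul]
  refine Real.exp_le_exp.2 (mul_le_mul_of_nonneg_right ?_ (inv_nonneg.2 (by linarith)))
  rw [← tsum_geometric_of_lt_one hx0.le hx1]
  exact (summable_geometric_of_lt_one hx0.le hx1).sum_le_tsum s fun k _ => by positivity

theorem profile_G2_mul_pow_le {x : ℝ} (hx0 : 0 < x) (hx1 : x < 1) (n : ℕ) :
    (profile (age G2) n : ℝ) * x ^ n ≤ Real.exp ((1 - x)⁻¹ * (1 - x)⁻¹) := by
  have h1 := hasProd_genFun_G2
  rw [HasProd, PowerSeries.WithPiTopology.tendsto_iff_coeff_tendsto] at h1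
  have h2 := ((Rat.continuous_coe_real.tendsto _).comp (h1 n)).mul_const (x ^ n)
  have h3 := le_of_tendsto' h2 fun s =>
    (coeff_prod_inv_mul_pow_le hx0 hx1 s n).trans (prod_inv_le hx0 hx1 s)
  simpa [genFun] using h3

theorem hasSubexponentialGrowth_G2 : HasSubexponentialGrowth (profile (age G2)) := by
  intro c hc
  obtain ⟨b, hb1, hbc⟩ := exists_between hc
  have hb0 : 0 < b := by linarith
  have hx0 : 0 < b⁻¹ := inv_pos.2 hb0
  have hx1 : b⁻¹ < 1 := inv_lt_one_of_one_lt₀ hb1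
  have h1 : (fun n => (profile (age G2) n : ℝ)) =O[atTop] fun n : ℕ => b ^ n := by
    refine IsBigO.of_bound (Real.exp ((1 - b⁻¹)⁻¹ * (1 - b⁻¹)⁻¹)) (Eventually.of_forall fun n => ?_)
    have h2 := profile_G2_mul_pow_le hx0 hx1 n
    have h3 : 0 < b ^ n := by positivity
    rw [inv_pow, ← div_eq_mul_inv, div_le_iff₀ h3] at h2
    rwa [Real.norm_of_nonneg (by positivity), Real.norm_of_nonneg h3.le]
  exact h1.trans_isLittleO (isLittleO_pow_pow_of_lt_left hb0.le hbc)


/-! ### Values of the profiles -/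

theorem card_codeG4_small : (codeG4 0).card = 0 ∧ (codeG4 1).card = 0 ∧ (codeG4 2).card = 1 := by
  decide

theorem card_codeG4_closed (k : ℕ) : (codeG4 (2 * k + 2)).card + 2 = (k + 1) ^ 2 + 2 * (k + 1) ∧
    (codeG4 (2 * k + 3)).card + 3 = (k + 2) * (k + 3) := by
  induction k with
  | zero =>
    have h := card_codeG4_small.2.2
    have h' := card_codeG4_succ (n := 2) le_rfl
    norm_num [h] at h' ⊢
    omega
  | succ k ih =>
    have h1 := card_codeG4_succ (n := 2 * k + 3) (by omega)
    have h2 := card_codeG4_succ (n := 2 * k + 4) (by omega)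
    rw [show (2 * k + 3 + 1) / 2 = k + 2 by omega] at h1
    rw [show (2 * k + 4 + 1) / 2 = k + 2 by omega] at h2
    rw [show 2 * (k + 1) + 2 = 2 * k + 3 + 1 by ring, show 2 * (k + 1) + 3 = 2 * k + 4 + 1 by ring]
    constructor
    · rw [h1]; nlinarith [ih.2]
    · rw [h2, show 2 * k + 4 = 2 * k + 3 + 1 by ring, h1]; nlinarith [ih.2]

/-- This holds because `2 ≤ (3 / 2) ^ 2`. The base `3 / 2`, between `1` and `2`, dominates the error
terms of all the exponential profiles. -/
theorem two_pow_half_le (n : ℕ) : (2 : ℝ) ^ (n / 2) ≤ (3 / 2) ^ n := by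
  have h1 : (2 : ℝ) ^ (n / 2) ≤ ((3 / 2) ^ 2) ^ (n / 2) := by gcongr; norm_num
  refine h1.trans ?_
  rw [← pow_mul]
  exact pow_le_pow_right₀ (by norm_num) (by omega)

/-! ### Quasi-polynomials with period two -/

section Quadratic

variable {f : ℕ → ℕ} {a c₀ c₁ d₀ d₁ : ℚ} {m : ℕ}

/-- Only the coefficients of lower order depend on the parity, so the difference from `a n²` is
linear in both cases. -/
theorem isEquivalent_of_parity (ha : a ≠ 0)
    (h₀ : ∀ n k, n = 2 * k → m ≤ n → (f n : ℚ) = a * n ^ 2 + c₀ * n + d₀)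
    (h₁ : ∀ n k, n = 2 * k + 1 → m ≤ n → (f n : ℚ) = a * n ^ 2 + c₁ * n + d₁) :
    (fun n => (f n : ℝ)) ~[atTop] fun n : ℕ => (a : ℝ) * (n : ℝ) ^ 2 := by
  have ha' : (a : ℝ) ≠ 0 := by exact_mod_cast ha
  rw [IsEquivalent]
  have h1 : (fun n : ℕ => (n : ℝ)) =o[atTop] fun n : ℕ => (a : ℝ) * (n : ℝ) ^ 2 := by
    refine IsLittleO.const_mul_right ha' ?_
    have := (isLittleO_pow_pow_atTop_of_lt (𝕜 := ℝ) (show 1 < 2 by norm_num)).comp_tendsto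
      tendsto_natCast_atTop_atTop
    simpa [Function.comp_def] using this
  refine IsBigO.trans_isLittleO (IsBigO.of_bound
    (|(c₀ : ℝ)| + |(c₁ : ℝ)| + |(d₀ : ℝ)| + |(d₁ : ℝ)|) ?_) h1
  filter_upwards [eventually_ge_atTop (max m 1)] with n hn
  have hm : m ≤ n := le_trans (le_max_left _ _) hn
  have hn1 : (1 : ℝ) ≤ n := by exact_mod_cast le_trans (le_max_right _ _) hn
  simp only [Pi.sub_apply, Real.norm_eq_abs, Nat.abs_cast]
  have key : ∀ c d : ℝ, (f n : ℝ) = a * n ^ 2 + c * n + d →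
      |(f n : ℝ) - a * n ^ 2| ≤ (|c| + |d|) * n := by
    intro c d h
    rw [h, show a * (n : ℝ) ^ 2 + c * n + d - a * n ^ 2 = c * n + d by ring]
    calc |c * n + d| ≤ |c * n| + |d| := abs_add_le _ _
      _ = |c| * n + |d| := by rw [abs_mul, Nat.abs_cast]
      _ ≤ (|c| + |d|) * n := by nlinarith [abs_nonneg d]
  obtain ⟨k, hk | hk⟩ := Nat.even_or_odd' n
  · refine (key c₀ d₀ (by exact_mod_cast congrArg (Rat.cast : ℚ → ℝ) (h₀ n k hk hm))).trans ?_
    refine mul_le_mul_of_nonneg_right ?_ n.cast_nonneg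
    linarith [abs_nonneg (c₁ : ℝ), abs_nonneg (d₁ : ℝ)]
  · refine (key c₁ d₁ (by exact_mod_cast congrArg (Rat.cast : ℚ → ℝ) (h₁ n k hk hm))).trans ?_
    refine mul_le_mul_of_nonneg_right ?_ n.cast_nonneg
    linarith [abs_nonneg (c₀ : ℝ), abs_nonneg (d₀ : ℝ)]

theorem hasPolynomialGrowth_of_isEquivalent {b : ℝ} (hb : b ≠ 0)
    (h : (fun n => (f n : ℝ)) ~[atTop] fun n : ℕ => b * (n : ℝ) ^ 2) : HasPolynomialGrowth 2 f :=
  h.isTheta.trans ((isTheta_refl _ _).const_mul_left hb)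

theorem isQuasiPolynomial_of_parity (ha : a ≠ 0)
    (h₀ : ∀ n k, n = 2 * k → m ≤ n → (f n : ℚ) = a * n ^ 2 + c₀ * n + d₀)
    (h₁ : ∀ n k, n = 2 * k + 1 → m ≤ n → (f n : ℚ) = a * n ^ 2 + c₁ * n + d₁) :
    IsQuasiPolynomial 2 f := by
  refine ⟨fun i n => if i = 2 then a else if i = 1 then (if n % 2 = 0 then c₀ else c₁) else
    (if n % 2 = 0 then d₀ else d₁), fun i _ => ⟨2, by norm_num, fun n => by simp⟩, ⟨0, by simpa⟩, ?_⟩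
  filter_upwards [eventually_ge_atTop m] with n hn
  simp only [Finset.sum_range_succ, Finset.sum_range_zero]
  obtain ⟨k, hk | hk⟩ := Nat.even_or_odd' n
  · rw [h₀ n k hk hn]
    have : n % 2 = 0 := by omega
    simp [this]
    ring
  · rw [h₁ n k hk hn]
    have : n % 2 = 1 := by omega
    simp [this]
    ring

end Quadratic

/-! ### Exponential growth -/

theorem isEquivalent_two_pow {f : ℕ → ℕ} {b C : ℝ} (hb : b ≠ 0)
    (h : ∀ᶠ n in atTop, |(f n : ℝ) - b * 2 ^ n| ≤ C * (3 / 2) ^ n) :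
    (fun n => (f n : ℝ)) ~[atTop] fun n : ℕ => b * (2 : ℝ) ^ n := by
  rw [IsEquivalent]
  have h1 : (fun n : ℕ => ((3 : ℝ) / 2) ^ n) =o[atTop] fun n : ℕ => b * (2 : ℝ) ^ n :=
    (isLittleO_pow_pow_of_lt_left (by norm_num) (by norm_num)).const_mul_right hb
  refine IsBigO.trans_isLittleO (IsBigO.of_bound C ?_) h1
  filter_upwards [h] with n hn
  have h3 : (0 : ℝ) < (3 / 2) ^ n := by positivity
  rw [Real.norm_of_nonneg h3.le]
  exact hn

theorem hasExponentialGrowth_of_isEquivalent {f : ℕ → ℕ} {b : ℝ} (hb : b ≠ 0)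
    (h : (fun n => (f n : ℝ)) ~[atTop] fun n : ℕ => b * (2 : ℝ) ^ n) : HasExponentialGrowth f :=
  ⟨2, by norm_num, h.isTheta.trans ((isTheta_refl _ _).const_mul_left hb)⟩

/-! ### Coefficients of rational series -/

theorem coeff_ofNat_mul (n a : ℕ) [a.AtLeastTwo] (F : PowerSeries ℚ) :
    PowerSeries.coeff n (ofNat(a) * F) = ofNat(a) * PowerSeries.coeff n F := by
  rw [← map_ofNat (PowerSeries.C (R := ℚ)) a, PowerSeries.coeff_C_mul]

theorem coeff_genFun_mul_X_pow (C : GraphClass) (n i : ℕ) :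
    PowerSeries.coeff n (genFun C * X ^ i) = if i ≤ n then (profile C (n - i) : ℚ) else 0 := by
  rw [PowerSeries.coeff_mul_X_pow']
  simp [genFun]

theorem coeff_genFun (C : GraphClass) (n : ℕ) :
    PowerSeries.coeff n (genFun C) = profile C n := by simp [genFun]

theorem profile_G6_small : profile (age G6) 0 = 1 ∧ profile (age G6) 1 = 1 :=
  ⟨profile_zero _, profile_one _⟩

theorem profile_G6_closed (m : ℕ) : (profile (age G6) (m + 2) : ℚ) = 3 * 2 ^ m - (m + 1) := by
  have : m + 1 ≤ 2 ^ m := m.lt_two_pow_self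
  rw [profile_G6]
  push_cast [this]
  ring

theorem genFun_G6 : genFun (age G6) =
    (1 - 3 * X + 3 * X ^ 2 - X ^ 3 + X ^ 4) * ((1 - 2 * X) * (1 - X) ^ 2)⁻¹ := by
  rw [PowerSeries.eq_mul_inv_iff_mul_eq (by simp)]
  -- Multiplying by the denominator turns the identity into a linear recurrence for the profile, and
  -- the first coefficients are checked from the initial values.
  have hD : genFun (age G6) * ((1 - 2 * X) * (1 - X) ^ 2) = genFun (age G6) -
      4 * (genFun (age G6) * X ^ 1) + 5 * (genFun (age G6) * X ^ 2) -
        2 * (genFun (age G6) * X ^ 3) := by ring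
  rw [hD]
  ext n
  rcases n with _ | _ | _ | _ | _ | n
  all_goals
    simp only [map_add, map_sub, coeff_ofNat_mul, coeff_genFun_mul_X_pow, coeff_genFun,
      PowerSeries.coeff_X_pow, PowerSeries.coeff_X, PowerSeries.coeff_one]
    simp [profile_G6_small, profile_G6_closed]
    try norm_num
    try ring


/-! ### Closed forms and generating functions of `G0`, `G4`, `G3`, `G1` and `G5` -/

theorem profile_G0_even (n k : ℕ) (h : n = 2 * k) (hn : 3 ≤ n) :
    (profile (age G0) n : ℚ) = 1 / 8 * n ^ 2 + 3 / 4 * n + 1 := by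
  rw [profile_G0 (by omega), show n / 2 = k by omega, Nat.cast_choose_two, h]
  push_cast
  ring

theorem profile_G0_odd (n k : ℕ) (h : n = 2 * k + 1) (hn : 3 ≤ n) :
    (profile (age G0) n : ℚ) = 1 / 8 * n ^ 2 + 1 / 2 * n + 3 / 8 := by
  rw [profile_G0 (by omega), show n / 2 = k by omega, Nat.cast_choose_two, h]
  push_cast
  ring

theorem profile_G0_small : profile (age G0) 0 = 1 ∧ profile (age G0) 1 = 1 ∧
    profile (age G0) 2 = 2 ∧ profile (age G0) 3 = 3 ∧ profile (age G0) 4 = 6 ∧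
    profile (age G0) 5 = 6 ∧ profile (age G0) 6 = 10 ∧ profile (age G0) 7 = 10 := by
  refine ⟨profile_zero _, profile_one _, profile_G0_two, ?_, ?_, ?_, ?_, ?_⟩
  all_goals exact profile_G0 (by norm_num)

theorem genFun_G0 : genFun (age G0) =
    (1 - X ^ 2 + X ^ 3 + 2 * X ^ 4 - 2 * X ^ 5 - X ^ 6 + X ^ 7) *
      ((1 - X) * (1 - X ^ 2) ^ 2)⁻¹ := by
  rw [PowerSeries.eq_mul_inv_iff_mul_eq (by simp)]
  have hD : genFun (age G0) * ((1 - X) * (1 - X ^ 2) ^ 2) = genFun (age G0) -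
      genFun (age G0) * X ^ 1 - 2 * (genFun (age G0) * X ^ 2) + 2 * (genFun (age G0) * X ^ 3) +
        genFun (age G0) * X ^ 4 - genFun (age G0) * X ^ 5 := by ring
  -- The closed forms hold from `n = 3` on, so the recurrence of order five is available from degree
  -- `8`, just above the degree of the numerator.
  have hrec : ∀ n, (profile (age G0) (n + 8) : ℚ) - profile (age G0) (n + 7) -
      2 * profile (age G0) (n + 6) + 2 * profile (age G0) (n + 5) + profile (age G0) (n + 4) -
        profile (age G0) (n + 3) = 0 := by
    intro n
    obtain ⟨k, rfl | rfl⟩ := Nat.even_or_odd' n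
    · rw [profile_G0_even _ (k + 4) (by ring) (by omega),
        profile_G0_odd _ (k + 3) (by ring) (by omega),
        profile_G0_even _ (k + 3) (by ring) (by omega),
        profile_G0_odd _ (k + 2) (by ring) (by omega),
        profile_G0_even _ (k + 2) (by ring) (by omega),
        profile_G0_odd _ (k + 1) (by ring) (by omega)]
      push_cast
      ring
    · rw [profile_G0_odd _ (k + 4) (by ring) (by omega),
        profile_G0_even _ (k + 4) (by ring) (by omega),
        profile_G0_odd _ (k + 3) (by ring) (by omega),
        profile_G0_even _ (k + 3) (by ring) (by omega),
        profile_G0_odd _ (k + 2) (by ring) (by omega),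
        profile_G0_even _ (k + 2) (by ring) (by omega)]
      push_cast
      ring
  rw [hD]
  ext n
  rcases n with _ | _ | _ | _ | _ | _ | _ | _ | n
  all_goals
    simp only [map_add, map_sub, coeff_ofNat_mul, coeff_genFun_mul_X_pow, coeff_genFun,
      PowerSeries.coeff_X_pow, PowerSeries.coeff_one]
    simp [profile_G0_small]
    try norm_num
  exact hrec n

theorem profile_G4_even (n k : ℕ) (h : n = 2 * k) (hn : 2 ≤ n) :
    (profile (age G4) n : ℚ) = 1 / 4 * n ^ 2 + 1 * n + -1 := by
  obtain ⟨j, rfl⟩ : ∃ j, k = j + 1 := ⟨k - 1, by omega⟩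
  have h1 := (card_codeG4_closed j).1
  rw [profile_G4, h, show 2 * (j + 1) = 2 * j + 2 by ring]
  have h2 : ((codeG4 (2 * j + 2)).card : ℚ) + 2 = (j + 1) ^ 2 + 2 * (j + 1) := by exact_mod_cast h1
  push_cast
  linear_combination h2

theorem profile_G4_odd (n k : ℕ) (h : n = 2 * k + 1) (hn : 2 ≤ n) :
    (profile (age G4) n : ℚ) = 1 / 4 * n ^ 2 + 1 * n + -(5 / 4) := by
  obtain ⟨j, rfl⟩ : ∃ j, k = j + 1 := ⟨k - 1, by omega⟩
  have h1 := (card_codeG4_closed j).2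
  rw [profile_G4, h, show 2 * (j + 1) + 1 = 2 * j + 3 by ring]
  have h2 : ((codeG4 (2 * j + 3)).card : ℚ) + 3 = (j + 2) * (j + 3) := by exact_mod_cast h1
  push_cast
  linear_combination h2

theorem card_codeG4_values : (codeG4 3).card = 3 ∧ (codeG4 4).card = 6 ∧ (codeG4 5).card = 9 := by
  have h1 := (card_codeG4_closed 0).2
  have h2 := (card_codeG4_closed 1).1
  have h3 := (card_codeG4_closed 1).2
  norm_num at h1 h2 h3
  omega

theorem profile_G4_small : profile (age G4) 0 = 1 ∧ profile (age G4) 1 = 1 ∧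
    profile (age G4) 2 = 2 ∧ profile (age G4) 3 = 4 ∧ profile (age G4) 4 = 7 ∧
    profile (age G4) 5 = 10 := by
  simp [profile_G4, card_codeG4_small, card_codeG4_values]

theorem genFun_G4 : genFun (age G4) =
    (1 - X + 2 * X ^ 3 - X ^ 5) * ((1 - X) ^ 3 * (1 + X))⁻¹ := by
  rw [PowerSeries.eq_mul_inv_iff_mul_eq (by simp)]
  have hD : genFun (age G4) * ((1 - X) ^ 3 * (1 + X)) = genFun (age G4) -
      2 * (genFun (age G4) * X ^ 1) + 2 * (genFun (age G4) * X ^ 3) -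
        genFun (age G4) * X ^ 4 := by ring
  have hrec : ∀ n, (profile (age G4) (n + 6) : ℚ) - 2 * profile (age G4) (n + 5) +
      2 * profile (age G4) (n + 3) - profile (age G4) (n + 2) = 0 := by
    intro n
    obtain ⟨k, rfl | rfl⟩ := Nat.even_or_odd' n
    · rw [profile_G4_even _ (k + 3) (by ring) (by omega),
        profile_G4_odd _ (k + 2) (by ring) (by omega),
        profile_G4_odd _ (k + 1) (by ring) (by omega),
        profile_G4_even _ (k + 1) (by ring) (by omega)]
      push_cast
      ring
    · rw [profile_G4_odd _ (k + 3) (by ring) (by omega),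
        profile_G4_even _ (k + 3) (by ring) (by omega),
        profile_G4_even _ (k + 2) (by ring) (by omega),
        profile_G4_odd _ (k + 1) (by ring) (by omega)]
      push_cast
      ring
  rw [hD]
  ext n
  rcases n with _ | _ | _ | _ | _ | _ | n
  all_goals
    simp only [map_add, map_sub, coeff_ofNat_mul, coeff_genFun_mul_X_pow, coeff_genFun,
      PowerSeries.coeff_X_pow, PowerSeries.coeff_X, PowerSeries.coeff_one]
    simp [profile_G4_small]
    try norm_num
  exact hrec n

theorem profile_G3_even (n k : ℕ) (h : n = 2 * k) (hn : 3 ≤ n) :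
    (profile (age G3) n : ℚ) = 1 / 4 * n ^ 2 + 1 * n + -2 := by
  obtain ⟨j, rfl⟩ : ∃ j, k = j + 2 := ⟨k - 2, by omega⟩
  have h1 := (card_codeG4_closed j).2
  rw [profile_G3, h, show 2 * (j + 2) - 1 = 2 * j + 3 by omega,
    show 2 * (j + 2) / 2 = j + 2 by omega]
  have h2 : ((codeG4 (2 * j + 3)).card : ℚ) + 3 = (j + 2) * (j + 3) := by exact_mod_cast h1
  push_cast
  linear_combination h2

theorem profile_G3_odd (n k : ℕ) (h : n = 2 * k + 1) (hn : 3 ≤ n) :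
    (profile (age G3) n : ℚ) = 1 / 4 * n ^ 2 + 1 * n + -(9 / 4) := by
  obtain ⟨j, rfl⟩ : ∃ j, k = j + 1 := ⟨k - 1, by omega⟩
  have h1 := (card_codeG4_closed j).1
  rw [profile_G3, h, show 2 * (j + 1) + 1 - 1 = 2 * j + 2 by omega,
    show (2 * (j + 1) + 1) / 2 = j + 1 by omega]
  have h2 : ((codeG4 (2 * j + 2)).card : ℚ) + 2 = (j + 1) ^ 2 + 2 * (j + 1) := by exact_mod_cast h1
  push_cast
  linear_combination h2

theorem profile_G3_small : profile (age G3) 0 = 1 ∧ profile (age G3) 1 = 1 ∧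
    profile (age G3) 2 = 2 ∧ profile (age G3) 3 = 3 ∧ profile (age G3) 4 = 6 ∧
    profile (age G3) 5 = 9 ∧ profile (age G3) 6 = 13 := by
  simp [profile_G3, card_codeG4_small, card_codeG4_values]

theorem genFun_G3 : genFun (age G3) =
    (1 - X + X ^ 3 + X ^ 4 - X ^ 6) * ((1 - X) ^ 2 * (1 - X ^ 2))⁻¹ := by
  rw [PowerSeries.eq_mul_inv_iff_mul_eq (by simp)]
  have hD : genFun (age G3) * ((1 - X) ^ 2 * (1 - X ^ 2)) = genFun (age G3) -
      2 * (genFun (age G3) * X ^ 1) + 2 * (genFun (age G3) * X ^ 3) -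
        genFun (age G3) * X ^ 4 := by ring
  have hrec : ∀ n, (profile (age G3) (n + 7) : ℚ) - 2 * profile (age G3) (n + 6) +
      2 * profile (age G3) (n + 4) - profile (age G3) (n + 3) = 0 := by
    intro n
    obtain ⟨k, rfl | rfl⟩ := Nat.even_or_odd' n
    · rw [profile_G3_odd _ (k + 3) (by ring) (by omega),
        profile_G3_even _ (k + 3) (by ring) (by omega),
        profile_G3_even _ (k + 2) (by ring) (by omega),
        profile_G3_odd _ (k + 1) (by ring) (by omega)]
      push_cast
      ring
    · rw [profile_G3_even _ (k + 4) (by ring) (by omega),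
        profile_G3_odd _ (k + 3) (by ring) (by omega),
        profile_G3_odd _ (k + 2) (by ring) (by omega),
        profile_G3_even _ (k + 2) (by ring) (by omega)]
      push_cast
      ring
  rw [hD]
  ext n
  rcases n with _ | _ | _ | _ | _ | _ | _ | n
  all_goals
    simp only [map_add, map_sub, coeff_ofNat_mul, coeff_genFun_mul_X_pow, coeff_genFun,
      PowerSeries.coeff_X_pow, PowerSeries.coeff_X, PowerSeries.coeff_one]
    simp [profile_G3_small]
    try norm_num
  exact hrec n

theorem two_mul_card_halfWords_even (k : ℕ) :
    2 * (halfWords (2 * k)).card = 2 ^ (2 * k) + 2 ^ k := by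
  rw [card_halfWords, card_fixed_even]

theorem two_mul_card_halfWords_odd (k : ℕ) :
    2 * (halfWords (2 * k + 1)).card = 2 ^ (2 * k + 1) := by
  rw [card_halfWords, card_fixed_odd, add_zero]

theorem profile_G1_closed (m : ℕ) : profile (age G1) (m + 2) = 2 ^ m + 2 ^ (m / 2) := by
  have h : ∀ k, 1 + ∑ i ∈ Finset.range (2 * k + 1), (halfWords i).card = 2 ^ (2 * k) + 2 ^ k ∧
      1 + ∑ i ∈ Finset.range (2 * k + 2), (halfWords i).card = 2 ^ (2 * k + 1) + 2 ^ k := by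
    intro k
    induction k with
    | zero =>
      have h0 := two_mul_card_halfWords_even 0
      have h1 := two_mul_card_halfWords_odd 0
      simp only [Finset.sum_range_succ, Finset.sum_range_zero]
      norm_num at h0 h1 ⊢
      omega
    | succ k ih =>
      have h0 := two_mul_card_halfWords_even (k + 1)
      have h1 := two_mul_card_halfWords_odd (k + 1)
      have h2 : 1 + ∑ i ∈ Finset.range (2 * (k + 1) + 1), (halfWords i).card =
          2 ^ (2 * (k + 1)) + 2 ^ (k + 1) := by
        rw [Finset.sum_range_succ, ← add_assoc, show 2 * (k + 1) = 2 * k + 2 by ring, ih.2]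
        rw [show 2 * (k + 1) = 2 * k + 2 by ring] at h0
        rw [pow_succ 2 (2 * k + 1), pow_succ 2 k] at h0 ⊢
        omega
      refine ⟨h2, ?_⟩
      rw [show 2 * (k + 1) + 2 = (2 * (k + 1) + 1) + 1 by ring, Finset.sum_range_succ, ← add_assoc,
        h2]
      rw [pow_succ 2 (2 * (k + 1))] at h1 ⊢
      omega
  rw [profile_G1]
  obtain ⟨k, rfl | rfl⟩ := Nat.even_or_odd' m
  · rw [(h k).1, Nat.mul_div_cancel_left k two_pos]
  · rw [(h k).2, show (2 * k + 1) / 2 = k by omega]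

theorem profile_G1_small : profile (age G1) 0 = 1 ∧ profile (age G1) 1 = 1 ∧
    profile (age G1) 2 = 2 ∧ profile (age G1) 3 = 3 ∧ profile (age G1) 4 = 6 ∧
    profile (age G1) 5 = 10 :=
  ⟨profile_zero _, profile_one _, profile_G1_closed 0, profile_G1_closed 1, profile_G1_closed 2,
    profile_G1_closed 3⟩

theorem genFun_G1 : genFun (age G1) =
    (1 - X - 2 * X ^ 2 + X ^ 3) * ((1 - 2 * X) * (1 - 2 * X ^ 2))⁻¹ := by
  rw [PowerSeries.eq_mul_inv_iff_mul_eq (by simp)]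
  have hD : genFun (age G1) * ((1 - 2 * X) * (1 - 2 * X ^ 2)) = genFun (age G1) -
      2 * (genFun (age G1) * X ^ 1) - 2 * (genFun (age G1) * X ^ 2) +
        4 * (genFun (age G1) * X ^ 3) := by ring
  have hrec : ∀ n, (profile (age G1) (n + 5) : ℚ) - 2 * profile (age G1) (n + 4) -
      2 * profile (age G1) (n + 3) + 4 * profile (age G1) (n + 2) = 0 := by
    intro n
    rw [show n + 5 = (n + 3) + 2 by ring, show n + 4 = (n + 2) + 2 by ring,
      show n + 3 = (n + 1) + 2 by ring, profile_G1_closed, profile_G1_closed, profile_G1_closed,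
      profile_G1_closed, show (n + 1 + 2) / 2 = (n + 1) / 2 + 1 by omega,
      show (n + 2) / 2 = n / 2 + 1 by omega]
    push_cast
    ring
  rw [hD]
  ext n
  rcases n with _ | _ | _ | _ | _ | n
  all_goals
    simp only [map_add, map_sub, coeff_ofNat_mul, coeff_genFun_mul_X_pow, coeff_genFun,
      PowerSeries.coeff_X_pow, PowerSeries.coeff_X, PowerSeries.coeff_one]
    simp [profile_G1_small]
    try norm_num
  exact hrec n

theorem profile_G5_closed (j : ℕ) : (profile (age G5) (j + 5) : ℚ) = 2 ^ (j + 5) - 6 := by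
  have h1 : 6 ≤ 2 ^ (j + 2 + 2) :=
    le_trans (by norm_num) (Nat.pow_le_pow_right two_pos (show 4 ≤ j + 2 + 2 by omega))
  rw [profile_G5 (j + 2), min_eq_right (by omega)]
  push_cast [h1]
  ring

theorem profile_G5_small : profile (age G5) 0 = 1 ∧ profile (age G5) 1 = 1 ∧
    profile (age G5) 2 = 2 ∧ profile (age G5) 3 = 4 ∧ profile (age G5) 4 = 11 ∧
    profile (age G5) 5 = 26 ∧ profile (age G5) 6 = 58 := by
  refine ⟨profile_zero _, profile_one _, profile_two ⟨.inr (), .inl (0, 1), by simp [G5]⟩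
    ⟨.inl (0, 1), .inl (1, 1), by simp, by simp [G5]⟩, ?_, ?_, ?_, ?_⟩
  · simpa using profile_G5 0
  · simpa using profile_G5 1
  · simpa using profile_G5 2
  · simpa using profile_G5 3

theorem genFun_G5 : genFun (age G5) =
    (1 - 2 * X + X ^ 2 + 3 * X ^ 4 + X ^ 5 + 2 * X ^ 6) * ((1 - X) * (1 - 2 * X))⁻¹ := by
  rw [PowerSeries.eq_mul_inv_iff_mul_eq (by simp)]
  have hD : genFun (age G5) * ((1 - X) * (1 - 2 * X)) = genFun (age G5) -
      3 * (genFun (age G5) * X ^ 1) + 2 * (genFun (age G5) * X ^ 2) := by ring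
  have hrec : ∀ n, (profile (age G5) (n + 7) : ℚ) - 3 * profile (age G5) (n + 6) +
      2 * profile (age G5) (n + 5) = 0 := by
    intro n
    rw [show n + 7 = (n + 2) + 5 by ring, show n + 6 = (n + 1) + 5 by ring, profile_G5_closed,
      profile_G5_closed, profile_G5_closed]
    ring
  rw [hD]
  ext n
  rcases n with _ | _ | _ | _ | _ | _ | _ | n
  all_goals
    simp only [map_add, map_sub, coeff_ofNat_mul, coeff_genFun_mul_X_pow, coeff_genFun,
      PowerSeries.coeff_X_pow, PowerSeries.coeff_X, PowerSeries.coeff_one]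
    simp [profile_G5_small]
    try norm_num
  exact hrec n


/-! ### Asymptotics -/

theorem isEquivalent_G0 :
    (fun n => (profile (age G0) n : ℝ)) ~[atTop] fun n : ℕ => 1 / 8 * (n : ℝ) ^ 2 := by
  simpa using isEquivalent_of_parity (by norm_num) profile_G0_even profile_G0_odd

theorem isEquivalent_G3 :
    (fun n => (profile (age G3) n : ℝ)) ~[atTop] fun n : ℕ => 1 / 4 * (n : ℝ) ^ 2 := by
  simpa using isEquivalent_of_parity (by norm_num) profile_G3_even profile_G3_odd

theorem isEquivalent_G4 :
    (fun n => (profile (age G4) n : ℝ)) ~[atTop] fun n : ℕ => 1 / 4 * (n : ℝ) ^ 2 := by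
  simpa using isEquivalent_of_parity (by norm_num) profile_G4_even profile_G4_odd

theorem isEquivalent_G1 :
    (fun n => (profile (age G1) n : ℝ)) ~[atTop] fun n : ℕ => 1 / 4 * (2 : ℝ) ^ n := by
  refine isEquivalent_two_pow (C := 1) (by norm_num) ?_
  filter_upwards [eventually_ge_atTop 2] with n hn
  obtain ⟨m, rfl⟩ := Nat.exists_eq_add_of_le' hn
  rw [profile_G1_closed]
  push_cast
  rw [pow_add (2 : ℝ) m 2, show (2 : ℝ) ^ m + 2 ^ (m / 2) - 1 / 4 * (2 ^ m * 2 ^ 2) = 2 ^ (m / 2) by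
    ring, abs_of_nonneg (by positivity), one_mul]
  exact (two_pow_half_le m).trans (pow_le_pow_right₀ (by norm_num) (by omega))

theorem isEquivalent_G5 :
    (fun n => (profile (age G5) n : ℝ)) ~[atTop] fun n : ℕ => 1 * (2 : ℝ) ^ n := by
  refine isEquivalent_two_pow (C := 6) (by norm_num) ?_
  filter_upwards [eventually_ge_atTop 5] with n hn
  obtain ⟨m, rfl⟩ := Nat.exists_eq_add_of_le' hn
  have h1 : (profile (age G5) (m + 5) : ℝ) = 2 ^ (m + 5) - 6 := by
    exact_mod_cast congrArg (Rat.cast : ℚ → ℝ) (profile_G5_closed m)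
  have h2 : (1 : ℝ) ≤ (3 / 2) ^ (m + 5) := one_le_pow₀ (by norm_num)
  rw [h1, show (2 : ℝ) ^ (m + 5) - 6 - 1 * 2 ^ (m + 5) = -6 by ring]
  norm_num
  linarith

theorem isEquivalent_G6 :
    (fun n => (profile (age G6) n : ℝ)) ~[atTop] fun n : ℕ => 3 / 4 * (2 : ℝ) ^ n := by
  refine isEquivalent_two_pow (C := 2) (by norm_num) ?_
  filter_upwards [eventually_ge_atTop 2] with n hn
  obtain ⟨m, rfl⟩ := Nat.exists_eq_add_of_le' hn
  have h1 : (profile (age G6) (m + 2) : ℝ) = 3 * 2 ^ m - (m + 1) := by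
    exact_mod_cast congrArg (Rat.cast : ℚ → ℝ) (profile_G6_closed m)
  -- Bernoulli's inequality bounds the linear error `m + 1` by `2 (3 / 2) ^ (m + 2)`.
  have h2 := one_add_mul_le_pow (a := (1 / 2 : ℝ)) (by norm_num) (m + 2)
  rw [show (1 : ℝ) + 1 / 2 = 3 / 2 by norm_num] at h2
  push_cast at h2
  rw [h1, pow_add (2 : ℝ) m 2,
    show 3 * (2 : ℝ) ^ m - (m + 1) - 3 / 4 * (2 ^ m * 2 ^ 2) = -(m + 1) by ring, abs_neg,
    abs_of_nonneg (by positivity)]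
  linarith

/-! ### The list of graphs -/

theorem image_graphList :
    (fun G : Σ V : Type, SimpleGraph V => genFun (age G.2)) '' graphList =
      Set.range fun i => genFun (age (graphFamily i).2) := by
  have e5 : genFun (age G5') = genFun (age G5) := by rw [age_G5']
  have e6 : genFun (age G6') = genFun (age G6) := by rw [age_G6']
  have hr : (Set.range fun i => genFun (age (graphFamily i).2)) =
      {genFun (age G0), genFun (age G1), genFun (age G2), genFun (age G3), genFun (age G4),
        genFun (age G5), genFun (age G6)} := by
    ext F
    simp only [Set.mem_range, Fin.exists_fin_succ, Set.mem_insert_iff, Set.mem_singleton_iff]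
    simp [graphFamily, eq_comm]
  rw [hr, graphList]
  simp only [Set.image_insert_eq, Set.image_singleton, genFun_compl, e5, e6]
  ext F
  simp only [Set.mem_insert_iff, Set.mem_singleton_iff]
  tauto

/-! ### Rationality and distinctness -/

theorem isRational_of_eq {F : PowerSeries ℚ} (P Q : Polynomial ℚ)
    (h : F = (P : PowerSeries ℚ) * (Q : PowerSeries ℚ)⁻¹) (hQ : Q.coeff 0 ≠ 0) : IsRational F :=
  ⟨P, Q, hQ, h⟩

theorem isRational_genFun_graphFamily (i : Fin 7) :
    IsRational (genFun (age (graphFamily i).2)) ↔ i ≠ 2 := by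
  have h2 : ((2 : Polynomial ℚ) : PowerSeries ℚ) = 2 :=
    map_ofNat (Polynomial.coeToPowerSeries.ringHom (R := ℚ)) 2
  have h3 : ((3 : Polynomial ℚ) : PowerSeries ℚ) = 3 :=
    map_ofNat (Polynomial.coeToPowerSeries.ringHom (R := ℚ)) 3
  fin_cases i
  · refine iff_of_true ?_ (by decide)
    refine isRational_of_eq (1 - Polynomial.X ^ 2 + Polynomial.X ^ 3 + 2 * Polynomial.X ^ 4 - 2 * Polynomial.X ^ 5 - Polynomial.X ^ 6 + Polynomial.X ^ 7)
      ((1 - Polynomial.X) * (1 - Polynomial.X ^ 2) ^ 2) (genFun_G0.trans ?_) (by simp [Polynomial.coeff_zero_eq_eval_zero])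
    push_cast
    rw [h2]
  · refine iff_of_true ?_ (by decide)
    refine isRational_of_eq (1 - Polynomial.X - 2 * Polynomial.X ^ 2 + Polynomial.X ^ 3) ((1 - 2 * Polynomial.X) * (1 - 2 * Polynomial.X ^ 2))
      (genFun_G1.trans ?_) (by simp [Polynomial.coeff_zero_eq_eval_zero])
    push_cast
    rw [h2]
  · exact iff_of_false not_isRational_genFun_G2 (by simp)
  · refine iff_of_true ?_ (by decide)
    refine isRational_of_eq (1 - Polynomial.X + Polynomial.X ^ 3 + Polynomial.X ^ 4 - Polynomial.X ^ 6) ((1 - Polynomial.X) ^ 2 * (1 - Polynomial.X ^ 2))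
      (genFun_G3.trans ?_) (by simp [Polynomial.coeff_zero_eq_eval_zero])
    push_cast
    rfl
  · refine iff_of_true ?_ (by decide)
    refine isRational_of_eq (1 - Polynomial.X + 2 * Polynomial.X ^ 3 - Polynomial.X ^ 5) ((1 - Polynomial.X) ^ 3 * (1 + Polynomial.X))
      (genFun_G4.trans ?_) (by simp [Polynomial.coeff_zero_eq_eval_zero])
    push_cast
    rw [h2]
  · refine iff_of_true ?_ (by decide)
    refine isRational_of_eq (1 - 2 * Polynomial.X + Polynomial.X ^ 2 + 3 * Polynomial.X ^ 4 + Polynomial.X ^ 5 + 2 * Polynomial.X ^ 6)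
      ((1 - Polynomial.X) * (1 - 2 * Polynomial.X)) (genFun_G5.trans ?_) (by simp [Polynomial.coeff_zero_eq_eval_zero])
    push_cast
    rw [h2, h3]
  · refine iff_of_true ?_ (by decide)
    refine isRational_of_eq (1 - 3 * Polynomial.X + 3 * Polynomial.X ^ 2 - Polynomial.X ^ 3 + Polynomial.X ^ 4) ((1 - 2 * Polynomial.X) * (1 - Polynomial.X) ^ 2)
      (genFun_G6.trans ?_) (by simp [Polynomial.coeff_zero_eq_eval_zero])
    push_cast
    rw [h2, h3]

theorem injective_genFun_graphFamily :
    Function.Injective fun i => genFun (age (graphFamily i).2) := by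
  have h6 : profile (age G6) 4 = 9 ∧ profile (age G6) 5 = 20 := ⟨profile_G6 2, profile_G6 3⟩
  have h : ∀ i, i ≠ 2 →
      (profile (age (graphFamily i).2) 4, profile (age (graphFamily i).2) 5) =
        (![(6, 6), (6, 10), (0, 0), (6, 9), (7, 10), (11, 26), (9, 20)] : Fin 7 → ℕ × ℕ) i := by
    intro i hi
    fin_cases i
    · simp [graphFamily, profile_G0_small]
    · simp [graphFamily, profile_G1_small]
    · exact (hi rfl).elim
    · simp [graphFamily, profile_G3_small]
    · simp [graphFamily, profile_G4_small]
    · simp [graphFamily, profile_G5_small]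
    · simp [graphFamily, h6]
  have hinj : Function.Injective
      (![(6, 6), (6, 10), (0, 0), (6, 9), (7, 10), (11, 26), (9, 20)] : Fin 7 → ℕ × ℕ) := by
    decide
  intro i j hij
  have hp : ∀ n, profile (age (graphFamily i).2) n = profile (age (graphFamily j).2) n := by
    intro n
    have := congrArg (PowerSeries.coeff n) hij
    simpa [genFun] using this
  have hi := isRational_genFun_graphFamily i
  have hj := isRational_genFun_graphFamily j
  have hij' : genFun (age (graphFamily i).2) = genFun (age (graphFamily j).2) := hij
  rw [hij', hj, not_iff_not] at hi
  by_cases hi2 : i = 2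
  · rw [hi2, hi.2 hi2]
  · refine hinj ?_
    rw [← h i hi2, ← h j fun hj2 => hi2 (hi.1 hj2), hp, hp]

end GraphAge

theorem mainTheorem10 :
    -- the generating functions of the graphs of the list are those of `G_0, …, G_6`
    ((fun G : Σ V : Type, SimpleGraph V => genFun (age G.2)) '' graphList =
      Set.range fun i => genFun (age (graphFamily i).2)) ∧
    (genFun (age G0ᶜ) = genFun (age G0) ∧
      genFun (age G1ᶜ) = genFun (age G1) ∧
      genFun (age G2ᶜ) = genFun (age G2) ∧
      genFun (age G3ᶜ) = genFun (age G3) ∧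
      genFun (age G4ᶜ) = genFun (age G4) ∧
      genFun (age G5') = genFun (age G5) ∧
      genFun (age G6') = genFun (age G6) ∧
      genFun (age G6ᶜ) = genFun (age G6) ∧
      genFun (age G6'ᶜ) = genFun (age G6)) ∧
    -- `G_0`
    (genFun (age G0) =
        (1 - X ^ 2 + X ^ 3 + 2 * X ^ 4 - 2 * X ^ 5 - X ^ 6 + X ^ 7) *
          ((1 - X) * (1 - X ^ 2) ^ 2)⁻¹ ∧
      (fun n => (profile (age G0) n : ℝ)) ~[atTop] fun n : ℕ => (n : ℝ) ^ 2 / 8) ∧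
    -- `G_1`
    (genFun (age G1) =
        (1 - X - 2 * X ^ 2 + X ^ 3) * ((1 - 2 * X) * (1 - 2 * X ^ 2))⁻¹ ∧
      (fun n => (profile (age G1) n : ℝ)) ~[atTop] fun n : ℕ => (2 : ℝ) ^ n / 4) ∧
    -- `G_2`
    (HasProd (fun k : ℕ => ((1 - X ^ (k + 1))⁻¹ : PowerSeries ℚ)) (genFun (age G2)) ∧
      ∀ n, profile (age G2) n = Fintype.card (Nat.Partition n)) ∧
    -- `G_3`
    (genFun (age G3) =
        (1 - X + X ^ 3 + X ^ 4 - X ^ 6) * ((1 - X) ^ 2 * (1 - X ^ 2))⁻¹ ∧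
      (fun n => (profile (age G3) n : ℝ)) ~[atTop] fun n : ℕ => (n : ℝ) ^ 2 / 4) ∧
    -- `G_4`
    (genFun (age G4) =
        (1 - X + 2 * X ^ 3 - X ^ 5) * ((1 - X) ^ 3 * (1 + X))⁻¹ ∧
      (fun n => (profile (age G4) n : ℝ)) ~[atTop] fun n : ℕ => (n : ℝ) ^ 2 / 4) ∧
    -- `G_5`
    (genFun (age G5) =
        (1 - 2 * X + X ^ 2 + 3 * X ^ 4 + X ^ 5 + 2 * X ^ 6) * ((1 - X) * (1 - 2 * X))⁻¹ ∧
      (fun n => (profile (age G5) n : ℝ)) ~[atTop] fun n : ℕ => (2 : ℝ) ^ n) ∧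
    -- `G_6`
    (genFun (age G6) =
        (1 - 3 * X + 3 * X ^ 2 - X ^ 3 + X ^ 4) * ((1 - 2 * X) * (1 - X) ^ 2)⁻¹ ∧
      (fun n => (profile (age G6) n : ℝ)) ~[atTop] fun n : ℕ => 3 * (2 : ℝ) ^ n / 4) ∧
    -- the seven generating functions are distinct, and all but that of `G_2` are rational
    (Function.Injective fun i => genFun (age (graphFamily i).2)) ∧
    (∀ i, IsRational (genFun (age (graphFamily i).2)) ↔ i ≠ 2) ∧
    -- types of growth
    (∀ i ∈ ({0, 3, 4} : Set (Fin 7)),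
      HasPolynomialGrowth 2 (profile (age (graphFamily i).2)) ∧
      IsQuasiPolynomial 2 (profile (age (graphFamily i).2))) ∧
    (∀ i ∈ ({1, 5, 6} : Set (Fin 7)),
      HasExponentialGrowth (profile (age (graphFamily i).2))) ∧
    HasSubexponentialGrowth (profile (age G2)) := by
  have cc := @genFun_compl
  have e5 : genFun (age G5') = genFun (age G5) := by rw [age_G5']
  have e6 : genFun (age G6') = genFun (age G6) := by rw [age_G6']
  refine ⟨image_graphList, ⟨cc _, cc _, cc _, cc _, cc _, e5, e6, cc _, by rw [cc, e6]⟩,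
    ⟨genFun_G0, ?_⟩, ⟨genFun_G1, ?_⟩, ⟨hasProd_genFun_G2, profile_G2⟩, ⟨genFun_G3, ?_⟩,
    ⟨genFun_G4, ?_⟩, ⟨genFun_G5, ?_⟩, ⟨genFun_G6, ?_⟩, injective_genFun_graphFamily,
    isRational_genFun_graphFamily, ?_, ?_, hasSubexponentialGrowth_G2⟩
  · exact isEquivalent_G0.congr_right (.of_forall fun n => by ring)
  · exact isEquivalent_G1.congr_right (.of_forall fun n => by ring)
  · exact isEquivalent_G3.congr_right (.of_forall fun n => by ring)
  · exact isEquivalent_G4.congr_right (.of_forall fun n => by ring)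
  · exact isEquivalent_G5.congr_right (.of_forall fun n => by ring)
  · exact isEquivalent_G6.congr_right (.of_forall fun n => by ring)
  · rintro i (rfl | rfl | rfl)
    · exact ⟨hasPolynomialGrowth_of_isEquivalent (by norm_num) isEquivalent_G0,
        isQuasiPolynomial_of_parity (by norm_num) profile_G0_even profile_G0_odd⟩
    · exact ⟨hasPolynomialGrowth_of_isEquivalent (by norm_num) isEquivalent_G3,
        isQuasiPolynomial_of_parity (by norm_num) profile_G3_even profile_G3_odd⟩
    · exact ⟨hasPolynomialGrowth_of_isEquivalent (by norm_num) isEquivalent_G4,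
        isQuasiPolynomial_of_parity (by norm_num) profile_G4_even profile_G4_odd⟩
  · rintro i (rfl | rfl | rfl)
    · exact hasExponentialGrowth_of_isEquivalent (by norm_num) isEquivalent_G1
    · exact hasExponentialGrowth_of_isEquivalent (by norm_num) isEquivalent_G5
    · exact hasExponentialGrowth_of_isEquivalent (by norm_num) isEquivalent_G6
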